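/- Let $k$ be an arbitrary field. For a finite dimensional $k$-algebra $A$ let $\mathrm{HH}^\bullet(A)$ denote its Hochschild cohomology ring, let $\mathrm{Jac}(A)$ be its Jacobson radical and, for a left $A$-module $M$, let $\varphi_M=-\otimes_A M:\mathrm{HH}^\bullet(A)\to\mathrm{Ext}_A^\bullet(M,M)$ be the canonical homomorphism of graded rings. We say that $A$ satisfies (fg1) and (fg2) if there is a graded subalgebra $H^\bullet\subseteq\mathrm{HH}^\bullet(A)$ such that (fg1) $H^\bullet$ is a finitely generated commutative $k$-algebra and $H^0=\mathrm{HH}^0(A)$; (fg2) $\mathrm{Ext}_A^\bullet(A/\mathrm{Jac}(A),A/\mathrm{Jac}(A))$ is a finitely generated $H^\bullet$-module, where $H^\bullet$ acts through $\varphi_{A/\mathrm{Jac}(A)}$. For a finite dimensional $A$-module $M$ with minimal projective resolution $\cdots\to P_1\to P_0\to M\to 0$, the complexity $\mathrm{cx}_A(M)\in\{0,1,2,\dots\}\cup\{\infty\}$ is the smallest integer $c\ge 0$ for which there is a real number $b$ such that $\dim_k P_n\le b\,n^{c-1}$ for all integers $n\ge 1$, and it is $\infty$ if there is no such $c$. An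 augmented $k$-algebra is a $k$-algebra $A$ with a $k$-algebra homomorphism $\varepsilon_A:A\to k$; its trivial module is $k$, on which $A$ acts through $\varepsilon_A$. Let $A$ and $A'$ be finite dimensional self-injective augmented $k$-algebras, each satisfying (fg1) and (fg2), and let $A\otimes A'=A\otimes_k A'$ be augmented by $a\otimes a'\mapsto\varepsilon_A(a)\,\varepsilon_{A'}(a')$. Then $$\mathrm{cx}_{A\otimes A'}(k)=\mathrm{cx}_A(k)+\mathrm{cx}_{A'}(k).$$ -/

import Mathlib

open scoped TensorProduct DirectSum

universe u v w

noncomputable section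

namespace HochschildTheory

variable {k : Type u} {A : Type v} {R : Type w} [Field k] [Ring A] [Algebra k A]
  [Ring R] [Algebra k R]

/-! ### Subquotients -/

section Subquotient

variable {M N P : Type*} [AddCommGroup M] [Module k M] [AddCommGroup N] [Module k N]
  [AddCommGroup P] [Module k P]

/-- The subquotient `Z / (Z ∩ B)` of a module. -/
def Subquotient (Z B : Submodule k M) : Type _ := Z ⧸ B.submoduleOf Z

instance (Z B : Submodule k M) : AddCommGroup (Subquotient Z B) :=
  inferInstanceAs (AddCommGroup (Z ⧸ B.submoduleOf Z))

instance (Z B : Submodule k M) : Module k (Subquotient Z B) :=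
  inferInstanceAs (Module k (Z ⧸ B.submoduleOf Z))

/-- The class of an element of `Z`. -/
def Subquotient.mk (Z B : Submodule k M) : Z →ₗ[k] Subquotient Z B :=
  (B.submoduleOf Z).mkQ

theorem Subquotient.mk_surjective (Z B : Submodule k M) :
    Function.Surjective (Subquotient.mk Z B) :=
  Submodule.mkQ_surjective _

theorem Subquotient.mk_eq_zero (Z B : Submodule k M) {z : Z} :
    Subquotient.mk Z B z = 0 ↔ z.1 ∈ B :=
  Submodule.Quotient.mk_eq_zero _

/-- A linear map on `Z` that vanishes on `Z ∩ B` descends to the subquotient. -/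
def Subquotient.lift (Z B : Submodule k M) (F : Z →ₗ[k] P) (h : ∀ z : Z, z.1 ∈ B → F z = 0) :
    Subquotient Z B →ₗ[k] P :=
  (B.submoduleOf Z).liftQ F h

/-- A bilinear map that vanishes when one argument is in `B` descends to the subquotients. -/
def Subquotient.lift₂ (Z B : Submodule k M) (Z' B' : Submodule k N) (F : Z →ₗ[k] Z' →ₗ[k] P)
    (h : ∀ (z : Z) (z' : Z'), z.1 ∈ B → F z z' = 0)
    (h' : ∀ (z : Z) (z' : Z'), z'.1 ∈ B' → F z z' = 0) :
    Subquotient Z B →ₗ[k] Subquotient Z' B' →ₗ[k] P :=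
  (Subquotient.lift Z' B' (Subquotient.lift Z B F fun z hz => LinearMap.ext fun z' => h z z' hz).flip
    fun z' hz' => LinearMap.ext fun x => by
      obtain ⟨z, rfl⟩ := Subquotient.mk_surjective Z B x
      exact h' z z' hz').flip

end Subquotient

/-! ### Hochschild cohomology with coefficients in an algebra -/

variable (k A R) in
/-- Hochschild cochains of degree `n`: the `k`-multilinear maps `A ^ n → R`, that is
`Hom_k (A^{⊗ n}, R)`. -/
abbrev Cochain (n : ℕ) : Type (max v w) := MultilinearMap k (fun _ : Fin n => A) R

theorem contractNth_update {n : ℕ} (j : Fin n) (a : Fin (n + 1) → A) (i : Fin (n + 1)) :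
    ∃ (p : Fin n) (L : A →ₗ[k] A), ∀ x : A,
      Fin.contractNth j.castSucc (· * ·) (Function.update a i x) =
        Function.update (Fin.contractNth j.castSucc (· * ·) a) p (L x) := by
  rcases lt_trichotomy i.val j.val with h | h | h
  · refine ⟨⟨i, by omega⟩, LinearMap.id, fun x => funext fun q => ?_⟩
    simp only [Fin.contractNth, Function.update_apply, Fin.ext_iff, Fin.val_castSucc,
      Fin.val_succ, LinearMap.id_apply]
    split_ifs <;> first | rfl | omega
  · refine ⟨j, LinearMap.mulRight k (a j.succ), fun x => funext fun q => ?_⟩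
    simp only [Fin.contractNth, Function.update_apply, Fin.ext_iff, Fin.val_castSucc,
      Fin.val_succ, LinearMap.mulRight_apply]
    split_ifs with h1 h2 h3 h4 h5 h6 <;> first | rfl | omega | skip
    rw [show q = j from Fin.ext (by omega)]
  · rcases Nat.lt_or_ge (j.val + 1) i.val with h' | h'
    · refine ⟨⟨i - 1, by omega⟩, LinearMap.id, fun x => funext fun q => ?_⟩
      simp only [Fin.contractNth, Function.update_apply, Fin.ext_iff, Fin.val_castSucc,
        Fin.val_succ, LinearMap.id_apply]
      split_ifs <;> first | rfl | omega
    · refine ⟨j, LinearMap.mulLeft k (a j.castSucc), fun x => funext fun q => ?_⟩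
      simp only [Fin.contractNth, Function.update_apply, Fin.ext_iff, Fin.val_castSucc,
        Fin.val_succ, LinearMap.mulLeft_apply]
      split_ifs with h1 h2 h3 h4 h5 h6 <;> first | rfl | omega | skip
      rw [show q = j from Fin.ext (by omega)]

/-- `(a₀, …, aₙ) ↦ f (a₀, …, aⱼ aⱼ₊₁, …, aₙ)`. -/
def Cochain.contract {n : ℕ} (f : Cochain k A R n) (j : Fin n) : Cochain k A R (n + 1) where
  toFun a := f (Fin.contractNth j.castSucc (· * ·) a)
  map_update_add' {inst} a i x y := by
    rw [Subsingleton.elim inst (instDecidableEqFin (n + 1))]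
    obtain ⟨p, L, h⟩ := contractNth_update (k := k) j a i
    simp [h]
  map_update_smul' {inst} a i c x := by
    rw [Subsingleton.elim inst (instDecidableEqFin (n + 1))]
    obtain ⟨p, L, h⟩ := contractNth_update (k := k) j a i
    simp [h]

/-- `(a₀, …, aₙ) ↦ ρ(a₀) f (a₁, …, aₙ)`. -/
def Cochain.leftMul (ρ : A →ₐ[k] R) {n : ℕ} (f : Cochain k A R n) : Cochain k A R (n + 1) :=
  LinearMap.uncurryLeft (M := fun _ : Fin (n + 1) => A)
    { toFun := fun a => (LinearMap.mulLeft k (ρ a)).compMultilinearMap f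
      map_add' := fun a b => by ext; simp [add_mul]
      map_smul' := fun c a => by ext; simp }

/-- `(a₀, …, aₙ) ↦ f (a₀, …, aₙ₋₁) ρ(aₙ)`. -/
def Cochain.rightMul (ρ : A →ₐ[k] R) {n : ℕ} (f : Cochain k A R n) : Cochain k A R (n + 1) :=
  MultilinearMap.uncurryRight (M := fun _ : Fin (n + 1) => A)
    (((LinearMap.mul k R).compl₂ ρ.toLinearMap).compMultilinearMap f)

/-- The Hochschild differential, `R` being an `A`-bimodule through `ρ : A → R`:
`(δ f)(a₀, …, aₙ) = ρ(a₀) f(a₁, …, aₙ) + ∑_{j < n} (-1)^{j+1} f(a₀, …, aⱼ aⱼ₊₁, …, aₙ)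
+ (-1)^{n+1} f(a₀, …, aₙ₋₁) ρ(aₙ)`. -/
def differential (ρ : A →ₐ[k] R) (n : ℕ) : Cochain k A R n →ₗ[k] Cochain k A R (n + 1) where
  toFun f := f.leftMul ρ + ∑ j : Fin n, (-1 : k) ^ (j.val + 1) • f.contract j +
    (-1 : k) ^ (n + 1) • f.rightMul ρ
  map_add' f g := by
    ext a
    simp [Cochain.leftMul, Cochain.contract, Cochain.rightMul, Finset.sum_add_distrib]
    abel
  map_smul' c f := by
    ext a
    simp [Cochain.leftMul, Cochain.contract, Cochain.rightMul, Finset.smul_sum,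
      smul_comm c]

theorem differential_apply (ρ : A →ₐ[k] R) (n : ℕ) (f : Cochain k A R n) (a : Fin (n + 1) → A) :
    differential ρ n f a = ρ (a 0) * f (fun i => a i.succ) +
      ∑ j : Fin n, (-1 : k) ^ (j.val + 1) • f (Fin.contractNth j.castSucc (· * ·) a) +
      (-1 : k) ^ (n + 1) • (f (fun i => a i.castSucc) * ρ (a (Fin.last n))) := by
  simp [differential, Cochain.leftMul, Cochain.contract, Cochain.rightMul]
  rfl

/-- The cup product `(f ∪ g)(a₁, …, aₘ₊ₙ) = f(a₁, …, aₘ) g(aₘ₊₁, …, aₘ₊ₙ)`. -/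
def Cochain.cup {m n : ℕ} (f : Cochain k A R m) (g : Cochain k A R n) : Cochain k A R (m + n) :=
  (LinearMap.mul' k R).compMultilinearMap ((f.domCoprod g).domDomCongr finSumFinEquiv)

theorem Cochain.cup_apply {m n : ℕ} (f : Cochain k A R m) (g : Cochain k A R n)
    (a : Fin (m + n) → A) :
    f.cup g a = f (fun i => a (Fin.castAdd n i)) * g (fun j => a (Fin.natAdd m j)) := by
  simp [Cochain.cup, MultilinearMap.domCoprod_apply]

theorem differential_cup (ρ : A →ₐ[k] R) {m n : ℕ} (f : Cochain k A R m) (g : Cochain k A R n)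
    (a : Fin (m + n + 1) → A) :
    differential ρ (m + n) (f.cup g) a =
      (differential ρ m f).cup g (fun i => a (Fin.cast (by omega) i)) +
        (-1 : k) ^ m • f.cup (differential ρ n g) a := by
  rw [Cochain.cup_apply, Cochain.cup_apply (g := differential ρ n g), differential_apply,
    differential_apply, differential_apply, Fin.sum_univ_add]
  simp only [Cochain.cup_apply]
  have hf0 : (fun i : Fin m => a (Fin.castAdd n i).succ) =
      fun i => a (Fin.cast (by omega) (Fin.castAdd n i.succ)) := by
    funext i; exact congrArg a (Fin.ext (by simp))
  have hg0 : (fun j : Fin n => a (Fin.natAdd m j).succ) =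
      fun j => a (Fin.cast (by omega) (Fin.natAdd (m + 1) j)) := by
    funext i; exact congrArg a (Fin.ext (by simp; omega))
  have hg1 : (fun j : Fin n => a (Fin.natAdd m j.succ)) =
      fun j => a (Fin.cast (by omega) (Fin.natAdd (m + 1) j)) := by
    funext i; exact congrArg a (Fin.ext (by simp; omega))
  have hf1 : (fun i : Fin m => a (Fin.castAdd n i).castSucc) =
      fun i => a (Fin.castAdd (n + 1) i) := by
    funext i; exact congrArg a (Fin.ext (by simp))
  have hf2 : (fun i : Fin m => a (Fin.cast (by omega) (Fin.castAdd n i.castSucc))) =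
      fun i => a (Fin.castAdd (n + 1) i) := by
    funext i; exact congrArg a (Fin.ext (by simp))
  have hc : ∀ j : Fin m, (fun i : Fin m =>
      Fin.contractNth (Fin.castAdd n j).castSucc (· * ·) a (Fin.castAdd n i)) =
      Fin.contractNth j.castSucc (· * ·)
        (fun i => a (Fin.cast (by omega) (Fin.castAdd n i))) := by
    intro j; funext i
    simp only [Fin.contractNth, Fin.val_castSucc, Fin.val_castAdd]
    rfl
  have hc' : ∀ j : Fin m, (fun i : Fin n =>
      Fin.contractNth (Fin.castAdd n j).castSucc (· * ·) a (Fin.natAdd m i)) =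
      fun i => a (Fin.cast (by omega) (Fin.natAdd (m + 1) i)) := by
    intro j; funext i
    rw [Fin.contractNth_apply_of_gt _ _ _ _ (by simp; omega)]
    exact congrFun hg0 i
  have hd : ∀ j : Fin n, (fun i : Fin m =>
      Fin.contractNth (Fin.natAdd m j).castSucc (· * ·) a (Fin.castAdd n i)) =
      fun i => a (Fin.castAdd (n + 1) i) := by
    intro j; funext i
    rw [Fin.contractNth_apply_of_lt _ _ _ _ (by simp; omega)]
    exact congrFun hf1 i
  have hd' : ∀ j : Fin n, (fun i : Fin n =>
      Fin.contractNth (Fin.natAdd m j).castSucc (· * ·) a (Fin.natAdd m i)) =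
      Fin.contractNth j.castSucc (· * ·) (fun i => a (Fin.natAdd m i)) := by
    intro j; funext i
    simp only [Fin.contractNth, Fin.val_castSucc, Fin.val_natAdd, Nat.add_lt_add_iff_left,
      Nat.add_left_cancel_iff]
    rfl
  have hg2 : (fun i : Fin n => a (Fin.natAdd m i).castSucc) =
      fun i => a (Fin.natAdd m i.castSucc) := rfl
  have e0 : (Fin.cast (by omega) (Fin.castAdd n (0 : Fin (m + 1))) : Fin (m + n + 1)) = 0 :=
    Fin.ext (by simp)
  have e1 : (Fin.cast (by omega) (Fin.castAdd n (Fin.last m)) : Fin (m + n + 1)) =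
      Fin.natAdd m (0 : Fin (n + 1)) := Fin.ext (by simp)
  have e2 : (Fin.natAdd m (Fin.last n) : Fin (m + (n + 1))) = Fin.last (m + n) :=
    Fin.ext (by simp)
  simp only [hc, hc', hd, hd', hf0, hg0, hg1, hf1, hf2, hg2, e0, e1, e2]
  simp only [Fin.val_castAdd, Fin.val_natAdd, add_mul, mul_add, smul_add, Finset.sum_mul,
    Finset.mul_sum, Finset.smul_sum, smul_mul_assoc, mul_smul_comm, smul_smul, pow_add, pow_one,
    mul_assoc, mul_neg, neg_mul, smul_neg, neg_smul, mul_one]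
  abel

/-- The cocycles of degree `n`. -/
def cocycles (ρ : A →ₐ[k] R) (n : ℕ) : Submodule k (Cochain k A R n) :=
  LinearMap.ker (differential ρ n)

/-- The coboundaries of degree `n`; there are none but `0` in degree `0`. -/
def coboundaries (ρ : A →ₐ[k] R) : (n : ℕ) → Submodule k (Cochain k A R n)
  | 0 => ⊥
  | n + 1 => LinearMap.range (differential ρ n)

/-- The Hochschild cohomology `HHⁿ(A, R)` with coefficients in the `A`-bimodule `R`:
cocycles modulo coboundaries. -/
def HH (ρ : A →ₐ[k] R) (n : ℕ) : Type (max v w) :=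
  Subquotient (M := Cochain k A R n) (cocycles ρ n) (coboundaries ρ n)

instance (ρ : A →ₐ[k] R) (n : ℕ) : AddCommGroup (HH ρ n) :=
  inferInstanceAs (AddCommGroup (Subquotient (M := Cochain k A R n) _ _))

instance (ρ : A →ₐ[k] R) (n : ℕ) : Module k (HH ρ n) :=
  inferInstanceAs (Module k (Subquotient (M := Cochain k A R n) _ _))

/-- The class of a cocycle. -/
def HH.mk (ρ : A →ₐ[k] R) (n : ℕ) : cocycles ρ n →ₗ[k] HH ρ n :=
  Subquotient.mk (M := Cochain k A R n) (cocycles ρ n) (coboundaries ρ n)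

theorem HH.mk_surjective (ρ : A →ₐ[k] R) (n : ℕ) : Function.Surjective (HH.mk ρ n) :=
  Subquotient.mk_surjective _ _

theorem HH.mk_eq_zero (ρ : A →ₐ[k] R) {n : ℕ} {z : cocycles ρ n} :
    HH.mk ρ n z = 0 ↔ z.1 ∈ coboundaries ρ n :=
  Subquotient.mk_eq_zero _ _

theorem HH.mk_eq_of_cast (ρ : A →ₐ[k] R) {m n : ℕ} (h : m = n) (z : cocycles ρ m)
    (z' : cocycles ρ n) (H : ∀ a : Fin m → A, z.1 a = z'.1 (fun i => a (Fin.cast h.symm i))) :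
    GradedMonoid.mk (A := HH ρ) m (HH.mk ρ m z) = GradedMonoid.mk n (HH.mk ρ n z') := by
  subst h
  rw [show z = z' from Subtype.ext (MultilinearMap.ext H)]

theorem differential_cast (ρ : A →ₐ[k] R) {m n : ℕ} (h : m = n) (f : Cochain k A R m)
    (a : Fin (n + 1) → A) :
    differential ρ n (f.domDomCongr (finCongr h)) a =
      differential ρ m f (fun i => a (Fin.cast (by omega) i)) := by
  subst h
  rfl

theorem cup_mem_cocycles (ρ : A →ₐ[k] R) {m n : ℕ} (f : cocycles ρ m) (g : cocycles ρ n) :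
    f.1.cup g.1 ∈ cocycles ρ (m + n) := by
  have hf : differential ρ m f.1 = 0 := f.2
  have hg : differential ρ n g.1 = 0 := g.2
  refine LinearMap.mem_ker.2 (MultilinearMap.ext fun a => ?_)
  rw [differential_cup, hf, hg]
  simp [Cochain.cup_apply]

/-- The cup product of cocycles, with values in cohomology. -/
def cupCocycles (ρ : A →ₐ[k] R) (m n : ℕ) :
    cocycles ρ m →ₗ[k] cocycles ρ n →ₗ[k] HH ρ (m + n) :=
  LinearMap.mk₂ k (fun f g => HH.mk ρ (m + n) ⟨f.1.cup g.1, cup_mem_cocycles ρ f g⟩)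
    (fun f f' g => by
      rw [← map_add]; congr 1; ext a; simp [Cochain.cup_apply, add_mul])
    (fun c f g => by
      rw [← map_smul]; congr 1; ext a; simp [Cochain.cup_apply])
    (fun f g g' => by
      rw [← map_add]; congr 1; ext a; simp [Cochain.cup_apply, mul_add])
    (fun c f g => by
      rw [← map_smul]; congr 1; ext a; simp [Cochain.cup_apply])

theorem cup_mem_coboundaries_right (ρ : A →ₐ[k] R) {m n : ℕ} (f : cocycles ρ m)
    (g : cocycles ρ n) (hg : g.1 ∈ coboundaries ρ n) :
    f.1.cup g.1 ∈ coboundaries ρ (m + n) := by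
  have hf : differential ρ m f.1 = 0 := f.2
  cases n with
  | zero =>
    have h0 : g.1 = 0 := hg
    have : f.1.cup g.1 = 0 := by ext a; rw [Cochain.cup_apply, h0]; simp
    rw [this]; exact zero_mem _
  | succ n =>
    obtain ⟨b, hb⟩ := hg
    refine ⟨(-1 : k) ^ m • f.1.cup b, MultilinearMap.ext fun a => ?_⟩
    rw [map_smul, smul_apply]
    erw [differential_cup]
    rw [hf, ← hb, smul_add, smul_smul,
      ← pow_add, Even.neg_one_pow ⟨m, rfl⟩]
    simp [Cochain.cup_apply]

theorem cup_mem_coboundaries_left (ρ : A →ₐ[k] R) {m n : ℕ} (f : cocycles ρ m)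
    (g : cocycles ρ n) (hf : f.1 ∈ coboundaries ρ m) :
    f.1.cup g.1 ∈ coboundaries ρ (m + n) := by
  have hg : differential ρ n g.1 = 0 := g.2
  cases m with
  | zero =>
    have h0 : f.1 = 0 := hf
    have : f.1.cup g.1 = 0 := by ext a; rw [Cochain.cup_apply, h0]; simp
    rw [this]; exact zero_mem _
  | succ m =>
    obtain ⟨b, hb⟩ := hf
    have key : ∀ (N : ℕ) (h : m + n + 1 = N) (F : Cochain k A R N),
        (∀ a, F a = differential ρ (m + n) (b.cup g.1) (fun i => a (Fin.cast h i))) →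
        F ∈ coboundaries ρ N := by
      intro N h F hF
      subst h
      exact ⟨b.cup g.1, MultilinearMap.ext fun a => (hF a).symm⟩
    refine key _ (by omega) _ fun a => ?_
    rw [differential_cup, hg, hb]
    simp [Cochain.cup_apply]

/-- The cup product on Hochschild cohomology. -/
def HH.mul (ρ : A →ₐ[k] R) (m n : ℕ) : HH ρ m →ₗ[k] HH ρ n →ₗ[k] HH ρ (m + n) :=
  Subquotient.lift₂ (M := Cochain k A R m) (N := Cochain k A R n)
    (cocycles ρ m) (coboundaries ρ m) (cocycles ρ n) (coboundaries ρ n) (cupCocycles ρ m n)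
    (fun f g hf => (HH.mk_eq_zero ρ).2 (cup_mem_coboundaries_left ρ f g hf))
    (fun f g hg => (HH.mk_eq_zero ρ).2 (cup_mem_coboundaries_right ρ f g hg))

theorem HH.mul_mk (ρ : A →ₐ[k] R) {m n : ℕ} (f : cocycles ρ m) (g : cocycles ρ n) :
    HH.mul ρ m n (HH.mk ρ m f) (HH.mk ρ n g) =
      HH.mk ρ (m + n) ⟨f.1.cup g.1, cup_mem_cocycles ρ f g⟩ := rfl

theorem constOfIsEmpty_mem_cocycles (ρ : A →ₐ[k] R) (c : k) :
    MultilinearMap.constOfIsEmpty k (fun _ : Fin 0 => A) (algebraMap k R c) ∈ cocycles ρ 0 := by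
  refine LinearMap.mem_ker.2 (MultilinearMap.ext fun a => ?_)
  rw [differential_apply]
  simp [Algebra.commutes]

/-- The scalars as classes of degree `0`. -/
def HH.scalar (ρ : A →ₐ[k] R) : k →+ HH ρ 0 where
  toFun c := HH.mk ρ 0 ⟨_, constOfIsEmpty_mem_cocycles ρ c⟩
  map_zero' := by
    rw [← map_zero (HH.mk ρ 0)]; congr 1; ext a; simp
  map_add' c d := by
    rw [← map_add]; congr 1; ext a; simp

instance (ρ : A →ₐ[k] R) : GradedMonoid.GMul (HH ρ) where
  mul {m n} x y := HH.mul ρ m n x y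

instance (ρ : A →ₐ[k] R) : GradedMonoid.GOne (HH ρ) where
  one := HH.scalar ρ 1

instance (ρ : A →ₐ[k] R) : GradedMonoid.GMonoid (HH ρ) where
  one_mul := by
    rintro ⟨n, x⟩
    obtain ⟨g, rfl⟩ := HH.mk_surjective ρ n x
    refine HH.mk_eq_of_cast ρ (zero_add n) ⟨_, cup_mem_cocycles ρ _ g⟩ g fun a => ?_
    rw [Cochain.cup_apply]
    simp
  mul_one := by
    rintro ⟨n, x⟩
    obtain ⟨g, rfl⟩ := HH.mk_surjective ρ n x
    refine HH.mk_eq_of_cast ρ (add_zero n) ⟨_, cup_mem_cocycles ρ g _⟩ g fun a => ?_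
    rw [Cochain.cup_apply]
    simp
  mul_assoc := by
    rintro ⟨m, x⟩ ⟨n, y⟩ ⟨p, z⟩
    obtain ⟨x, rfl⟩ := HH.mk_surjective ρ m x
    obtain ⟨y, rfl⟩ := HH.mk_surjective ρ n y
    obtain ⟨z, rfl⟩ := HH.mk_surjective ρ p z
    refine HH.mk_eq_of_cast ρ (add_assoc m n p)
      ⟨_, cup_mem_cocycles ρ ⟨_, cup_mem_cocycles ρ x y⟩ z⟩
      ⟨_, cup_mem_cocycles ρ x ⟨_, cup_mem_cocycles ρ y z⟩⟩ fun a => ?_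
    simp only [Cochain.cup_apply, mul_assoc]
    congr 2
    congr 1
    funext i
    exact congrArg a (Fin.ext (by simp; omega))

instance (ρ : A →ₐ[k] R) : DirectSum.GRing (HH ρ) where
  mul_zero x := map_zero _
  zero_mul x := LinearMap.map_zero₂ _ _
  mul_add x y z := map_add _ _ _
  add_mul x y z := LinearMap.map_add₂ _ _ _ _
  natCast c := HH.scalar ρ c
  natCast_zero := by simp
  natCast_succ c := by rw [Nat.cast_succ, map_add]; rfl
  intCast c := HH.scalar ρ c
  intCast_ofNat c := by simp only [Int.cast_natCast]
  intCast_negSucc_ofNat c := by rw [← map_neg]; congr 1; simp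

instance (ρ : A →ₐ[k] R) : DirectSum.GAlgebra k (HH ρ) where
  toFun := HH.scalar ρ
  map_one := rfl
  map_mul c d := by
    refine HH.mk_eq_of_cast ρ (zero_add 0).symm _ ⟨_, cup_mem_cocycles ρ _ _⟩ fun a => ?_
    rw [Cochain.cup_apply]
    simp
  commutes c := by
    rintro ⟨n, x⟩
    obtain ⟨g, rfl⟩ := HH.mk_surjective ρ n x
    refine HH.mk_eq_of_cast ρ ((zero_add n).trans (add_zero n).symm)
      ⟨_, cup_mem_cocycles ρ _ g⟩ ⟨_, cup_mem_cocycles ρ g _⟩ fun a => ?_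
    simp only [Cochain.cup_apply]
    simp [Algebra.commutes]
  smul_def c := by
    rintro ⟨n, x⟩
    obtain ⟨g, rfl⟩ := HH.mk_surjective ρ n x
    refine HH.mk_eq_of_cast ρ (zero_add n).symm (c • g) ⟨_, cup_mem_cocycles ρ _ g⟩ fun a => ?_
    rw [Cochain.cup_apply]
    simp [Algebra.smul_def]

theorem differential_compMultilinearMap (σ : A →ₐ[k] R) {n : ℕ} (f : Cochain k A A n) :
    differential σ n (σ.toLinearMap.compMultilinearMap f) =
      σ.toLinearMap.compMultilinearMap (differential (AlgHom.id k A) n f) := by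
  ext a
  refine (differential_apply σ n _ a).trans
    (Eq.trans ?_ (congrArg σ (differential_apply (AlgHom.id k A) n f a)).symm)
  simp

/-- Composition of cocycles with `σ : A → R`. -/
def pushCocycles (σ : A →ₐ[k] R) (n : ℕ) : cocycles (AlgHom.id k A) n →ₗ[k] cocycles σ n where
  toFun f := ⟨σ.toLinearMap.compMultilinearMap f.1, by
    have hf : differential (AlgHom.id k A) n f.1 = 0 := f.2
    refine LinearMap.mem_ker.2 ?_
    rw [differential_compMultilinearMap, hf]
    ext a
    simp⟩
  map_add' f g := Subtype.ext (MultilinearMap.ext fun a => map_add σ (f.1 a) (g.1 a))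
  map_smul' c f := Subtype.ext (MultilinearMap.ext fun a => map_smul σ c (f.1 a))

/-- Composition with `σ : A → R` on cohomology classes: `HHⁿ(A) → HHⁿ(A, R)`, `[f] ↦ [σ ∘ f]`. -/
def HH.push (σ : A →ₐ[k] R) (n : ℕ) : HH (AlgHom.id k A) n →ₗ[k] HH σ n :=
  Subquotient.lift (M := Cochain k A A n) (cocycles (AlgHom.id k A) n)
    (coboundaries (AlgHom.id k A) n) ((HH.mk σ n).comp (pushCocycles σ n))
    (fun f hf => (HH.mk_eq_zero σ).2 (by
      cases n with
      | zero =>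
        have h0 : f.1 = 0 := hf
        have : σ.toLinearMap.compMultilinearMap f.1 = 0 := by rw [h0]; ext a; simp
        exact this
      | succ n =>
        obtain ⟨b, hb⟩ := hf
        exact ⟨σ.toLinearMap.compMultilinearMap b, by
          rw [differential_compMultilinearMap, hb]; rfl⟩))

theorem HH.push_mk (σ : A →ₐ[k] R) {n : ℕ} (f : cocycles (AlgHom.id k A) n) :
    HH.push σ n (HH.mk _ n f) = HH.mk σ n (pushCocycles σ n f) := rfl

/-- The homomorphism of graded algebras `HH^•(A) → HH^•(A, R)` induced by `σ : A → R`. -/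
def HH.pushAlgHom (σ : A →ₐ[k] R) :
    (⨁ n, HH (AlgHom.id k A) n) →ₐ[k] (⨁ n, HH σ n) :=
  DirectSum.toAlgebra k (HH (AlgHom.id k A))
    (fun n => (DirectSum.lof k ℕ (HH σ) n).comp (HH.push σ n))
    (by
      have h : HH.push σ 0 GradedMonoid.GOne.one = GradedMonoid.GOne.one := by
        refine (HH.push_mk σ _).trans (congrArg (HH.mk σ 0) (Subtype.ext ?_))
        exact MultilinearMap.ext fun a => by simp [pushCocycles]
      exact congrArg (DirectSum.lof k ℕ (HH σ) 0) h)
    (by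
      intro m n x y
      obtain ⟨f, rfl⟩ := HH.mk_surjective _ m x
      obtain ⟨g, rfl⟩ := HH.mk_surjective _ n y
      refine Eq.trans ?_ (DirectSum.of_mul_of _ _).symm
      have h : HH.push σ (m + n) (HH.mul _ m n (HH.mk _ m f) (HH.mk _ n g)) =
          HH.mul σ m n (HH.push σ m (HH.mk _ m f)) (HH.push σ n (HH.mk _ n g)) := by
        rw [HH.mul_mk, HH.push_mk, HH.push_mk, HH.push_mk, HH.mul_mk]
        refine congrArg (HH.mk σ (m + n)) (Subtype.ext (MultilinearMap.ext fun a => ?_))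
        simp [pushCocycles, Cochain.cup_apply]
      exact congrArg (DirectSum.lof k ℕ (HH σ) (m + n)) h)

/-! ### The finiteness assumptions -/

variable (k A) in
/-- The Hochschild cohomology ring `HH^•(A)`. -/
abbrev HochschildRing : Type v := ⨁ n, HH (AlgHom.id k A) n

variable (k A) in
/-- The ring `Ext_A^•(M, M)`, computed by the bar resolution `A ⊗ A^{⊗ n} ⊗ M` of `M`:
`Hom_A (A ⊗ A^{⊗ n} ⊗ M, M) = Hom_k (A^{⊗ n}, End_k M)`, with the Hochschild differential. -/
abbrev ExtRing (M : Type w) [AddCommGroup M] [Module k M] [Module A M] [IsScalarTower k A M] :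
    Type (max v w) :=
  ⨁ n, HH (Algebra.lsmul k k M : A →ₐ[k] Module.End k M) n

variable (k A) in
/-- The ring homomorphism `φ_M = - ⊗_A M : HH^•(A) → Ext_A^•(M, M)`. For a cocycle `f`, viewed as a
map from the bar resolution of the bimodule `A` to `A`, the map `f ⊗_A M` on the bar resolution of
`M` is the cochain `(a₁, …, aₙ) ↦ (m ↦ f(a₁, …, aₙ) m)`. -/
def tensorHom (M : Type w) [AddCommGroup M] [Module k M] [Module A M] [IsScalarTower k A M] :
    HochschildRing k A →ₐ[k] ExtRing k A M :=
  HH.pushAlgHom (Algebra.lsmul k k M : A →ₐ[k] Module.End k M)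

/-- `H` is a graded subalgebra of `HH^•(A)` that is a finitely generated commutative algebra and
contains all of `HH^0(A)`. -/
structure FG1 (H : Subalgebra k (HochschildRing k A)) : Prop where
  homogeneous : ∀ x ∈ H, ∀ n, DirectSum.of (HH (AlgHom.id k A)) n (x n) ∈ H
  fg : H.FG
  commutative : ∀ x ∈ H, ∀ y ∈ H, x * y = y * x
  degree_zero : ∀ x : HH (AlgHom.id k A) 0, DirectSum.of (HH (AlgHom.id k A)) 0 x ∈ H

/-- `Ext_A^•(A/Jac(A), A/Jac(A))` is a finitely generated `H`-module, `H` acting through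
`φ_{A/Jac(A)}`. -/
def FG2 (H : Subalgebra k (HochschildRing k A)) : Prop :=
  letI : Module H (ExtRing k A (A ⧸ Ring.jacobson A)) :=
    Module.compHom _ ((tensorHom k A (A ⧸ Ring.jacobson A)).comp H.val).toRingHom
  Module.Finite H (ExtRing k A (A ⧸ Ring.jacobson A))

variable (k A) in
/-- The assumptions (fg1) and (fg2), with the same graded subalgebra `H` of `HH^•(A)`. -/
def SatisfiesFG : Prop :=
  ∃ H : Subalgebra k (HochschildRing k A), FG1 H ∧ FG2 H

/-! ### Complexity -/

open CategoryTheory in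
/-- A projective resolution `⋯ → P₁ → P₀ → M → 0` is minimal if the image of each differential
`P_{n+1} → P_n` lies in `Jac(A) P_n`. -/
def IsMinimal {A : Type u} [Ring A] {M : ModuleCat.{u} A} (P : ProjectiveResolution M) : Prop :=
  ∀ n, LinearMap.range (P.complex.d (n + 1) n).hom ≤
    Ring.jacobson A • (⊤ : Submodule A (P.complex.X n))

/-- The rate of growth of a sequence of dimensions: the least natural number `c` for which there is
a real `b` with `d n ≤ b * n ^ (c - 1)` for all `n ≥ 1`, and `∞` if there is no such `c`. -/
def growthRate (d : ℕ → ℕ) : ℕ∞ :=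
  ⨅ (c : ℕ) (_ : ∃ b : ℝ, ∀ n : ℕ, 0 < n → (d n : ℝ) ≤ b * (n : ℝ) ^ ((c : ℤ) - 1)), (c : ℕ∞)

open CategoryTheory in
open scoped ModuleCat.Algebra in
/-- The complexity of a finite dimensional module `M` over a finite dimensional algebra `A`: the
rate of growth of the terms of a minimal projective resolution of `M`. (Such a resolution exists,
is unique up to isomorphism, and has finite dimensional terms, so that the infimum is taken over a
single value.) -/
def complexity (k : Type u) {A : Type u} [Field k] [Ring A] [Algebra k A] (M : ModuleCat.{u} A) :
    ℕ∞ :=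
  ⨅ (P : ProjectiveResolution M) (_ : IsMinimal P),
    growthRate fun n => Module.finrank k (P.complex.X n)

/-- The trivial module `k` of an augmented algebra, on which `A` acts through the augmentation. -/
abbrev trivialModule {k A : Type u} [Field k] [Ring A] [Algebra k A] (ε : A →ₐ[k] k) :
    ModuleCat.{u} A :=
  (ModuleCat.restrictScalars ε.toRingHom).obj (ModuleCat.of k k)

/-- The augmentation `a ⊗ a' ↦ ε(a) ε'(a')` of `A ⊗ A'`. -/
abbrev tensorAugmentation {k A A' : Type u} [Field k] [Ring A] [Algebra k A] [Ring A']
    [Algebra k A'] (ε : A →ₐ[k] k) (ε' : A' →ₐ[k] k) : A ⊗[k] A' →ₐ[k] k :=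
  (Algebra.TensorProduct.lmul' k).comp (Algebra.TensorProduct.map ε ε')

end HochschildTheory
end

/-! Take minimal projective resolutions P and P' of the trivial modules over A and A'. The total
complex of P ⊗ P' over k resolves k ⊗ k = k over A ⊗ A': over a field both augmented complexes have
k-linear contractions, and these combine to a contraction of the total complex (`totalD_totalH`).
Its terms are projective (`OuterTensor.projective`), and it is minimal because a ⊗ 1 and 1 ⊗ a' lie
in Jac(A ⊗ A') whenever a and a' lie in the radicals (`map_mem_jacobson`). Minimal resolutions being
unique, the dimensions over A ⊗ A' form the convolution of the sequences dim P_n and dim P'_n.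

The growth rate of a convolution is not the sum of the growth rates in general: if p(n) = n^e for
powers of 2 and 0 otherwise, with e ≥ 1, then convolving p with the constant sequence 1 does not
raise its rate. Additivity does hold if each sequence is eventually zero with a positive initial
value, or is bounded by a multiple of n^(c-1) and reaches this order along a whole arithmetic
progression (`HasGrowth`, `growthRate_convolution`), because then, for suitable n, proportionally to
n many pairs i + j = n contribute the full order.

This regularity comes from (fg1) and (fg2). Up to constant factors dim P_n is dim Hom_A(P_n, A/Jac
A), by Nakayama, and by minimality this Hom is Ext^n(k, A/Jac A). As k is a direct summand of A/Jac
A, cut out by an idempotent endomorphism e, it is the part of Ext^n(A/Jac A, A/Jac A) fixed under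
right multiplication by e (`range_homToHH`). The ring H acts on the left, so these classes form a
graded submodule of a Noetherian H-module, and the Hilbert–Serre argument
(`isQuasiPolynomial_finrank_sub`) makes their dimensions quasi-polynomial. A quasi-polynomial
sequence of natural numbers has the required regularity (`exists_hasGrowth`). -/

noncomputable section

namespace HochschildTheory

/-! ### Projective resolutions of modules from exact sequences -/

section Resolution

open CategoryTheory

variable {A : Type u} [Ring A] {M : ModuleCat.{u} A}

/-- The chain complex of modules given by maps with vanishing consecutive composites. -/
def mkComplex (X : ℕ → ModuleCat.{u} A) (d : ∀ n, X (n + 1) ⟶ X n)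
    (hd : ∀ n, d (n + 1) ≫ d n = 0) : ChainComplex (ModuleCat.{u} A) ℕ :=
  ChainComplex.of X d hd

theorem mkComplex_d (X : ℕ → ModuleCat.{u} A) (d : ∀ n, X (n + 1) ⟶ X n)
    (hd : ∀ n, d (n + 1) ≫ d n = 0) (n : ℕ) : (mkComplex X d hd).d (n + 1) n = d n :=
  ChainComplex.of_d X d n

/-- The augmentation of `mkComplex`. -/
def mkComplexπ (X : ℕ → ModuleCat.{u} A) (d : ∀ n, X (n + 1) ⟶ X n)
    (hd : ∀ n, d (n + 1) ≫ d n = 0) (π : X 0 ⟶ M) (h0 : d 0 ≫ π = 0) :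
    mkComplex X d hd ⟶ (ChainComplex.single₀ (ModuleCat.{u} A)).obj M :=
  (ChainComplex.toSingle₀Equiv _ _).symm ⟨π, (congrArg (· ≫ π) (mkComplex_d X d hd 0)).trans h0⟩

theorem mkComplexπ_f_zero (X : ℕ → ModuleCat.{u} A) (d : ∀ n, X (n + 1) ⟶ X n)
    (hd : ∀ n, d (n + 1) ≫ d n = 0) (π : X 0 ⟶ M) (h0 : d 0 ≫ π = 0) :
    (mkComplexπ X d hd π h0).f 0 = π :=
  ChainComplex.toSingle₀Equiv_symm_apply_f_zero (C := mkComplex X d hd) π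
    ((congrArg (· ≫ π) (mkComplex_d X d hd 0)).trans h0)

theorem comp_eq_zero_of_exact {X Y Z : ModuleCat.{u} A} {f : X ⟶ Y} {g : Y ⟶ Z}
    (h : Function.Exact f.hom g.hom) : f ≫ g = 0 := by
  ext x
  exact h.apply_apply_eq_zero x

/-- The projective resolution given by an exact sequence of projective modules. -/
def mkResolution (X : ℕ → ModuleCat.{u} A) (d : ∀ n, X (n + 1) ⟶ X n) (π : X 0 ⟶ M)
    (hX : ∀ n, Module.Projective A (X n)) (hπ : Function.Surjective π.hom)
    (h0 : Function.Exact (d 0).hom π.hom) (hd : ∀ n, Function.Exact (d (n + 1)).hom (d n).hom) :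
    ProjectiveResolution M where
  complex := mkComplex X d fun n => comp_eq_zero_of_exact (hd n)
  projective n := (IsProjective.iff_projective (X n)).1 (hX n)
  π := mkComplexπ X d (fun n => comp_eq_zero_of_exact (hd n)) π (comp_eq_zero_of_exact h0)
  quasiIso := ⟨fun n => by
    cases n with
    | zero =>
      rw [ChainComplex.quasiIsoAt₀_iff, ShortComplex.quasiIso_iff_of_zeros' _ rfl rfl rfl]
      have hd' := fun n => comp_eq_zero_of_exact (hd n)
      have h0' := comp_eq_zero_of_exact h0
      refine (ShortComplex.exact_and_epi_g_iff_of_iso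
        (S₂ := ShortComplex.mk (d 0) π h0') (ShortComplex.isoMk (Iso.refl _) (Iso.refl _)
          (Iso.refl _) ?_ ?_)).2 ⟨?_, ?_⟩
      · exact (Category.id_comp (d 0)).trans ((mkComplex_d X d hd' 0).symm.trans
          (Category.comp_id ((mkComplex X d hd').d 1 0)).symm)
      · exact (Category.id_comp π).trans ((mkComplexπ_f_zero X d hd' π h0').symm.trans
          (Category.comp_id ((mkComplexπ X d hd' π h0').f 0)).symm)
      · exact (ShortComplex.ShortExact.moduleCat_exact_iff_function_exact _).2 h0
      · exact (ModuleCat.epi_iff_surjective _).2 hπ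
    | succ n =>
      rw [quasiIsoAt_iff_exactAt' (hL := ChainComplex.exactAt_succ_single_obj ..),
          HomologicalComplex.exactAt_iff' _ (n + 2) (n + 1) n (by simp) (by simp)]
      refine (ShortComplex.ShortExact.moduleCat_exact_iff_function_exact _).2 ?_
      have hd' := fun n => comp_eq_zero_of_exact (hd n)
      change Function.Exact ((mkComplex X d hd').d (n + 2) (n + 1)).hom
        ((mkComplex X d hd').d (n + 1) n).hom
      rw [mkComplex_d, mkComplex_d]
      exact hd n⟩

theorem mkResolution_d (X : ℕ → ModuleCat.{u} A) (d : ∀ n, X (n + 1) ⟶ X n) (π : X 0 ⟶ M)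
    (hX : ∀ n, Module.Projective A (X n)) (hπ : Function.Surjective π.hom)
    (h0 : Function.Exact (d 0).hom π.hom) (hd : ∀ n, Function.Exact (d (n + 1)).hom (d n).hom)
    (n : ℕ) : (mkResolution X d π hX hπ h0 hd).complex.d (n + 1) n = d n :=
  mkComplex_d X d (fun n => comp_eq_zero_of_exact (hd n)) n

theorem mkResolution_π (X : ℕ → ModuleCat.{u} A) (d : ∀ n, X (n + 1) ⟶ X n) (π : X 0 ⟶ M)
    (hX : ∀ n, Module.Projective A (X n)) (hπ : Function.Surjective π.hom)
    (h0 : Function.Exact (d 0).hom π.hom) (hd : ∀ n, Function.Exact (d (n + 1)).hom (d n).hom) :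
    (mkResolution X d π hX hπ h0 hd).π.f 0 = π :=
  mkComplexπ_f_zero X d (fun n => comp_eq_zero_of_exact (hd n)) π (comp_eq_zero_of_exact h0)

theorem exact_d_π (P : ProjectiveResolution M) :
    Function.Exact (P.complex.d 1 0).hom (P.π.f 0).hom :=
  (ShortComplex.ShortExact.moduleCat_exact_iff_function_exact _).1 P.exact₀

theorem exact_d_d (P : ProjectiveResolution M) (n : ℕ) :
    Function.Exact (P.complex.d (n + 2) (n + 1)).hom (P.complex.d (n + 1) n).hom :=
  (ShortComplex.ShortExact.moduleCat_exact_iff_function_exact _).1 (P.exact_succ n)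

theorem surjective_π (P : ProjectiveResolution M) : Function.Surjective (P.π.f 0).hom :=
  (ModuleCat.epi_iff_surjective _).1 inferInstance

theorem projective_X (P : ProjectiveResolution M) (n : ℕ) :
    Module.Projective A (P.complex.X n) :=
  (IsProjective.iff_projective (P.complex.X n)).2 (P.projective n)

theorem π_lift_apply {N : ModuleCat.{u} A} (f : M ⟶ N) (P : ProjectiveResolution M)
    (Q : ProjectiveResolution N) (x : P.complex.X 0) :
    (Q.π.f 0).hom (((ProjectiveResolution.lift f P Q).f 0).hom x) = f.hom ((P.π.f 0).hom x) :=
  LinearMap.congr_fun (congrArg ModuleCat.Hom.hom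
    (ProjectiveResolution.lift_commutes_zero f P Q)) x

/-- Two lifts of the same map between projective resolutions of modules agree up to terms that
factor through the differentials. -/
theorem exists_homotopy_of_lift {N : ModuleCat.{u} A} {P : ProjectiveResolution M}
    {Q : ProjectiveResolution N} (f g : P.complex ⟶ Q.complex)
    (h : f.f 0 ≫ Q.π.f 0 = g.f 0 ≫ Q.π.f 0) (n : ℕ) :
    ∃ (s : P.complex.X n →ₗ[A] Q.complex.X (n + 1)) (t : P.complex.X n →ₗ[A] Q.complex.X n),
      (∀ x, (f.f n).hom x = (g.f n).hom x + (Q.complex.d (n + 1) n).hom (s x) + t x) ∧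
      (n = 0 → t = 0) ∧ ∀ m, n = m + 1 → ∃ r : P.complex.X m →ₗ[A] Q.complex.X n,
        ∀ x, t x = r ((P.complex.d n m).hom x) := by
  have h' : f ≫ Q.π = g ≫ Q.π := by
    refine HomologicalComplex.hom_ext _ _ fun i => ?_
    cases i with
    | zero => exact h
    | succ i => simp
  let H : Homotopy f g := Homotopy.equivSubZero.symm
    (ProjectiveResolution.liftHomotopyZero (f - g) (by simp [h']))
  have hc := H.comm n
  cases n with
  | zero =>
    refine ⟨(H.hom 0 1).hom, 0, fun x => ?_, fun _ => rfl, fun m hm => by omega⟩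
    rw [Homotopy.dNext_zero_chainComplex, Homotopy.prevD_chainComplex, zero_add] at hc
    rw [hc]
    simp [add_comm]
  | succ n =>
    refine ⟨(H.hom (n + 1) (n + 2)).hom, (P.complex.d (n + 1) n ≫ H.hom n (n + 1)).hom,
      fun x => ?_, fun h => by omega, fun m hm => ?_⟩
    · rw [Homotopy.dNext_succ_chainComplex, Homotopy.prevD_chainComplex] at hc
      rw [hc]
      simp
      abel
    · obtain rfl : n = m := by omega
      exact ⟨(H.hom n (n + 1)).hom, fun x => rfl⟩

end Resolution
end HochschildTheory
end

noncomputable section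

namespace HochschildTheory

/-! ### The bar resolution -/

/-- A module over a `k`-algebra `A` together with the compatible `k`-module structure. -/
structure BarModule (k A : Type u) [Field k] [Ring A] [Algebra k A] where
  carrier : Type u
  [addCommGroup : AddCommGroup carrier]
  [moduleBase : Module k carrier]
  [module : Module A carrier]
  [isScalarTower : IsScalarTower k A carrier]

namespace BarModule

variable {k A : Type u} [Field k] [Ring A] [Algebra k A]

instance : CoeSort (BarModule k A) (Type u) := ⟨BarModule.carrier⟩

attribute [instance] addCommGroup moduleBase module isScalarTower

/-- The module `A ⊗ V` on which `A` acts through the left factor. -/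
def free (V : BarModule k A) : BarModule k A := ⟨A ⊗[k] V⟩

/-- The section `v ↦ 1 ⊗ v`. -/
def unit (V : BarModule k A) : V →ₗ[k] V.free :=
  (TensorProduct.mk k A V 1 : V →ₗ[k] A ⊗[k] V)

/-- The `A`-linear extension of a `k`-linear map. -/
def extend (V : BarModule k A) {N : Type w} [AddCommGroup N] [Module k N] [Module A N]
    [IsScalarTower k A N] (g : V →ₗ[k] N) : V.free →ₗ[A] N :=
  (TensorProduct.AlgebraTensorModule.lift
    { toFun := fun a => (Algebra.lsmul k k N a).comp g
      map_add' := fun a b => by ext; simp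
      map_smul' := fun a b => by ext; simp } : A ⊗[k] V →ₗ[A] N)

theorem extend_smul_unit (V : BarModule k A) {N : Type w} [AddCommGroup N] [Module k N]
    [Module A N] [IsScalarTower k A N] (g : V →ₗ[k] N) (a : A) (v : V) :
    V.extend g (a • V.unit v) = a • g v := by
  rw [map_smul]
  congr 1
  change (1 : A) • g v = g v
  rw [one_smul]

theorem extend_unit (V : BarModule k A) {N : Type w} [AddCommGroup N] [Module k N]
    [Module A N] [IsScalarTower k A N] (g : V →ₗ[k] N) (v : V) :
    V.extend g (V.unit v) = g v := by
  simpa using V.extend_smul_unit g 1 v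

theorem free_induction (V : BarModule k A) {p : V.free → Prop}
    (h : ∀ (a : A) (v : V), p (a • V.unit v)) (hadd : ∀ x y, p x → p y → p (x + y))
    (x : V.free) : p x := by
  refine TensorProduct.induction_on (R := k) (M := A) (N := V) (motive := p) x ?_ ?_ hadd
  · have := h 0 0
    rwa [zero_smul] at this
  · intro a v
    have : a • V.unit v = (a ⊗ₜ[k] v : A ⊗[k] V) := by
      change a • ((1 : A) ⊗ₜ[k] v) = _
      rw [TensorProduct.smul_tmul', smul_eq_mul, mul_one]
    exact this ▸ h a v

theorem hom_ext (V : BarModule k A) {N : Type w} [AddCommGroup N] [Module A N]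
    {f g : V.free →ₗ[A] N} (h : ∀ v, f (V.unit v) = g (V.unit v)) : f = g := by
  refine LinearMap.ext fun x => V.free_induction (p := fun x => f x = g x) (fun a v => ?_)
    (fun x y hx hy => ?_) x
  · rw [map_smul, map_smul, h]
  · rw [map_add, map_add, hx, hy]

theorem projective_free (V : BarModule k A) : Module.Projective A V.free :=
  inferInstanceAs (Module.Projective A (A ⊗[k] V))

variable (X : BarModule k A)

/-- The terms of the augmented bar resolution of `X`, starting with `X`. -/
def bar : ℕ → BarModule k A
  | 0 => X
  | n + 1 => (bar n).free

/-- The contracting homotopy of the augmented bar resolution. -/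
def barUnit (n : ℕ) : X.bar n →ₗ[k] X.bar (n + 1) := (X.bar n).unit

/-- The `A`-linear extension of a `k`-linear map on a term of the bar resolution. -/
def barExtend {N : Type w} [AddCommGroup N] [Module k N] [Module A N]
    [IsScalarTower k A N] {n : ℕ} (g : X.bar n →ₗ[k] N) : X.bar (n + 1) →ₗ[A] N :=
  (X.bar n).extend g

/-- The differential of the augmented bar resolution: `a ⊗ t ↦ a t - a ⊗ d t`. -/
def barD : (n : ℕ) → X.bar (n + 1) →ₗ[A] X.bar n
  | 0 => X.barExtend LinearMap.id
  | n + 1 => X.barExtend (LinearMap.id - (X.barUnit n).comp ((barD n).restrictScalars k))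

theorem barExtend_unit {N : Type w} [AddCommGroup N] [Module k N] [Module A N]
    [IsScalarTower k A N] {n : ℕ} (g : X.bar n →ₗ[k] N) (t : X.bar n) :
    X.barExtend g (X.barUnit n t) = g t :=
  (X.bar n).extend_unit g t

theorem barD_zero_unit (x : X.bar 0) : X.barD 0 (X.barUnit 0 x) = x :=
  X.barExtend_unit _ x

/-- The homotopy identity d s + s d = 1 for s = `barUnit`. The elements 1 ⊗ t generate over A, so it
determines d; both d d = 0 and exactness follow from it. -/
theorem barD_succ_unit (n : ℕ) (t : X.bar (n + 1)) :
    X.barD (n + 1) (X.barUnit (n + 1) t) = t - X.barUnit n (X.barD n t) :=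
  X.barExtend_unit _ t

theorem barD_barD (n : ℕ) (t : X.bar (n + 2)) : X.barD n (X.barD (n + 1) t) = 0 := by
  suffices h : (X.barD n).comp (X.barD (n + 1)) = 0 from LinearMap.congr_fun h t
  refine (X.bar (n + 1)).hom_ext fun t => ?_
  change X.barD n (X.barD (n + 1) (X.barUnit (n + 1) t)) = 0
  rw [barD_succ_unit, map_sub]
  cases n with
  | zero => rw [barD_zero_unit, sub_self]
  | succ n => rw [barD_succ_unit, barD_barD n, map_zero, sub_zero, sub_self]

theorem exact_barD (n : ℕ) : Function.Exact (X.barD (n + 1)) (X.barD n) := fun t =>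
  ⟨fun ht => ⟨X.barUnit (n + 1) t, by rw [barD_succ_unit, ht, map_zero, sub_zero]⟩, by
    rintro ⟨y, rfl⟩
    exact X.barD_barD n y⟩

open CategoryTheory in
/-- The bar resolution. -/
def barResolution : ProjectiveResolution (ModuleCat.of A X) :=
  mkResolution (fun n => ModuleCat.of A (X.bar (n + 1)))
    (fun n => ModuleCat.ofHom (X.barD (n + 1)))
    (ModuleCat.ofHom (X.barD 0)) (fun n => (X.bar n).projective_free)
    (fun x => ⟨X.barUnit 0 x, X.barD_zero_unit x⟩) (X.exact_barD 0) (fun n => X.exact_barD (n + 1))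

theorem barResolution_d (n : ℕ) :
    X.barResolution.complex.d (n + 1) n = ModuleCat.ofHom (X.barD (n + 1)) :=
  mkResolution_d _ _ _ _ _ _ _ n

theorem barResolution_π : X.barResolution.π.f 0 = ModuleCat.ofHom (X.barD 0) :=
  mkResolution_π _ _ _ _ _ _ _

theorem contractNth_succ {n : ℕ} (j : Fin n) (a : Fin (n + 2) → A) :
    (fun i : Fin n => Fin.contractNth j.succ.castSucc (· * ·) a i.succ) =
      Fin.contractNth j.castSucc (· * ·) fun i : Fin (n + 1) => a i.succ := by
  funext i
  simp only [Fin.contractNth, Fin.val_castSucc, Fin.val_succ, Nat.add_lt_add_iff_right,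
    Nat.add_right_cancel_iff]
  rfl

/-! ### Cochains and the bar resolution -/

/-- The tensor `a₁ ⊗ ⋯ ⊗ aₙ ⊗ x`. -/
def barTensor : (n : ℕ) → MultilinearMap k (fun _ : Fin n => A) (X →ₗ[k] X.bar n)
  | 0 => MultilinearMap.constOfIsEmpty k _ (LinearMap.id : X →ₗ[k] X)
  | n + 1 => LinearMap.uncurryLeft (M := fun _ : Fin (n + 1) => A)
      { toFun := fun a => (LinearMap.llcomp k X (X.bar n) (X.bar (n + 1))
          (((Algebra.lsmul k k (X.bar (n + 1)) a).comp (X.barUnit n)))).compMultilinearMap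
            (barTensor n)
        map_add' := fun a b => by ext; simp
        map_smul' := fun c a => by ext; simp }

theorem barTensor_succ (n : ℕ) (a : Fin (n + 1) → A) (x : X) :
    X.barTensor (n + 1) a x = a 0 • X.barUnit n (X.barTensor n (fun i => a i.succ) x) := rfl

/-- In the recursion a ⊗ t ↦ a t - a ⊗ d t, the term a t is the contraction j = 0, and - a ⊗ d t
shifts the remaining contractions by one position and one sign. -/
theorem barD_barTensor (n : ℕ) (a : Fin (n + 1) → A) (x : X) :
    X.barD n (X.barTensor (n + 1) a x) =
      ∑ j : Fin n, (-1 : k) ^ j.val •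
        X.barTensor n (Fin.contractNth j.castSucc (· * ·) a) x +
      (-1 : k) ^ n • X.barTensor n (fun i => a i.castSucc) (a (Fin.last n) • x) := by
  induction n with
  | zero =>
    rw [barTensor_succ, map_smul, barD_zero_unit]
    simp only [Finset.univ_eq_empty, Finset.sum_empty, zero_add, pow_zero, one_smul]
    rfl
  | succ n ih =>
    rw [barTensor_succ, map_smul, barD_succ_unit, ih, Fin.sum_univ_succ, smul_sub, map_add,
      map_sum, smul_add, Finset.smul_sum, sub_add_eq_sub_sub, sub_eq_add_neg, sub_eq_add_neg,
      ← Finset.sum_neg_distrib]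
    congr 1
    · congr 1
      · rw [barTensor_succ, barTensor_succ, smul_smul]
        simp [Fin.contractNth]
      · refine Finset.sum_congr rfl fun j _ => ?_
        rw [map_smul, smul_comm, barTensor_succ, Fin.val_succ, pow_succ, mul_neg_one, neg_smul]
        congr 4
        exact congrArg (fun b => X.barTensor n b x) (contractNth_succ j a).symm
    · rw [map_smul, smul_comm, barTensor_succ, pow_succ, mul_neg_one, neg_smul]
      rfl

end BarModule
end HochschildTheory
end

/-! ### Functoriality of the bar resolution; cochains as homomorphisms out of it -/

noncomputable section

namespace HochschildTheory

namespace BarModule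

variable {k A : Type u} [Field k] [Ring A] [Algebra k A] (X : BarModule k A)

/-- The functoriality of the bar resolution. -/
def barMap (h : X →ₗ[A] X) : (n : ℕ) → X.bar n →ₗ[A] X.bar n
  | 0 => h
  | n + 1 => X.barExtend ((X.barUnit n).comp ((barMap h n).restrictScalars k))

theorem barMap_unit (h : X →ₗ[A] X) (n : ℕ) (t : X.bar n) :
    X.barMap h (n + 1) (X.barUnit n t) = X.barUnit n (X.barMap h n t) :=
  X.barExtend_unit _ t

theorem bar_hom_ext {N : Type w} [AddCommGroup N] [Module A N] {n : ℕ}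
    {f g : X.bar (n + 1) →ₗ[A] N} (h : ∀ t, f (X.barUnit n t) = g (X.barUnit n t)) : f = g :=
  (X.bar n).hom_ext h

theorem bar_induction {n : ℕ} {p : X.bar (n + 1) → Prop}
    (h : ∀ (a : A) (t : X.bar n), p (a • X.barUnit n t)) (hadd : ∀ x y, p x → p y → p (x + y))
    (t : X.bar (n + 1)) : p t :=
  (X.bar n).free_induction h hadd t

theorem barD_barMap (h : X →ₗ[A] X) (n : ℕ) (t : X.bar (n + 1)) :
    X.barD n (X.barMap h (n + 1) t) = X.barMap h n (X.barD n t) := by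
  suffices H : (X.barD n).comp (X.barMap h (n + 1)) = (X.barMap h n).comp (X.barD n) from
    LinearMap.congr_fun H t
  refine X.bar_hom_ext fun t => ?_
  rw [LinearMap.comp_apply, LinearMap.comp_apply, barMap_unit]
  cases n with
  | zero => rw [barD_zero_unit, barD_zero_unit]
  | succ n => rw [barD_succ_unit, barD_succ_unit, barD_barMap h n, map_sub, barMap_unit]

theorem barMap_barTensor (h : X →ₗ[A] X) (n : ℕ) (a : Fin n → A) (x : X) :
    X.barMap h n (X.barTensor n a x) = X.barTensor n a (h x) := by
  induction n with
  | zero => rfl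
  | succ n ih => rw [barTensor_succ, barTensor_succ, map_smul, barMap_unit, ih]

open CategoryTheory in
/-- The endomorphism of the bar resolution induced by an endomorphism of the module. -/
def barMapHom (h : X →ₗ[A] X) : X.barResolution.complex ⟶ X.barResolution.complex where
  f n := ModuleCat.ofHom (X.barMap h (n + 1))
  comm' i j hij := by
    obtain rfl : j + 1 = i := hij
    rw [barResolution_d]
    exact ModuleCat.hom_ext (LinearMap.ext fun t => X.barD_barMap h (j + 1) t)

section Cochain

variable {N : Type u} [AddCommGroup N] [Module k N]

/-- The `k`-linear map on `A ^ {⊗ n} ⊗ X` given by a cochain. -/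
def barLift : (n : ℕ) → MultilinearMap k (fun _ : Fin n => A) (X →ₗ[k] N) →ₗ[k]
    (X.bar n →ₗ[k] N)
  | 0 =>
    { toFun := fun c => c 0
      map_add' := fun _ _ => rfl
      map_smul' := fun _ _ => rfl }
  | n + 1 =>
    { toFun := fun c => (TensorProduct.lift ((barLift n).comp
        (MultilinearMap.curryLeft c)) : A ⊗[k] X.bar n →ₗ[k] N)
      map_add' := fun c c' => TensorProduct.ext' fun a t => by
        change barLift n (c.curryLeft a + c'.curryLeft a) t = _
        rw [map_add]
        rfl
      map_smul' := fun r c => TensorProduct.ext' fun a t => by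
        change barLift n (r • c.curryLeft a) t = _
        rw [map_smul]
        rfl }

theorem smul_barUnit {n : ℕ} (a : A) (t : X.bar n) :
    a • X.barUnit n t = (a ⊗ₜ[k] t : A ⊗[k] X.bar n) := by
  change a • ((1 : A) ⊗ₜ[k] t) = _
  rw [TensorProduct.smul_tmul', smul_eq_mul, mul_one]

theorem barLift_barTensor {n : ℕ} (c : MultilinearMap k (fun _ : Fin n => A) (X →ₗ[k] N))
    (a : Fin n → A) (x : X) : X.barLift n c (X.barTensor n a x) = c a x := by
  induction n with
  | zero =>
    rw [Subsingleton.elim a 0]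
    rfl
  | succ n ih =>
    rw [barTensor_succ, smul_barUnit]
    change X.barLift n (c.curryLeft (a 0)) _ = _
    rw [ih, MultilinearMap.curryLeft_apply]
    congr 2
    exact Fin.cons_self_tail a

/-- The tensors a₁ ⊗ ⋯ ⊗ aₙ ⊗ x span. In the induction the leading factor a is absorbed into the
map, v ↦ g(a ⊗ v). -/
theorem hom_eq_zero_of_barTensor {n : ℕ} (g : X.bar n →ₗ[k] N)
    (h : ∀ a x, g (X.barTensor n a x) = 0) (t : X.bar n) : g t = 0 := by
  induction n with
  | zero => exact h 0 t
  | succ n ih =>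
    refine X.bar_induction (p := fun t => g t = 0) (fun a v => ?_) (fun x y hx hy => ?_) t
    · refine ih (g.comp ((Algebra.lsmul k k (X.bar (n + 1)) a).comp (X.barUnit n)))
        (fun b x => ?_) v
      exact h (Fin.cons a b) x
    · rw [map_add, hx, hy, add_zero]

variable [Module A N] [IsScalarTower k A N]

/-- The cochain `(a₁, …, aₙ) ↦ (x ↦ ψ (1 ⊗ a₁ ⊗ ⋯ ⊗ aₙ ⊗ x))`. -/
def toCochain {n : ℕ} (ψ : X.bar (n + 1) →ₗ[A] N) :
    MultilinearMap k (fun _ : Fin n => A) (X →ₗ[k] N) :=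
  (LinearMap.llcomp k X (X.bar n) N
    ((ψ.restrictScalars k).comp (X.barUnit n))).compMultilinearMap (X.barTensor n)

theorem toCochain_apply {n : ℕ} (ψ : X.bar (n + 1) →ₗ[A] N) (a : Fin n → A) (x : X) :
    X.toCochain ψ a x = ψ (X.barUnit n (X.barTensor n a x)) := rfl

/-- Together with `toCochain_surjective` this is the adjunction Hom_A(A ⊗ A^{⊗ n} ⊗ X, N) =
Hom_k(A^{⊗ n}, Hom_k(X, N)). -/
theorem toCochain_injective {n : ℕ} {ψ ψ' : X.bar (n + 1) →ₗ[A] N}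
    (h : X.toCochain ψ = X.toCochain ψ') : ψ = ψ' := by
  refine X.bar_hom_ext fun t => sub_eq_zero.1 ?_
  refine X.hom_eq_zero_of_barTensor
    ((ψ.restrictScalars k).comp (X.barUnit n) - (ψ'.restrictScalars k).comp (X.barUnit n))
    (fun a x => sub_eq_zero.2 ?_) t
  exact LinearMap.congr_fun (congrFun (congrArg DFunLike.coe h) a) x

theorem toCochain_surjective {n : ℕ} (c : MultilinearMap k (fun _ : Fin n => A) (X →ₗ[k] N)) :
    ∃ ψ : X.bar (n + 1) →ₗ[A] N, X.toCochain ψ = c := by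
  refine ⟨X.barExtend (X.barLift n c), MultilinearMap.ext fun a => LinearMap.ext fun x => ?_⟩
  rw [toCochain_apply, barExtend_unit, barLift_barTensor]

end Cochain

/-- This identifies the cohomology of `X.rep` with Ext_A(X, X). For t = a₀ ⊗ t', d(1 ⊗ t) = t - 1 ⊗
d t: the first term gives the left multiplication by a₀, the second all other terms of the
Hochschild differential. -/
theorem differential_toCochain {n : ℕ} (ψ : X.bar (n + 1) →ₗ[A] X) :
    differential (Algebra.lsmul k k X : A →ₐ[k] Module.End k X) n (X.toCochain ψ) =
      X.toCochain (ψ.comp (X.barD (n + 1))) := by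
  refine MultilinearMap.ext fun a => LinearMap.ext fun x => ?_
  rw [differential_apply, toCochain_apply, LinearMap.comp_apply, barD_succ_unit, map_sub,
    barD_barTensor, barTensor_succ, map_smul]
  simp only [map_add, map_sum, LinearMap.add_apply, LinearMap.sum_apply, map_smul,
    LinearMap.smul_apply, Module.End.mul_apply, toCochain_apply, Algebra.lsmul_coe]
  rw [sub_eq_add_neg, neg_add, add_assoc]
  congr 1
  rw [← Finset.sum_neg_distrib]
  have hψ : ∀ (c : k) (y : X.bar (n + 1)), ψ (c • y) = c • ψ y :=
    fun c y => (ψ.restrictScalars k).map_smul c y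
  simp only [hψ, pow_succ, mul_neg_one, neg_smul]

end BarModule

/-! ### Cohomology from a minimal resolution -/

section Minimal

open CategoryTheory

variable {k A : Type u} [Field k] [Ring A] [Algebra k A] (X : BarModule k A)

/-- The representation of `A` on the module. -/
abbrev BarModule.rep : A →ₐ[k] Module.End k X := Algebra.lsmul k k X

theorem toCochain_mem_cocycles {n : ℕ} {ψ : X.bar (n + 1) →ₗ[A] X}
    (h : ∀ t, ψ (X.barD (n + 1) t) = 0) : X.toCochain ψ ∈ cocycles X.rep n := by
  refine LinearMap.mem_ker.2 ((X.differential_toCochain ψ).trans ?_)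
  rw [show ψ.comp (X.barD (n + 1)) = 0 from LinearMap.ext h]
  rfl

/-- The hypotheses have the shape in which `exists_homotopy_of_lift` describes its term t: zero in
degree 0, factoring through the differential above. -/
theorem toCochain_mem_coboundaries {n : ℕ} {ψ : X.bar (n + 1) →ₗ[A] X} (h0 : n = 0 → ψ = 0)
    (h : ∀ m, n = m + 1 → ∃ r : X.barResolution.complex.X m →ₗ[A] X,
      ∀ t, ψ t = r ((X.barResolution.complex.d n m).hom t)) :
    X.toCochain ψ ∈ coboundaries X.rep n := by
  cases n with
  | zero =>
    rw [h0 rfl]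
    rfl
  | succ n =>
    obtain ⟨χ, hχ⟩ := h n rfl
    refine ⟨X.toCochain (n := n) χ, (X.differential_toCochain (n := n) χ).trans ?_⟩
    congr 1
    refine LinearMap.ext fun t => (hχ t).symm ▸ ?_
    rw [X.barResolution_d]
    rfl

theorem exists_of_toCochain_mem_coboundaries {n : ℕ} {ψ : X.bar (n + 1) →ₗ[A] X}
    (h : X.toCochain ψ ∈ coboundaries X.rep n) : (n = 0 → ψ = 0) ∧
    ∀ m, n = m + 1 → ∃ r : X.barResolution.complex.X m →ₗ[A] X,
      ∀ t, ψ t = r ((X.barResolution.complex.d n m).hom t) := by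
  cases n with
  | zero => exact ⟨fun _ => X.toCochain_injective h, fun m hm => by omega⟩
  | succ n =>
    refine ⟨fun h => by omega, fun m hm => ?_⟩
    obtain rfl : n = m := by omega
    obtain ⟨c, hc⟩ := h
    obtain ⟨χ, rfl⟩ := X.toCochain_surjective c
    refine ⟨χ, fun t => ?_⟩
    have := (X.differential_toCochain χ).symm.trans hc
    rw [← X.toCochain_injective this, X.barResolution_d]
    rfl

/-- Hence the complex Hom_A(P, X) has zero differential, so that each Hom_A(Pₙ, X) is already
Ext^n(M, X). -/
theorem eq_zero_of_minimal {M : ModuleCat.{u} A} {P : ProjectiveResolution M}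
    (hP : IsMinimal P) (hX : ∀ a ∈ Ring.jacobson A, ∀ x : X, a • x = 0) {n : ℕ}
    (φ : P.complex.X n →ₗ[A] X) (y : P.complex.X (n + 1)) :
    φ ((P.complex.d (n + 1) n).hom y) = 0 := by
  have h := hP n (LinearMap.mem_range_self _ y)
  refine Submodule.smul_induction_on (p := fun z => φ z = 0) h (fun a ha z _ => ?_)
    (fun x y hx hy => ?_)
  · rw [map_smul, hX a ha]
  · rw [map_add, hx, hy, add_zero]

variable {M : ModuleCat.{u} A} (P : ProjectiveResolution M) (π : X →ₗ[A] M)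

/-- A lift of `π : X → M` to resolutions. -/
def barToRes (n : ℕ) : X.bar (n + 1) →ₗ[A] P.complex.X n :=
  ((ProjectiveResolution.lift (ModuleCat.ofHom π) X.barResolution P).f n).hom

theorem barToRes_barD (n : ℕ) (t : X.bar (n + 2)) :
    barToRes X P π n (X.barD (n + 1) t) =
      (P.complex.d (n + 1) n).hom (barToRes X P π (n + 1) t) := by
  have h := (ProjectiveResolution.lift (ModuleCat.ofHom π) X.barResolution P).comm (n + 1) n
  rw [X.barResolution_d] at h
  exact (LinearMap.congr_fun (congrArg ModuleCat.Hom.hom h) t).symm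

variable {P}

/-- The cocycle on `A` given by a homomorphism `Pₙ → X` and `π : X → M`. -/
def homToCocycles (hP : IsMinimal P) (hX : ∀ a ∈ Ring.jacobson A, ∀ x : X, a • x = 0) (n : ℕ) :
    (P.complex.X n →ₗ[A] X) →ₗ[k] cocycles X.rep n where
  toFun φ := ⟨X.toCochain (φ.comp (barToRes X P π n)), toCochain_mem_cocycles X fun t => by
    rw [LinearMap.comp_apply, barToRes_barD]
    exact eq_zero_of_minimal X hP hX φ _⟩
  map_add' _ _ := rfl
  map_smul' _ _ := rfl

/-- The map `Hom_A (Pₙ, X) → HHⁿ(A, End X)` induced by `π : X → M`, for a minimal resolution `P`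
of `M` and a module `X` without action of the radical. -/
def homToHH (hP : IsMinimal P) (hX : ∀ a ∈ Ring.jacobson A, ∀ x : X, a • x = 0) (n : ℕ) :
    (P.complex.X n →ₗ[A] X) →ₗ[k] HH X.rep n :=
  (HH.mk X.rep n).comp (homToCocycles X π hP hX n)

variable {π} {ι : M →ₗ[A] X} (hι : ∀ m, π (ι m) = m)

include hι

/-- M is a retract of X, so the lift of ι followed by the lift of π is homotopic to the identity of
P, and φ kills the homotopy terms by minimality. If the class of φ is a coboundary χ ∘ d, then
precomposing with the lift of ι recovers φ as a map that factors through the differential of P, and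
this vanishes too. -/
theorem homToHH_injective (hP : IsMinimal P) (hX : ∀ a ∈ Ring.jacobson A, ∀ x : X, a • x = 0)
    (n : ℕ) : Function.Injective (homToHH X π hP hX n) := by
  refine (injective_iff_map_eq_zero _).2 fun φ hφ => ?_
  obtain ⟨h0, h1⟩ := exists_of_toCochain_mem_coboundaries X ((HH.mk_eq_zero X.rep).1 hφ)
  obtain ⟨s, t, hst, ht0, ht1⟩ := exists_homotopy_of_lift
    (ProjectiveResolution.lift (ModuleCat.ofHom ι) P X.barResolution ≫
      ProjectiveResolution.lift (ModuleCat.ofHom π) X.barResolution P) (𝟙 P.complex) (by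
    refine ModuleCat.hom_ext (LinearMap.ext fun x => (π_lift_apply _ _ _ _).trans ?_)
    exact (congrArg π (π_lift_apply (ModuleCat.ofHom ι) P X.barResolution x)).trans (hι _)) n
  have key : ∀ x, φ (barToRes X P π n
      (((ProjectiveResolution.lift (ModuleCat.ofHom ι) P X.barResolution).f n).hom x)) =
      φ x + φ (t x) := fun x => by
    have := congrArg φ (hst x)
    rw [map_add, map_add, eq_zero_of_minimal X hP hX, add_zero] at this
    exact this
  refine LinearMap.ext fun x => ?_
  have hx := key x
  cases n with
  | zero =>
    rw [ht0 rfl] at hx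
    have h2 := LinearMap.congr_fun (h0 rfl)
      (((ProjectiveResolution.lift (ModuleCat.ofHom ι) P X.barResolution).f 0).hom x)
    rw [LinearMap.zero_apply, map_zero, add_zero] at hx
    exact hx.symm.trans h2
  | succ n =>
    obtain ⟨r, hr⟩ := ht1 n rfl
    obtain ⟨χ, hχ⟩ := h1 n rfl
    have h2 := hχ (((ProjectiveResolution.lift (ModuleCat.ofHom ι) P X.barResolution).f
      (n + 1)).hom x)
    rw [hr x, show φ (r ((P.complex.d (n + 1) n).hom x)) = 0 from
      eq_zero_of_minimal X hP hX (φ.comp r) x, add_zero] at hx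
    refine hx.symm.trans (h2.trans ?_)
    have h3 := (ProjectiveResolution.lift (ModuleCat.ofHom ι) P X.barResolution).comm (n + 1) n
    have h4 := LinearMap.congr_fun (congrArg ModuleCat.Hom.hom h3) x
    refine (congrArg χ h4).trans ?_
    exact eq_zero_of_minimal X hP hX
      (χ.comp ((ProjectiveResolution.lift (ModuleCat.ofHom ι) P X.barResolution).f n).hom) x

omit hι

/-- The class in `HH⁰(A, End X) = End_A X` of an `A`-linear endomorphism. -/
def endCocycle (e : X →ₗ[A] X) : cocycles X.rep 0 :=
  ⟨MultilinearMap.constOfIsEmpty k _ (e.restrictScalars k), by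
    refine LinearMap.mem_ker.2 (MultilinearMap.ext fun a => LinearMap.ext fun x => ?_)
    rw [differential_apply]
    simp⟩

/-- The cup product with a degree 0 class on the right composes the values of the cochain with e on
X, which is what `barMap e` does to the last tensor factor. -/
theorem mul_endCocycle (e : X →ₗ[A] X) {n : ℕ} (ψ : X.bar (n + 1) →ₗ[A] X)
    (h : X.toCochain ψ ∈ cocycles X.rep n)
    (h' : X.toCochain (ψ.comp (X.barMap e (n + 1))) ∈ cocycles X.rep n) :
    HH.mul X.rep n 0 (HH.mk X.rep n ⟨X.toCochain ψ, h⟩) (HH.mk X.rep 0 (endCocycle X e)) =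
      HH.mk X.rep n ⟨X.toCochain (ψ.comp (X.barMap e (n + 1))), h'⟩ := by
  rw [HH.mul_mk]
  refine congrArg (HH.mk X.rep n) (Subtype.ext (MultilinearMap.ext fun a => LinearMap.ext
    fun x => ?_))
  refine (LinearMap.congr_fun (Cochain.cup_apply (X.toCochain ψ) (endCocycle X e).1 a) x).trans ?_
  rw [X.toCochain_apply (n := n) _ a x, LinearMap.comp_apply, X.barMap_unit, X.barMap_barTensor]
  rfl

theorem mk_eq_mk_of_sub {n : ℕ} {ψ ψ' : X.bar (n + 1) →ₗ[A] X}
    {h : X.toCochain ψ ∈ cocycles X.rep n} {h' : X.toCochain ψ' ∈ cocycles X.rep n}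
    (H : X.toCochain (ψ - ψ') ∈ coboundaries X.rep n) :
    HH.mk X.rep n ⟨X.toCochain ψ, h⟩ = HH.mk X.rep n ⟨X.toCochain ψ', h'⟩ := by
  refine sub_eq_zero.1 ?_
  rw [← map_sub]
  exact (HH.mk_eq_zero X.rep).2 H

include hι

/-- For the idempotent e = ι ∘ π this says Ext(M, X) = Ext(X, X) e. The condition is phrased as
being fixed under right multiplication because that commutes with the left action of H. -/
theorem range_homToHH (hP : IsMinimal P) (hX : ∀ a ∈ Ring.jacobson A, ∀ x : X, a • x = 0)
    (n : ℕ) (x : HH X.rep n) : x ∈ LinearMap.range (homToHH X π hP hX n) ↔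
      HH.mul X.rep n 0 x (HH.mk X.rep 0 (endCocycle X (ι.comp π))) = x := by
  constructor
  · rintro ⟨φ, rfl⟩
    have hc : ∀ t, ((φ.comp (barToRes X P π n)).comp (X.barMap (ι.comp π) (n + 1)))
        (X.barD (n + 1) t) = 0 := fun t => by
      rw [LinearMap.comp_apply, ← X.barD_barMap, LinearMap.comp_apply, barToRes_barD]
      exact eq_zero_of_minimal X hP hX φ _
    refine (mul_endCocycle X (ι.comp π) (φ.comp (barToRes X P π n)) _
      (toCochain_mem_cocycles X hc)).trans (mk_eq_mk_of_sub X ?_)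
    -- Since π ∘ (ι ∘ π) = π, both maps of complexes lift π.
    obtain ⟨s, t, hst, ht0, ht1⟩ := exists_homotopy_of_lift
      (X.barMapHom (ι.comp π) ≫ ProjectiveResolution.lift (ModuleCat.ofHom π) X.barResolution P)
      (ProjectiveResolution.lift (ModuleCat.ofHom π) X.barResolution P) (by
        rw [HomologicalComplex.comp_f, Category.assoc, ProjectiveResolution.lift_commutes_zero,
          X.barResolution_π]
        refine ModuleCat.hom_ext (LinearMap.ext fun y => ?_)
        exact (congrArg π (X.barD_barMap (ι.comp π) 0 y)).trans (hι _)) n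
    have key : ∀ y : X.bar (n + 1), φ (barToRes X P π n (X.barMap (ι.comp π) (n + 1) y)) =
        φ (barToRes X P π n y) + φ (t y) := fun y => by
      refine (congrArg φ (hst y)).trans ((map_add φ _ _).trans (congrArg (· + φ (t y)) ?_))
      refine (map_add φ _ _).trans ?_
      exact (congrArg (_ + ·) (eq_zero_of_minimal X hP hX φ (s y))).trans (add_zero _)
    refine toCochain_mem_coboundaries X (fun h => ?_) fun m hm => ?_
    · refine LinearMap.ext fun y => sub_eq_zero.2 ?_
      refine (key y).trans ?_
      rw [ht0 h]
      exact (congrArg (_ + ·) (map_zero φ)).trans (add_zero _)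
    · obtain ⟨r, hr⟩ := ht1 m hm
      exact ⟨φ.comp r, fun y => sub_eq_iff_eq_add'.2 ((key y).trans (congrArg (_ + ·) (congrArg φ (hr y))))⟩
  · obtain ⟨⟨c, hc⟩, rfl⟩ := HH.mk_surjective X.rep n x
    obtain ⟨ψ, rfl⟩ := X.toCochain_surjective c
    intro hx
    have hψ : ∀ t, ψ (X.barD (n + 1) t) = 0 := fun t => LinearMap.congr_fun
      (X.toCochain_injective (ψ := ψ.comp (X.barD (n + 1))) (ψ' := 0)
        ((X.differential_toCochain ψ).symm.trans hc)) t
    have hc' : ∀ t, (ψ.comp (X.barMap (ι.comp π) (n + 1))) (X.barD (n + 1) t) = 0 := fun t => by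
      rw [LinearMap.comp_apply, ← X.barD_barMap, hψ]
    -- The preimage of the class of ψ is its pullback along a lift of ι.
    refine ⟨ψ.comp ((ProjectiveResolution.lift (ModuleCat.ofHom ι) P X.barResolution).f n).hom,
      Eq.trans ?_ hx⟩
    refine Eq.trans ?_ (mul_endCocycle X (ι.comp π) ψ hc (toCochain_mem_cocycles X hc')).symm
    refine mk_eq_mk_of_sub X ?_
    -- Both maps of complexes lift ι ∘ π.
    obtain ⟨s, t, hst, ht0, ht1⟩ := exists_homotopy_of_lift
      (ProjectiveResolution.lift (ModuleCat.ofHom π) X.barResolution P ≫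
        ProjectiveResolution.lift (ModuleCat.ofHom ι) P X.barResolution)
      (X.barMapHom (ι.comp π)) (by
        refine ModuleCat.hom_ext (LinearMap.ext fun y => (π_lift_apply (ModuleCat.ofHom ι) P
          X.barResolution (barToRes X P π 0 y)).trans ?_)
        refine (congrArg ι (π_lift_apply (ModuleCat.ofHom π) X.barResolution P y)).trans ?_
        rw [X.barResolution_π]
        exact (X.barD_barMap (ι.comp π) 0 y).symm) n
    have key : ∀ y, ψ (((ProjectiveResolution.lift (ModuleCat.ofHom ι) P X.barResolution).f n).hom
        (barToRes X P π n y)) = ψ (X.barMap (ι.comp π) (n + 1) y) + ψ (t y) := fun y => by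
      have h1 := congrArg ψ (hst y)
      rw [X.barResolution_d] at h1
      refine h1.trans ((map_add ψ _ _).trans (congrArg (· + ψ (t y)) ?_))
      refine (map_add ψ _ _).trans ?_
      exact (congrArg (_ + ·) (hψ (s y))).trans (add_zero _)
    refine toCochain_mem_coboundaries X (fun h => ?_) fun m hm => ?_
    · refine LinearMap.ext fun y => sub_eq_zero.2 ?_
      refine (key y).trans ?_
      rw [ht0 h]
      exact (congrArg (_ + ·) (map_zero ψ)).trans (add_zero _)
    · obtain ⟨r, hr⟩ := ht1 m hm
      exact ⟨ψ.comp r, fun y => sub_eq_iff_eq_add'.2 ((key y).trans (congrArg (_ + ·) (congrArg ψ (hr y))))⟩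

end Minimal

end HochschildTheory
end

noncomputable section

namespace HochschildTheory

/-! ### Quasi-polynomial sequences -/

section QuasiPolynomial

open Polynomial

/-- The shift operator on sequences. -/
def seqShift : Module.End ℤ (ℕ → ℤ) := LinearMap.funLeft ℤ ℤ (· + 1)

/-- The sequences that are eventually zero. -/
def eventuallyZero : Submodule ℤ (ℕ → ℤ) where
  carrier := {a | ∃ N, ∀ n ≥ N, a n = 0}
  add_mem' := by
    rintro a b ⟨N, hN⟩ ⟨M, hM⟩
    refine ⟨max N M, fun n hn => ?_⟩
    rw [Pi.add_apply, hN n (le_trans (le_max_left _ _) hn), hM n (le_trans (le_max_right _ _) hn),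
      add_zero]
  zero_mem' := ⟨0, fun _ _ => rfl⟩
  smul_mem' := by
    rintro c a ⟨N, hN⟩
    exact ⟨N, fun n hn => by rw [Pi.smul_apply, hN n hn, smul_zero]⟩

theorem seqShift_pow_apply (d : ℕ) (a : ℕ → ℤ) (n : ℕ) : (seqShift ^ d) a n = a (n + d) := by
  induction d generalizing a n with
  | zero => rfl
  | succ d ih =>
    rw [pow_succ, Module.End.mul_apply, ih]
    rfl

theorem aeval_seqShift_mem (p : ℤ[X]) {a : ℕ → ℤ} (ha : a ∈ eventuallyZero) :
    aeval seqShift p a ∈ eventuallyZero := by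
  induction p using Polynomial.induction_on' with
  | add p q hp hq =>
    rw [map_add]
    exact add_mem hp hq
  | monomial n c =>
    obtain ⟨N, hN⟩ := ha
    refine ⟨N, fun m hm => ?_⟩
    rw [aeval_monomial, Module.End.mul_apply, Module.algebraMap_end_apply, Pi.smul_apply,
      seqShift_pow_apply, hN _ (by omega), smul_zero]

/-- The polynomials in the shift that make a sequence eventually zero form an ideal. Two sequences
can therefore be brought to a common annihilator by passing to multiples. -/
theorem aeval_seqShift_mem_of_dvd {p q : ℤ[X]} (h : p ∣ q) {a : ℕ → ℤ}
    (ha : aeval seqShift p a ∈ eventuallyZero) : aeval seqShift q a ∈ eventuallyZero := by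
  obtain ⟨r, rfl⟩ := h
  rw [mul_comm, map_mul]
  exact aeval_seqShift_mem r ha

/-- A sequence is quasi-polynomial if its generating function is, up to a polynomial, of the form
`f(t) / (1 - t ^ d) ^ r`. -/
def IsQuasiPolynomial (a : ℕ → ℤ) : Prop :=
  ∃ d > 0, ∃ r : ℕ, aeval seqShift ((X ^ d - 1 : ℤ[X]) ^ r) a ∈ eventuallyZero

theorem X_pow_sub_one_pow_dvd {d e r s : ℕ} (h : d ∣ e) (h' : r ≤ s) :
    (X ^ d - 1 : ℤ[X]) ^ r ∣ (X ^ e - 1) ^ s := by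
  obtain ⟨f, rfl⟩ := h
  refine (pow_dvd_pow _ h').trans (pow_dvd_pow_of_dvd ?_ s)
  simpa [pow_mul] using sub_dvd_pow_sub_pow (X ^ d : ℤ[X]) 1 f

theorem IsQuasiPolynomial.of_eventuallyZero {a : ℕ → ℤ} (h : a ∈ eventuallyZero) :
    IsQuasiPolynomial a :=
  ⟨1, one_pos, 0, by simpa using h⟩

theorem IsQuasiPolynomial.sub {a b : ℕ → ℤ} (ha : IsQuasiPolynomial a)
    (hb : IsQuasiPolynomial b) : IsQuasiPolynomial (a - b) := by
  obtain ⟨d, hd, r, h⟩ := ha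
  obtain ⟨e, he, s, h'⟩ := hb
  refine ⟨d * e, Nat.mul_pos hd he, r + s, ?_⟩
  rw [map_sub]
  exact sub_mem
    (aeval_seqShift_mem_of_dvd (X_pow_sub_one_pow_dvd (Nat.dvd_mul_right d e) (by omega)) h)
    (aeval_seqShift_mem_of_dvd (X_pow_sub_one_pow_dvd (Nat.dvd_mul_left e d) (by omega)) h')

theorem IsQuasiPolynomial.shift {a : ℕ → ℤ} (ha : IsQuasiPolynomial a) (m : ℕ) :
    IsQuasiPolynomial fun n => a (n + m) := by
  obtain ⟨d, hd, r, h⟩ := ha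
  refine ⟨d, hd, r, ?_⟩
  have h1 : (fun n => a (n + m)) = aeval seqShift (X ^ m : ℤ[X]) a := by
    funext n
    rw [map_pow, aeval_X, seqShift_pow_apply]
  rw [h1, ← Module.End.mul_apply, ← map_mul]
  exact aeval_seqShift_mem_of_dvd (Dvd.intro _ rfl) h

/-- The hypothesis reads (X^d - 1) a = b, so an annihilator of b times X^d - 1 annihilates a. This
is the inductive step of the Hilbert–Serre argument. -/
theorem IsQuasiPolynomial.of_difference {a b : ℕ → ℤ} {d : ℕ} (hd : 0 < d)
    (hb : IsQuasiPolynomial b) (h : ∀ n, a (n + d) - a n = b n) : IsQuasiPolynomial a := by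
  obtain ⟨e, he, r, hr⟩ := hb
  have h1 : b = aeval seqShift (X ^ d - 1 : ℤ[X]) a := by
    funext n
    rw [← h, map_sub, map_pow, aeval_X, map_one, LinearMap.sub_apply, Pi.sub_apply,
      seqShift_pow_apply]
    rfl
  rw [h1, ← Module.End.mul_apply, ← map_mul] at hr
  refine ⟨d * e, Nat.mul_pos hd he, r + 1, aeval_seqShift_mem_of_dvd ?_ hr⟩
  rw [pow_succ]
  refine mul_dvd_mul (X_pow_sub_one_pow_dvd (Nat.dvd_mul_left e d) le_rfl) ?_
  simpa using X_pow_sub_one_pow_dvd (r := 1) (s := 1) (Nat.dvd_mul_right d e) le_rfl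

theorem aeval_seqShift_eq_fwdDiff (d r : ℕ) (a : ℕ → ℤ) :
    aeval seqShift ((X ^ d - 1 : ℤ[X]) ^ r) a = (fwdDiff d)^[r] a := by
  induction r generalizing a with
  | zero => simp
  | succ r ih =>
    rw [pow_succ, map_mul, Module.End.mul_apply, ih, Function.iterate_succ_apply]
    congr 1
    funext n
    rw [map_sub, map_pow, aeval_X, map_one, LinearMap.sub_apply, Pi.sub_apply,
      seqShift_pow_apply]
    rfl

/-- A quasi-polynomial sequence is eventually given by a polynomial on each residue class. -/
theorem IsQuasiPolynomial.exists_polynomial {a : ℕ → ℤ} (ha : IsQuasiPolynomial a) :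
    ∃ d > 0, ∃ (N : ℕ) (p : ℕ → ℝ[X]), ∀ i m : ℕ, (a (N + i + m * d) : ℝ) = (p i).eval (m : ℝ) := by
  obtain ⟨d, hd, r, N, hN⟩ := ha
  rw [aeval_seqShift_eq_fwdDiff] at hN
  have hz : ∀ k ≥ r, ∀ n ≥ N, (fwdDiff d)^[k] a n = 0 := by
    intro k hk
    induction k, hk using Nat.le_induction with
    | base => exact hN
    | succ k _ ih =>
      intro n hn
      rw [Function.iterate_succ_apply', fwdDiff, ih n hn, ih (n + d) (by omega), sub_zero]
  -- Newton's interpolation formula a(N + i + m d) = ∑ₖ (m choose k) Δᵏa(N + i) with step d, where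
  -- (m choose k) is the falling factorial of m divided by k!.
  refine ⟨d, hd, N, fun i => ∑ k ∈ Finset.range r,
    C (((fwdDiff d)^[k] a (N + i) : ℤ) / (k.factorial : ℝ)) * descPochhammer ℝ k, fun i m => ?_⟩
  have h1 := shift_eq_sum_fwdDiff_iter d a m (N + i)
  rw [smul_eq_mul] at h1
  rw [h1, eval_finsetSum]
  have h2 : ∀ k, (((m.choose k • (fwdDiff d)^[k] a (N + i) : ℤ)) : ℝ) =
      eval (m : ℝ) (C (((fwdDiff d)^[k] a (N + i) : ℤ) / (k.factorial : ℝ)) *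
        descPochhammer ℝ k) := by
    intro k
    rw [eval_mul, eval_C, descPochhammer_eval_eq_descFactorial, nsmul_eq_mul,
      Nat.descFactorial_eq_factorial_mul_choose]
    push_cast
    field_simp
  rw [Int.cast_sum, Finset.sum_congr rfl fun k _ => h2 k]
  -- Newton's sum runs over k ≤ m, the polynomial over k < r. The surplus terms vanish, since Δᵏa is
  -- zero beyond N for k ≥ r and (m choose k) is zero for k > m.
  rcases le_total r (m + 1) with h | h
  · refine (Finset.sum_subset (Finset.range_mono h) fun k _ hk => ?_).symm
    rw [← h2, hz k (by simpa using hk) _ (by omega)]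
    simp
  · refine Finset.sum_subset (Finset.range_mono h) fun k _ hk => ?_
    rw [← h2, Nat.choose_eq_zero_of_lt (by simpa using hk)]
    simp

end QuasiPolynomial

/-! ### Growth of sequences -/

section Growth

open Polynomial Filter Topology

/-- A sequence has growth `c` if it is bounded by a multiple of `n ^ (c - 1)`, and is at least a
multiple of it on an arithmetic progression. -/
def HasGrowth (q : ℕ → ℕ) : ℕ → Prop
  | 0 => ∃ N, ∀ n ≥ N, q n = 0
  | e + 1 => (∃ B : ℝ, ∀ n, (q n : ℝ) ≤ B * ((n : ℝ) + 1) ^ e) ∧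
      ∃ (r d : ℕ) (β : ℝ) (M : ℕ), 0 < d ∧ 0 < β ∧ ∀ m ≥ M, β * (m : ℝ) ^ e ≤ q (r + m * d)

theorem abs_eval_le (p : ℝ[X]) {e : ℕ} (he : p.natDegree ≤ e) :
    ∃ B : ℝ, 0 ≤ B ∧ ∀ m : ℕ, |p.eval (m : ℝ)| ≤ B * ((m : ℝ) + 1) ^ e := by
  refine ⟨∑ j ∈ Finset.range (p.natDegree + 1), |p.coeff j|,
    Finset.sum_nonneg fun _ _ => abs_nonneg _, fun m => ?_⟩
  rw [eval_eq_sum_range, Finset.sum_mul]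
  refine (Finset.abs_sum_le_sum_abs _ _).trans (Finset.sum_le_sum fun j hj => ?_)
  rw [abs_mul, abs_of_nonneg (a := (m : ℝ) ^ j) (pow_nonneg (Nat.cast_nonneg m) j)]
  refine mul_le_mul_of_nonneg_left ?_ (abs_nonneg _)
  rw [Finset.mem_range] at hj
  refine (pow_le_pow_left₀ (Nat.cast_nonneg m) (by linarith) j).trans
    (pow_le_pow_right₀ ?_ (by omega))
  have : (0 : ℝ) ≤ m := Nat.cast_nonneg m
  linarith

/-- The leading coefficient is the limit of the nonnegative quotients p(m) / m^deg, so it is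
positive, and half of it serves as β. -/
theorem eval_ge_of_nonneg {p : ℝ[X]} (hp : p ≠ 0) (h : ∀ m : ℕ, 0 ≤ p.eval (m : ℝ)) :
    ∃ β > 0, ∃ M : ℕ, ∀ m ≥ M, β * (m : ℝ) ^ p.natDegree ≤ p.eval (m : ℝ) := by
  have ht : Tendsto (fun m : ℕ => p.eval (m : ℝ) / (X ^ p.natDegree : ℝ[X]).eval (m : ℝ)) atTop
      (𝓝 (p.leadingCoeff / (X ^ p.natDegree : ℝ[X]).leadingCoeff)) :=
    (p.div_tendsto_atTop_leadingCoeff_div_of_degree_eq _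
      (by rw [degree_X_pow, degree_eq_natDegree hp])).comp tendsto_natCast_atTop_atTop
  rw [leadingCoeff_X_pow, div_one] at ht
  simp only [eval_pow, eval_X] at ht
  have hlc : 0 < p.leadingCoeff := lt_of_le_of_ne
    (ge_of_tendsto' ht fun m => div_nonneg (h m) (pow_nonneg (Nat.cast_nonneg m) _))
    (leadingCoeff_ne_zero.2 hp).symm
  obtain ⟨M, hM⟩ := eventually_atTop.1 (ht.eventually (lt_mem_nhds (half_lt_self hlc)))
  refine ⟨p.leadingCoeff / 2, half_pos hlc, M + 1, fun m hm => ?_⟩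
  have hm0 : (0 : ℝ) < m := by exact_mod_cast (by omega : 0 < m)
  exact ((lt_div_iff₀ (pow_pos hm0 _)).1 (hM m (by omega))).le

/-- The exponent is the largest degree among the polynomials of the residue classes. All classes
obey the upper bound, and a class of largest degree is the progression of the lower bound; if all
the polynomials vanish, the growth is 0. -/
theorem exists_hasGrowth {q : ℕ → ℕ} (hq : IsQuasiPolynomial fun n => (q n : ℤ)) :
    ∃ c, HasGrowth q c := by
  obtain ⟨d, hd, N, p, hp⟩ := hq.exists_polynomial
  replace hp : ∀ i m : ℕ, (q (N + i + m * d) : ℝ) = (p i).eval (m : ℝ) := fun i m => by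
    rw [← hp]
    simp
  have hdiv : ∀ n ≥ N, ∃ i < d, ∃ m, n = N + i + m * d := fun n hn =>
    ⟨(n - N) % d, Nat.mod_lt _ hd, (n - N) / d, by
      have := Nat.mod_add_div (n - N) d
      rw [mul_comm d] at this
      omega⟩
  by_cases h0 : ∀ i < d, p i = 0
  · refine ⟨0, N, fun n hn => ?_⟩
    obtain ⟨i, hi, m, rfl⟩ := hdiv n hn
    have := hp i m
    rw [h0 i hi, eval_zero] at this
    exact_mod_cast this
  · push Not at h0
    obtain ⟨i₁, hi₁, hne₁⟩ := h0
    obtain ⟨i₀, hi₀, hmax⟩ := Finset.exists_max_image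
      ((Finset.range d).filter fun i => p i ≠ 0) (fun i => (p i).natDegree)
      ⟨i₁, by simp [hi₁, hne₁]⟩
    simp only [Finset.mem_filter, Finset.mem_range] at hi₀ hmax
    refine ⟨(p i₀).natDegree + 1, ?_, ?_⟩
    · have hdeg : ∀ i, i < d → (p i).natDegree ≤ (p i₀).natDegree := fun i hi => by
        by_cases h : p i = 0
        · simp [h]
        · exact hmax i ⟨hi, h⟩
      have hB : ∀ i, ∃ B : ℝ, 0 ≤ B ∧ (i < d → ∀ m : ℕ, |(p i).eval (m : ℝ)| ≤
          B * ((m : ℝ) + 1) ^ (p i₀).natDegree) := fun i => by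
        by_cases hi : i < d
        · obtain ⟨B, hB, h⟩ := abs_eval_le (p i) (hdeg i hi)
          exact ⟨B, hB, fun _ => h⟩
        · exact ⟨0, le_rfl, fun h => absurd h hi⟩
      choose B hB0 hB using hB
      have hS1 : 0 ≤ ∑ i ∈ Finset.range d, B i := Finset.sum_nonneg fun i _ => hB0 i
      have hS2 : (0 : ℝ) ≤ ∑ n ∈ Finset.range N, (q n : ℝ) :=
        Finset.sum_nonneg fun i _ => Nat.cast_nonneg _
      -- The second sum absorbs the initial values n < N, where no polynomial describes q.
      refine ⟨∑ i ∈ Finset.range d, B i + ∑ n ∈ Finset.range N, (q n : ℝ), fun n => ?_⟩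
      have hn1 : (1 : ℝ) ≤ ((n : ℝ) + 1) ^ (p i₀).natDegree :=
        one_le_pow₀ (by have : (0 : ℝ) ≤ n := Nat.cast_nonneg n
                        linarith)
      rcases Nat.lt_or_ge n N with hn | hn
      · have h1 : (q n : ℝ) ≤ ∑ n ∈ Finset.range N, (q n : ℝ) :=
          Finset.single_le_sum (f := fun n => (q n : ℝ)) (fun i _ => Nat.cast_nonneg _)
            (Finset.mem_range.2 hn)
        nlinarith
      · obtain ⟨i, hi, m, rfl⟩ := hdiv n hn
        rw [hp]
        have h1 : B i ≤ ∑ i ∈ Finset.range d, B i :=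
          Finset.single_le_sum (f := B) (fun i _ => hB0 i) (Finset.mem_range.2 hi)
        have h2 : ((m : ℝ) + 1) ^ (p i₀).natDegree ≤
            (((N + i + m * d : ℕ) : ℝ) + 1) ^ (p i₀).natDegree := by
          refine pow_le_pow_left₀ (by positivity) ?_ _
          have : m ≤ N + i + m * d := le_trans (Nat.le_mul_of_pos_right m hd) (by omega)
          have : (m : ℝ) ≤ ((N + i + m * d : ℕ) : ℝ) := by exact_mod_cast this
          linarith
        refine (le_abs_self _).trans ((hB i hi m).trans ?_)
        exact mul_le_mul (by linarith) h2 (by positivity) (by linarith)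
    · obtain ⟨β, hβ, M, h⟩ := eval_ge_of_nonneg hi₀.2 fun m => by
        rw [← hp]
        exact Nat.cast_nonneg _
      exact ⟨N + i₀, d, β, M, hd, hβ, fun m hm => by rw [hp]; exact h m hm⟩

/-- Transfers growth from the dimensions of Hom_A(Pₙ, A/Jac A) to those of Pₙ. -/
theorem HasGrowth.of_le_mul {p q : ℕ → ℕ} {c : ℕ} (hq : HasGrowth q c) {C D : ℕ}
    (h : ∀ n, p n ≤ C * q n) (h' : ∀ n, q n ≤ D * p n) : HasGrowth p c := by
  cases c with
  | zero =>
    obtain ⟨N, hN⟩ := hq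
    exact ⟨N, fun n hn => by simpa [hN n hn] using h n⟩
  | succ e =>
    obtain ⟨⟨B, hB⟩, r, d, β, M, hd, hβ, hM⟩ := hq
    refine ⟨⟨C * B, fun n => ?_⟩, r, d, β / (D + 1), M, hd, by positivity, fun m hm => ?_⟩
    · have : (p n : ℝ) ≤ C * q n := by exact_mod_cast h n
      refine this.trans ?_
      rw [mul_assoc]
      exact mul_le_mul_of_nonneg_left (hB n) (Nat.cast_nonneg C)
    · have h1 : (q (r + m * d) : ℝ) ≤ D * p (r + m * d) := by exact_mod_cast h' _
      have h2 := hM m hm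
      have h3 : (0 : ℝ) ≤ p (r + m * d) := Nat.cast_nonneg _
      rw [div_mul_eq_mul_div, div_le_iff₀ (by positivity)]
      linarith

/-- The part of `HasGrowth` that determines the rate of growth. -/
def HasGrowthRate (q : ℕ → ℕ) : ℕ → Prop
  | 0 => ∃ N, ∀ n ≥ N, q n = 0
  | e + 1 => (∃ B : ℝ, ∀ n, (q n : ℝ) ≤ B * ((n : ℝ) + 1) ^ e) ∧
      ∃ β : ℝ, 0 < β ∧ ∀ N : ℕ, ∃ n ≥ N, β * (n : ℝ) ^ e ≤ q n

theorem HasGrowth.hasGrowthRate {q : ℕ → ℕ} {c : ℕ} (hq : HasGrowth q c) : HasGrowthRate q c := by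
  cases c with
  | zero => exact hq
  | succ e =>
    obtain ⟨hB, r, d, β, M, hd, hβ, hM⟩ := hq
    -- For m ≥ 1 one has r + m d ≤ (r + d) m, which explains the constant. The choice m = M + N + 1
    -- passes both thresholds.
    refine ⟨hB, β / ((r : ℝ) + d) ^ e, by positivity, fun N => ⟨r + (M + N + 1) * d, ?_, ?_⟩⟩
    · have : M + N + 1 ≤ (M + N + 1) * d := Nat.le_mul_of_pos_right _ hd
      omega
    · refine le_trans ?_ (hM (M + N + 1) (by omega))
      rw [div_mul_eq_mul_div, div_le_iff₀ (by positivity), mul_assoc, ← mul_pow]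
      refine mul_le_mul_of_nonneg_left (pow_le_pow_left₀ (by positivity) ?_ e) hβ.le
      push_cast
      have h1 : (0 : ℝ) ≤ r := Nat.cast_nonneg r
      have h2 : (0 : ℝ) ≤ M := Nat.cast_nonneg M
      have h3 : (0 : ℝ) ≤ N := Nat.cast_nonneg N
      nlinarith [mul_nonneg h1 (add_nonneg h2 h3)]

/-- A smaller exponent c' ≤ e would give β n^e ≤ |b| n^(e-1), that is n ≤ |b| / β, for arbitrarily
large n. -/
theorem HasGrowthRate.growthRate_eq {q : ℕ → ℕ} {c : ℕ} (hq : HasGrowthRate q c) :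
    growthRate q = c := by
  refine le_antisymm (iInf₂_le c ?_) (le_iInf₂ fun c' hc' => ?_)
  · cases c with
    | zero =>
      obtain ⟨N, hN⟩ := hq
      -- For c = 0 the required bound is b / n, so b has to dominate every q(n) n; only finitely
      -- many of these are nonzero.
      refine ⟨∑ n ∈ Finset.range N, (q n : ℝ) * n, fun n hn => ?_⟩
      have hn' : (0 : ℝ) < n := by exact_mod_cast hn
      rw [Nat.cast_zero, zero_sub, zpow_neg_one, ← div_eq_mul_inv, le_div_iff₀ hn']
      rcases Nat.lt_or_ge n N with h | h
      · exact Finset.single_le_sum (f := fun n => (q n : ℝ) * n) (fun i _ => by positivity)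
          (Finset.mem_range.2 h)
      · rw [hN n h, Nat.cast_zero, zero_mul]
        exact Finset.sum_nonneg fun i _ => by positivity
    | succ e =>
      obtain ⟨⟨B, hB⟩, -⟩ := hq
      refine ⟨B * 2 ^ e, fun n hn => (hB n).trans ?_⟩
      have hn' : (1 : ℝ) ≤ n := by exact_mod_cast hn
      have hB0 : 0 ≤ B := by
        have h0 := hB 0
        have : (0 : ℝ) ≤ q 0 := Nat.cast_nonneg _
        simp at h0
        linarith
      rw [Nat.cast_succ, add_sub_cancel_right, zpow_natCast, mul_assoc, ← mul_pow]
      exact mul_le_mul_of_nonneg_left (pow_le_pow_left₀ (by positivity) (by linarith) e) hB0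
  · cases c with
    | zero => simp
    | succ e =>
      obtain ⟨-, β, hβ, hN⟩ := hq
      obtain ⟨b, hb⟩ := hc'
      by_contra hlt
      have hlt' : c' < e + 1 := by exact_mod_cast not_le.1 hlt
      obtain ⟨n, hn, hle⟩ := hN (⌈|b| / β⌉₊ + 1)
      have hn1 : 0 < n := by omega
      have hn' : (1 : ℝ) ≤ n := by exact_mod_cast hn1
      have h1 : β * (n : ℝ) ^ e ≤ |b| * (n : ℝ) ^ ((e : ℤ) - 1) :=
        hle.trans ((hb n hn1).trans (mul_le_mul (le_abs_self b)
          (zpow_le_zpow_right₀ hn' (by omega)) (by positivity) (abs_nonneg b)))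
      rw [zpow_sub_one₀ (by positivity), zpow_natCast, ← mul_assoc, ← div_eq_mul_inv,
        le_div_iff₀ (by positivity)] at h1
      have h2 : β * n ≤ |b| := by
        have hp : (0 : ℝ) < (n : ℝ) ^ e := by positivity
        refine le_of_mul_le_mul_right ?_ hp
        linarith
      have h3 : (n : ℝ) ≤ |b| / β := by
        rw [le_div_iff₀ hβ]
        linarith
      have h4 : |b| / β < n := (Nat.le_ceil _).trans_lt (by exact_mod_cast hn)
      linarith

/-- The convolution of two sequences. -/
def convolution (p q : ℕ → ℕ) (n : ℕ) : ℕ := ∑ x ∈ Finset.HasAntidiagonal.antidiagonal n, p x.1 * q x.2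

theorem convolution_comm (p q : ℕ → ℕ) : convolution p q = convolution q p := by
  funext n
  refine (Finset.Nat.sum_antidiagonal_swap (f := fun x => p x.1 * q x.2)).symm.trans ?_
  exact Finset.sum_congr rfl fun x _ => mul_comm _ _

/-- The sequence p has finite support, so the convolution is at most (∑ p) times the bound for q. It
is at least p(0) q(n) ≥ q(n), which is where the positive initial value enters. -/
theorem HasGrowth.convolution_zero {p q : ℕ → ℕ} {c : ℕ} (hp : HasGrowth p 0)
    (hq : HasGrowth q c) (hp0 : 0 < p 0) : HasGrowthRate (convolution p q) c := by
  obtain ⟨N, hN⟩ := hp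
  cases c with
  | zero =>
    obtain ⟨M, hM⟩ := hq
    refine ⟨N + M, fun n hn => Finset.sum_eq_zero fun x hx => ?_⟩
    rw [Finset.HasAntidiagonal.mem_antidiagonal] at hx
    rcases Nat.lt_or_ge x.1 N with h | h
    · rw [hM x.2 (by omega), mul_zero]
    · rw [hN x.1 h, zero_mul]
  | succ e =>
    obtain ⟨B, hB⟩ := hq.1
    have hB0 : 0 ≤ B := by
      have h0 := hB 0
      have : (0 : ℝ) ≤ q 0 := Nat.cast_nonneg _
      simp at h0
      linarith
    refine ⟨⟨(∑ i ∈ Finset.range N, (p i : ℝ)) * B, fun n => ?_⟩, ?_⟩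
    · have h1 : ∀ x ∈ Finset.HasAntidiagonal.antidiagonal n, ((p x.1 * q x.2 : ℕ) : ℝ) ≤
          p x.1 * (B * ((n : ℝ) + 1) ^ e) := fun x hx => by
        rw [Finset.HasAntidiagonal.mem_antidiagonal] at hx
        rw [Nat.cast_mul]
        refine mul_le_mul_of_nonneg_left ((hB x.2).trans ?_) (Nat.cast_nonneg _)
        refine mul_le_mul_of_nonneg_left (pow_le_pow_left₀ (by positivity) ?_ e) hB0
        have : (x.2 : ℝ) ≤ n := by exact_mod_cast (by omega : x.2 ≤ n)
        linarith
      rw [convolution, Nat.cast_sum]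
      refine (Finset.sum_le_sum h1).trans ?_
      rw [← Finset.sum_mul, mul_assoc]
      refine mul_le_mul_of_nonneg_right ?_ (by positivity)
      rw [Finset.Nat.sum_antidiagonal_eq_sum_range_succ_mk]
      rcases le_total N (n + 1) with h | h
      · refine (Finset.sum_subset (Finset.range_mono h) fun i _ hi => ?_).ge
        rw [hN i (by simpa using hi), Nat.cast_zero]
      · exact Finset.sum_le_sum_of_subset_of_nonneg (Finset.range_mono h)
          fun _ _ _ => Nat.cast_nonneg _
    · obtain ⟨-, β, hβ, h⟩ := hq.hasGrowthRate
      refine ⟨β, hβ, fun N => ?_⟩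
      obtain ⟨n, hn, hle⟩ := h N
      refine ⟨n, hn, hle.trans ?_⟩
      have h1 : q n ≤ convolution p q n :=
        (Nat.le_mul_of_pos_left (q n) hp0).trans (Finset.single_le_sum
          (f := fun x : ℕ × ℕ => p x.1 * q x.2) (fun _ _ => Nat.zero_le _)
          (Finset.HasAntidiagonal.mem_antidiagonal.2 (zero_add n) : (0, n) ∈ Finset.HasAntidiagonal.antidiagonal n))
      exact_mod_cast h1

/-- Above, n + 1 summands are each of order n^(e+f). Below, along n = r + r' + 3 l d d', there are l
+ 1 summands whose two indices both lie on the given progressions and at distance of order l from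
their starts. -/
theorem HasGrowth.convolution_succ {p q : ℕ → ℕ} {e f : ℕ} (hp : HasGrowth p (e + 1))
    (hq : HasGrowth q (f + 1)) : HasGrowthRate (convolution p q) (e + f + 1 + 1) := by
  obtain ⟨⟨B, hB⟩, r, d, β, M, hd, hβ, hM⟩ := hp
  obtain ⟨⟨B', hB'⟩, r', d', β', M', hd', hβ', hM'⟩ := hq
  constructor
  · refine ⟨B * B', fun n => ?_⟩
    have h1 : ∀ x ∈ Finset.HasAntidiagonal.antidiagonal n, ((p x.1 * q x.2 : ℕ) : ℝ) ≤
        B * ((n : ℝ) + 1) ^ e * (B' * ((n : ℝ) + 1) ^ f) := fun x hx => by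
      rw [Finset.HasAntidiagonal.mem_antidiagonal] at hx
      have hB0 : 0 ≤ B := by
        have h0 := hB 0
        have : (0 : ℝ) ≤ p 0 := Nat.cast_nonneg _
        simp at h0
        linarith
      have hB0' : 0 ≤ B' := by
        have h0 := hB' 0
        have : (0 : ℝ) ≤ q 0 := Nat.cast_nonneg _
        simp at h0
        linarith
      have hx1 : (x.1 : ℝ) ≤ n := by exact_mod_cast (by omega : x.1 ≤ n)
      have hx2 : (x.2 : ℝ) ≤ n := by exact_mod_cast (by omega : x.2 ≤ n)
      rw [Nat.cast_mul]
      refine mul_le_mul ((hB x.1).trans ?_) ((hB' x.2).trans ?_) (Nat.cast_nonneg _) (by positivity)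
      · exact mul_le_mul_of_nonneg_left (pow_le_pow_left₀ (by positivity) (by linarith) e) hB0
      · exact mul_le_mul_of_nonneg_left (pow_le_pow_left₀ (by positivity) (by linarith) f) hB0'
    rw [convolution, Nat.cast_sum]
    refine (Finset.sum_le_sum h1).trans (le_of_eq ?_)
    rw [Finset.sum_const, Finset.Nat.card_antidiagonal, nsmul_eq_mul]
    push_cast
    ring
  · refine ⟨β * β' / ((r : ℝ) + r' + 3 * d * d') ^ (e + f + 1), by positivity, fun N => ?_⟩
    let l := M + M' + N + 1
    have hdd : 0 < d * d' := Nat.mul_pos hd hd'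
    have hl : l ≤ 3 * l * (d * d') := le_trans (by omega) (Nat.le_mul_of_pos_right (3 * l) hdd)
    refine ⟨r + r' + 3 * l * (d * d'), by omega, ?_⟩
    have hl1 : (1 : ℝ) ≤ l := by exact_mod_cast (by omega : 1 ≤ l)
    have h1 : β * β' / ((r : ℝ) + r' + 3 * d * d') ^ (e + f + 1) *
        ((r + r' + 3 * l * (d * d') : ℕ) : ℝ) ^ (e + f + 1) ≤ β * β' * (l : ℝ) ^ (e + f + 1) := by
      rw [div_mul_eq_mul_div, div_le_iff₀ (by positivity), mul_assoc (β * β'), ← mul_pow]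
      refine mul_le_mul_of_nonneg_left (pow_le_pow_left₀ (by positivity) ?_ _) (by positivity)
      push_cast
      have h2 : (0 : ℝ) ≤ r + r' := by positivity
      nlinarith
    refine h1.trans ?_
    -- Splitting 3 l as (l + i) + (2 l - i) with 0 ≤ i ≤ l keeps both parts at least l, and the
    -- factor d d' makes each index admissible for its progression.
    let g : ℕ → ℕ × ℕ := fun i => (r + (l + i) * d' * d, r' + (2 * l - i) * d * d')
    have hg : ∀ i ∈ Finset.range (l + 1), g i ∈
        Finset.HasAntidiagonal.antidiagonal (r + r' + 3 * l * (d * d')) := fun i hi => by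
      rw [Finset.HasAntidiagonal.mem_antidiagonal]
      have hi' : i ≤ l := by simpa [Nat.lt_succ_iff] using hi
      have : (l + i) + (2 * l - i) = 3 * l := by omega
      change r + (l + i) * d' * d + (r' + (2 * l - i) * d * d') = _
      rw [← this]
      ring
    have hginj : Set.InjOn g (Finset.range (l + 1)) := fun i _ j _ hij => by
      have h2 : (l + i) * d' * d = (l + j) * d' * d := Nat.add_left_cancel (congrArg Prod.fst hij)
      have := Nat.eq_of_mul_eq_mul_right hd' (Nat.eq_of_mul_eq_mul_right hd h2)
      omega
    have h3 : ∑ i ∈ Finset.range (l + 1), p (g i).1 * q (g i).2 ≤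
        convolution p q (r + r' + 3 * l * (d * d')) := by
      rw [← Finset.sum_image (f := fun x : ℕ × ℕ => p x.1 * q x.2) hginj]
      exact Finset.sum_le_sum_of_subset (Finset.image_subset_iff.2 hg)
    have h4 : ∀ i ∈ Finset.range (l + 1), β * β' * (l : ℝ) ^ (e + f) ≤
        ((p (g i).1 * q (g i).2 : ℕ) : ℝ) := fun i hi => by
      have hi' : i ≤ l := by simpa [Nat.lt_succ_iff] using hi
      have e1 : l ≤ (l + i) * d' := le_trans (by omega) (Nat.le_mul_of_pos_right (l + i) hd')
      have e2 : l ≤ (2 * l - i) * d :=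
        le_trans (by omega) (Nat.le_mul_of_pos_right (2 * l - i) hd)
      have p1 : β * (l : ℝ) ^ e ≤ p (g i).1 := by
        refine le_trans ?_ (hM ((l + i) * d') (by omega))
        refine mul_le_mul_of_nonneg_left (pow_le_pow_left₀ (by positivity) ?_ e) hβ.le
        exact_mod_cast e1
      have p2 : β' * (l : ℝ) ^ f ≤ q (g i).2 := by
        refine le_trans ?_ (hM' ((2 * l - i) * d) (by omega))
        refine mul_le_mul_of_nonneg_left (pow_le_pow_left₀ (by positivity) ?_ f) hβ'.le
        exact_mod_cast e2
      calc β * β' * (l : ℝ) ^ (e + f) = β * (l : ℝ) ^ e * (β' * (l : ℝ) ^ f) := by ring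
        _ ≤ p (g i).1 * q (g i).2 := mul_le_mul p1 p2 (by positivity) (Nat.cast_nonneg _)
        _ = _ := by push_cast; rfl
    have h5 := Finset.sum_le_sum h4
    rw [Finset.sum_const, Finset.card_range, nsmul_eq_mul, ← Nat.cast_sum] at h5
    refine le_trans ?_ (h5.trans (by exact_mod_cast h3))
    rw [pow_succ]
    push_cast
    have : 0 ≤ β * β' * (l : ℝ) ^ (e + f) := by positivity
    nlinarith

theorem growthRate_convolution {p q : ℕ → ℕ} {c c' : ℕ} (hp : HasGrowth p c)
    (hq : HasGrowth q c') (hp0 : 0 < p 0) (hq0 : 0 < q 0) :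
    growthRate (convolution p q) = growthRate p + growthRate q := by
  rw [hp.hasGrowthRate.growthRate_eq, hq.hasGrowthRate.growthRate_eq]
  cases c with
  | zero => rw [(hp.convolution_zero hq hp0).growthRate_eq, Nat.cast_zero, zero_add]
  | succ e =>
    cases c' with
    | zero =>
      rw [convolution_comm, (hq.convolution_zero hp hq0).growthRate_eq, Nat.cast_zero, add_zero]
    | succ f =>
      rw [(hp.convolution_succ hq).growthRate_eq, ← Nat.cast_add]
      congr 1
      omega

end Growth

end HochschildTheory
end

noncomputable section

namespace HochschildTheory

/-! ### The Hilbert–Serre theorem -/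

section HilbertSerre

theorem finrank_map_add_finrank_ker_inf {k V W : Type*} [Field k] [AddCommGroup V] [Module k V]
    [AddCommGroup W] [Module k W] [FiniteDimensional k V] (T : V →ₗ[k] W) (U : Submodule k V) :
    Module.finrank k (U.map T) + Module.finrank k (LinearMap.ker T ⊓ U : Submodule k V) =
      Module.finrank k U := by
  rw [← LinearMap.finrank_range_add_finrank_ker (T.domRestrict U), LinearMap.range_domRestrict,
    LinearMap.ker_domRestrict]
  congr 1
  rw [← Submodule.finrank_map_subtype_eq]
  change _ = Module.finrank k (((LinearMap.ker T).comap U.subtype).map U.subtype)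
  rw [Submodule.map_comap_subtype, inf_comm]

/-- U and U' + T(U) have the same image in W / U'; rank-nullity is applied to both maps. -/
theorem finrank_sup_map_add_finrank_inf_comap {k V W : Type*} [Field k] [AddCommGroup V]
    [Module k V] [AddCommGroup W] [Module k W] [FiniteDimensional k V] [FiniteDimensional k W]
    (T : V →ₗ[k] W) (U : Submodule k V) (U' : Submodule k W) :
    Module.finrank k (U' ⊔ U.map T : Submodule k W) +
      Module.finrank k (U ⊓ U'.comap T : Submodule k V) =
      Module.finrank k U' + Module.finrank k U := by
  have h1 := finrank_map_add_finrank_ker_inf (U'.mkQ.comp T) U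
  have h2 := finrank_map_add_finrank_ker_inf U'.mkQ (U' ⊔ U.map T)
  rw [Submodule.ker_mkQ, inf_eq_left.2 le_sup_left, Submodule.map_sup, Submodule.mkQ_map_self,
    bot_sup_eq] at h2
  rw [LinearMap.ker_comp, Submodule.ker_mkQ, Submodule.map_comp, inf_comm] at h1
  omega

variable {k : Type*} [Field k] {E : ℕ → Type*} [∀ n, AddCommGroup (E n)] [∀ n, Module k (E n)]
  {H : Type*} [CommRing H] [Algebra k H] [Module H (⨁ n, E n)] [IsScalarTower k H (⨁ n, E n)]

/-- A submodule of a direct sum is homogeneous if it contains the components of its elements. -/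
def IsHomogeneousSubmodule (W : Submodule H (⨁ n, E n)) : Prop :=
  ∀ w ∈ W, ∀ n, DirectSum.of E n (w n) ∈ W

variable (k) in
/-- The degree `n` part of a submodule. -/
def degreePart (W : Submodule H (⨁ n, E n)) (n : ℕ) : Submodule k (E n) :=
  (W.restrictScalars k).comap (DirectSum.lof k ℕ E n)

theorem mem_degreePart {W : Submodule H (⨁ n, E n)} {n : ℕ} {y : E n} :
    y ∈ degreePart k W n ↔ DirectSum.of E n y ∈ W := Iff.rfl

/-- A ring element that raises degrees by `d`. -/
def RaisesDegree (E : ℕ → Type*) [∀ n, AddCommGroup (E n)] [Module H (⨁ n, E n)]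
    (h : H) (d : ℕ) : Prop :=
  ∀ n (y : E n), ∃ z : E (n + d), h • DirectSum.of E n y = DirectSum.of E (n + d) z

omit [Algebra k H] in
theorem RaisesDegree.smul_of {h : H} {d : ℕ} (hd : RaisesDegree E h d) (w : ⨁ n, E n) (n : ℕ) :
    h • DirectSum.of E n (w n) = DirectSum.of E (n + d) ((h • w) (n + d)) := by
  induction w using DirectSum.induction_on with
  | zero => simp
  | of i y =>
    obtain ⟨z, hz⟩ := hd i y
    rw [hz]
    by_cases hi : i = n
    · subst hi
      rw [DirectSum.of_eq_same, DirectSum.of_eq_same, hz]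
    · rw [DirectSum.of_eq_of_ne _ _ _ (Ne.symm hi), DirectSum.of_eq_of_ne _ _ _ (by omega)]
      simp
  | add x y hx hy => simp only [DirectSum.add_apply, map_add, smul_add, hx, hy]

theorem RaisesDegree.smul_apply_of_lt {h : H} {d : ℕ} (hd : RaisesDegree E h d) (w : ⨁ n, E n)
    {n : ℕ} (hn : n < d) : (h • w) n = 0 := by
  induction w using DirectSum.induction_on with
  | zero => simp
  | of i y =>
    obtain ⟨z, hz⟩ := hd i y
    rw [hz, DirectSum.of_eq_of_ne _ _ _ (by omega)]
  | add x y hx hy => rw [smul_add, DirectSum.add_apply, hx, hy, add_zero]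

variable [∀ n, FiniteDimensional k (E n)]

/-- For W' ≤ W stable under x, multiplication by x on W / W' has kernel (W ∩ x⁻¹W') / W' and
cokernel W / (W' + x W). With f(n) = dim (W / W')ₙ the identity then says that f(n + d) - f(n) is
the cokernel dimension in degree n + d minus the kernel dimension in degree n. -/
theorem finrank_degreePart_difference {W W' : Submodule H (⨁ n, E n)} {x : H} {d : ℕ}
    (hx : RaisesDegree E x d) (hW : IsHomogeneousSubmodule W) (hW' : IsHomogeneousSubmodule W')
    (n : ℕ) :
    Module.finrank k (degreePart k (W' ⊔ W.map (LinearMap.lsmul H _ x)) (n + d)) +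
      Module.finrank k (degreePart k (W ⊓ W'.comap (LinearMap.lsmul H _ x)) n) =
    Module.finrank k (degreePart k W' (n + d)) + Module.finrank k (degreePart k W n) := by
  let T : E n →ₗ[k] E (n + d) :=
    { toFun := fun y => (x • DirectSum.lof k ℕ E n y) (n + d)
      map_add' := fun y z => by rw [map_add, smul_add, DirectSum.add_apply]
      map_smul' := fun c y => by
        rw [map_smul, smul_algebra_smul_comm, DirectSum.smul_apply, RingHom.id_apply] }
  have hT : ∀ y, x • DirectSum.of E n y = DirectSum.of E (n + d) (T y) := fun y => by
    have := hx.smul_of (DirectSum.of E n y) n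
    rwa [DirectSum.of_eq_same] at this
  have h1 : degreePart k (W' ⊔ W.map (LinearMap.lsmul H _ x)) (n + d) =
      degreePart k W' (n + d) ⊔ (degreePart k W n).map T := by
    refine le_antisymm (fun y hy => ?_) (sup_le (fun y hy => ?_) ?_)
    · obtain ⟨a, ha, b, ⟨w, hw, rfl⟩, hab⟩ := Submodule.mem_sup.1 (mem_degreePart.1 hy)
      have h2 : y = a (n + d) + (x • w) (n + d) := by
        have := congrArg (fun v : ⨁ n, E n => v (n + d)) hab
        simpa [DirectSum.of_eq_same] using this.symm
      rw [h2]
      refine Submodule.add_mem_sup (hW' a ha _) ⟨w n, hW w hw n, ?_⟩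
      change (x • DirectSum.of E n (w n)) (n + d) = _
      rw [hx.smul_of, DirectSum.of_eq_same]
    · exact Submodule.mem_sup_left (S := W') (mem_degreePart.1 hy)
    · rintro _ ⟨y, hy, rfl⟩
      refine Submodule.mem_sup_right (S := W') (T := W.map (LinearMap.lsmul H _ x)) ?_
      exact ⟨DirectSum.of E n y, hy, hT y⟩
  have h2 : degreePart k (W ⊓ W'.comap (LinearMap.lsmul H _ x)) n =
      degreePart k W n ⊓ (degreePart k W' (n + d)).comap T := by
    ext y
    change _ ∧ x • DirectSum.of E n y ∈ W' ↔ _ ∧ DirectSum.of E (n + d) (T y) ∈ W'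
    rw [hT]
    rfl
  rw [h1, h2]
  exact finrank_sup_map_add_finrank_inf_comap T _ _

omit [∀ n, FiniteDimensional k (E n)] in
-- The generators of positive degree kill W modulo W', so only those of degree 0 act on the
-- quotient. As W is finitely generated, the quotient lives in boundedly many degrees.
theorem exists_degreePart_le [IsNoetherian H (⨁ n, E n)] {G : Set H}
    (hG : Algebra.adjoin k G = ⊤) {deg : H → ℕ} (hdeg : ∀ g ∈ G, RaisesDegree E g (deg g))
    {W W' : Submodule H (⨁ n, E n)} (hW' : IsHomogeneousSubmodule W')
    (h : ∀ g ∈ G, deg g = 0 ∨ ∀ w ∈ W, g • w ∈ W') :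
    ∃ N, ∀ n ≥ N, degreePart k W n ≤ degreePart k W' n := by
  obtain ⟨S, hS⟩ := (IsNoetherian.noetherian W : W.FG)
  have hbound : ∃ N, ∀ s ∈ S, ∀ n ≥ N, s n = 0 := by
    classical
    refine ⟨(S.sup fun s => s.support.sup id) + 1, fun s hs n hn => ?_⟩
    by_contra hne
    have h1 : n ≤ s.support.sup id :=
      Finset.le_sup (f := id) (DFinsupp.mem_support_iff.2 hne)
    have h2 : s.support.sup id ≤ S.sup fun s => s.support.sup id :=
      Finset.le_sup (f := fun s : ⨁ n, E n => s.support.sup id) hs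
    omega
  obtain ⟨N, hN⟩ := hbound
  -- A property that holds for the generators of W, beyond their top degree N, and is stable under
  -- the action of H.
  let p : (⨁ n, E n) → Prop := fun u => u ∈ W ∧ ∀ n ≥ N, DirectSum.of E n (u n) ∈ W'
  have hp : ∀ a : H, ∀ u, p u → p (a • u) := fun a => by
    have ha : a ∈ Algebra.adjoin k G := hG ▸ Algebra.mem_top
    induction ha using Algebra.adjoin_induction with
    | mem g hg =>
      intro u hu
      refine ⟨W.smul_mem g hu.1, fun n hn => ?_⟩
      rcases h g hg with h0 | h0
      · have h1 := (hdeg g hg).smul_of u n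
        rw [h0] at h1
        exact h1 ▸ W'.smul_mem g (hu.2 n hn)
      · exact hW' _ (h0 u hu.1) n
    | algebraMap c =>
      intro u hu
      refine ⟨W.smul_mem _ hu.1, fun n hn => ?_⟩
      rw [algebraMap_smul, DirectSum.smul_apply]
      exact (degreePart k W' n).smul_mem c (hu.2 n hn)
    | add a b _ _ ha hb =>
      intro u hu
      rw [add_smul]
      refine ⟨W.add_mem (ha u hu).1 (hb u hu).1, fun n hn => ?_⟩
      rw [DirectSum.add_apply, map_add]
      exact W'.add_mem ((ha u hu).2 n hn) ((hb u hu).2 n hn)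
    | mul a b _ _ ha hb =>
      intro u hu
      rw [mul_smul]
      exact ha _ (hb u hu)
  have hall : ∀ u ∈ W, p u := fun u hu => by
    rw [← hS] at hu
    induction hu using Submodule.span_induction with
    | mem s hs =>
      refine ⟨hS ▸ Submodule.subset_span hs, fun n hn => ?_⟩
      rw [hN s hs n hn, map_zero]
      exact W'.zero_mem
    | zero => exact ⟨W.zero_mem, fun n _ => by
        rw [DirectSum.zero_apply, map_zero]
        exact W'.zero_mem⟩
    | add a b _ _ ha hb =>
      refine ⟨W.add_mem ha.1 hb.1, fun n hn => ?_⟩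
      rw [DirectSum.add_apply, map_add]
      exact W'.add_mem (ha.2 n hn) (hb.2 n hn)
    | smul a u _ hu => exact hp a u hu
  refine ⟨N, fun n hn y hy => mem_degreePart.2 ?_⟩
  have := (hall _ (mem_degreePart.1 hy)).2 n hn
  rwa [DirectSum.of_eq_same] at this

/-- The dimensions of the homogeneous parts of a subquotient of a graded Noetherian module over a
finitely generated graded algebra form a quasi-polynomial sequence. -/
theorem isQuasiPolynomial_finrank_sub [IsNoetherian H (⨁ n, E n)] {G : Set H}
    (hG : Algebra.adjoin k G = ⊤) {deg : H → ℕ} (hdeg : ∀ g ∈ G, RaisesDegree E g (deg g))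
    (s : Finset H) : ∀ {W W' : Submodule H (⨁ n, E n)}, IsHomogeneousSubmodule W →
      IsHomogeneousSubmodule W' → W' ≤ W →
      (∀ g ∈ G, g ∈ s ∨ deg g = 0 ∨ ∀ w ∈ W, g • w ∈ W') →
      IsQuasiPolynomial fun n => (Module.finrank k (degreePart k W n) : ℤ) -
        Module.finrank k (degreePart k W' n) := by
  classical
  -- The set s contains the generators of positive degree that are not yet known to kill W / W'.
  induction s using Finset.induction_on with
  | empty =>
    intro W W' hW hW' hle h
    obtain ⟨N, hN⟩ := exists_degreePart_le (k := k) hG hdeg hW'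
      (fun g hg => (h g hg).resolve_left (Finset.notMem_empty g))
    refine IsQuasiPolynomial.of_eventuallyZero ⟨N, fun n hn => ?_⟩
    exact sub_eq_zero.2 (congrArg (fun U : Submodule k (E n) => (Module.finrank k U : ℤ))
      (le_antisymm (hN n hn) fun y hy => hle hy))
  | insert x s hxs ih =>
    intro W W' hW hW' hle h
    by_cases hx : x ∈ G ∧ deg x ≠ 0
    · have hd := hdeg x hx.1
      have hK : IsHomogeneousSubmodule (W ⊓ W'.comap (LinearMap.lsmul H _ x)) := fun w hw n => by
        refine ⟨hW w hw.1 n, ?_⟩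
        change x • DirectSum.of E n (w n) ∈ W'
        rw [hd.smul_of]
        exact hW' _ hw.2 _
      have hC : IsHomogeneousSubmodule (W' ⊔ W.map (LinearMap.lsmul H _ x)) := fun w hw n => by
        obtain ⟨a, ha, b, ⟨c, hc, rfl⟩, rfl⟩ := Submodule.mem_sup.1 hw
        rw [DirectSum.add_apply, map_add]
        refine Submodule.add_mem_sup (hW' a ha n) ?_
        rw [LinearMap.lsmul_apply]
        rcases Nat.lt_or_ge n (deg x) with hn | hn
        · rw [hd.smul_apply_of_lt c hn, map_zero]
          exact Submodule.zero_mem _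
        · obtain ⟨m, rfl⟩ := Nat.exists_eq_add_of_le' hn
          rw [← hd.smul_of]
          exact ⟨_, hW c hc m, rfl⟩
      have ih1 := ih hW hC (sup_le hle (by
        rintro _ ⟨w, hw, rfl⟩
        exact W.smul_mem x hw)) (fun g hg => by
          rcases h g hg with h1 | h1 | h1
          · rcases Finset.mem_insert.1 h1 with rfl | h2
            · exact Or.inr (Or.inr fun w hw => Submodule.mem_sup_right ⟨w, hw, rfl⟩)
            · exact Or.inl h2
          · exact Or.inr (Or.inl h1)
          · exact Or.inr (Or.inr fun w hw => Submodule.mem_sup_left (h1 w hw)))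
      have ih2 := ih hK hW' (le_inf hle fun w hw => W'.smul_mem x hw) (fun g hg => by
          rcases h g hg with h1 | h1 | h1
          · rcases Finset.mem_insert.1 h1 with rfl | h2
            · exact Or.inr (Or.inr fun w hw => hw.2)
            · exact Or.inl h2
          · exact Or.inr (Or.inl h1)
          · exact Or.inr (Or.inr fun w hw => h1 w hw.1))
      refine IsQuasiPolynomial.of_difference (Nat.pos_of_ne_zero hx.2)
        ((ih1.shift (deg x)).sub ih2) fun n => ?_
      have := finrank_degreePart_difference (k := k) hd hW hW' n
      simp only [Pi.sub_apply]
      omega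
    · refine ih hW hW' hle fun g hg => ?_
      rcases h g hg with h1 | h1
      · rcases Finset.mem_insert.1 h1 with rfl | h2
        · exact Or.inr (Or.inl (by_contra fun h3 => hx ⟨hg, h3⟩))
        · exact Or.inl h2
      · exact Or.inr h1

theorem isQuasiPolynomial_finrank [IsNoetherian H (⨁ n, E n)] {G : Finset H}
    (hG : Algebra.adjoin k (G : Set H) = ⊤) (hdeg : ∀ g ∈ G, ∃ d, RaisesDegree E g d)
    {W : Submodule H (⨁ n, E n)} (hW : IsHomogeneousSubmodule W) :
    IsQuasiPolynomial fun n => (Module.finrank k (degreePart k W n) : ℤ) := by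
  have hdeg' : ∀ g, ∃ d, g ∈ G → RaisesDegree E g d := fun g => by
    by_cases hg : g ∈ G
    · exact (hdeg g hg).imp fun d h _ => h
    · exact ⟨0, fun h => absurd h hg⟩
  choose deg hdeg' using hdeg'
  have h := isQuasiPolynomial_finrank_sub (k := k) hG hdeg' G hW (W' := ⊥)
    (fun w hw n => by
      rw [(Submodule.mem_bot H).1 hw, DirectSum.zero_apply, map_zero]
      exact Submodule.zero_mem _) bot_le fun g hg => Or.inl hg
  have h0 : ∀ n, (Module.finrank k (degreePart k (⊥ : Submodule H (⨁ n, E n)) n) : ℤ) = 0 :=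
      fun n => by
    refine (congrArg (fun U : Submodule k (E n) => (Module.finrank k U : ℤ)) (a₂ := ⊥) ?_).trans
      (by rw [finrank_bot, Nat.cast_zero])
    refine (Submodule.eq_bot_iff _).2 fun y hy => ?_
    exact DirectSum.of_injective n (((Submodule.mem_bot H).1 (mem_degreePart.1 hy)).trans
      (map_zero _).symm)
  simpa only [h0, sub_zero] using h

end HilbertSerre

end HochschildTheory
end

noncomputable section

namespace HochschildTheory

/-! ### Modules over artinian rings -/

section Artinian

variable {A : Type*} [Ring A] [IsArtinianRing A]
variable {M N : Type*} [AddCommGroup M] [Module A M] [AddCommGroup N] [Module A N]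

/-- Nakayama's lemma for the Jacobson radical of an artinian ring and arbitrary modules. -/
theorem eq_top_of_sup_jacobson_smul {U : Submodule A M}
    (h : U ⊔ Ring.jacobson A • (⊤ : Submodule A M) = ⊤) : U = ⊤ := by
  have key : ∀ n : ℕ, U ⊔ Ring.jacobson A ^ n • (⊤ : Submodule A M) = ⊤ := by
    intro n
    induction n with
    | zero => simp [Submodule.pow_zero, Ideal.one_eq_top]
    | succ n ih =>
      -- Multiplying the hypothesis by Jⁿ gives JⁿM = JⁿU + Jⁿ⁺¹M, so each step pushes the remainder
      -- one power deeper; J is nilpotent.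
      refine top_le_iff.1 (ih.symm.le.trans (sup_le le_sup_left ?_))
      calc Ring.jacobson A ^ n • (⊤ : Submodule A M)
          = Ring.jacobson A ^ n • U ⊔ Ring.jacobson A ^ n • Ring.jacobson A • ⊤ := by
            rw [← Submodule.smul_sup, h]
        _ ≤ U ⊔ Ring.jacobson A ^ (n + 1) • ⊤ := by
            rw [Submodule.pow_succ, Submodule.mul_smul]
            exact sup_le_sup_right Submodule.smul_le_right _
  obtain ⟨n, hn⟩ := IsSemiprimaryRing.isNilpotent (R := A)
  have := key n
  rw [hn] at this
  simpa using this

/-- By A-linearity ν maps JⁿM into Jⁿ ν(M), hence into Jⁿ⁺¹M, and J is nilpotent. -/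
theorem isNilpotent_of_range_le_jacobson_smul (ν : Module.End A M)
    (h : LinearMap.range ν ≤ Ring.jacobson A • (⊤ : Submodule A M)) : IsNilpotent ν := by
  have key : ∀ n : ℕ, LinearMap.range (ν ^ n) ≤ Ring.jacobson A ^ n • (⊤ : Submodule A M) := by
    intro n
    induction n with
    | zero => simp [Submodule.pow_zero, Ideal.one_eq_top]
    | succ n ih =>
      calc LinearMap.range (ν ^ (n + 1)) = (LinearMap.range (ν ^ n)).map ν := by
            rw [pow_succ', Module.End.mul_eq_comp, LinearMap.range_comp]
        _ ≤ (Ring.jacobson A ^ n • (⊤ : Submodule A M)).map ν := Submodule.map_mono ih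
        _ = Ring.jacobson A ^ n • LinearMap.range ν := by
            rw [Submodule.map_smul'', Submodule.map_top]
        _ ≤ Ring.jacobson A ^ (n + 1) • ⊤ := by
            rw [Submodule.pow_succ, Submodule.mul_smul]
            exact Submodule.smul_mono le_rfl h
  obtain ⟨n, hn⟩ := IsSemiprimaryRing.isNilpotent (R := A)
  refine ⟨n, LinearMap.range_eq_bot.1 (le_bot_iff.1 ((key n).trans ?_))⟩
  rw [hn]
  simp

/-- An endomorphism that is the identity modulo the radical is bijective. -/
theorem bijective_of_sub_mem_jacobson_smul (f : M →ₗ[A] M)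
    (h : ∀ x, f x - x ∈ Ring.jacobson A • (⊤ : Submodule A M)) : Function.Bijective f := by
  have hν : IsNilpotent (f - 1 : Module.End A M) :=
    isNilpotent_of_range_le_jacobson_smul _ (by rintro _ ⟨x, rfl⟩; exact h x)
  have := hν.isUnit_one_add
  rw [add_sub_cancel] at this
  exact (Module.End.isUnit_iff _).1 this

/-- `M / Jac(A) M` is semisimple. -/
instance isSemisimpleModule_quotient_jacobson_smul :
    IsSemisimpleModule A (M ⧸ Ring.jacobson A • (⊤ : Submodule A M)) := by
  have ht : Module.IsTorsionBySet A (M ⧸ Ring.jacobson A • (⊤ : Submodule A M))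
      (Ring.jacobson A : Set A) := by
    rintro x ⟨a, ha⟩
    obtain ⟨x, rfl⟩ := Submodule.Quotient.mk_surjective _ x
    exact (Submodule.Quotient.mk_eq_zero _).2 (Submodule.smul_mem_smul ha trivial)
  let _ := ht.module
  exact ht.isSemisimpleModule_iff.1 inferInstance

omit [IsArtinianRing A] in
theorem jacobson_smul_eq_zero {a : A} (ha : a ∈ Ring.jacobson A) (x : A ⧸ Ring.jacobson A) :
    a • x = 0 := by
  obtain ⟨x, rfl⟩ := Ideal.Quotient.mk_surjective x
  exact Ideal.Quotient.eq_zero_iff_mem.2 (Ideal.mul_mem_right x _ ha)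

instance isSemisimpleModule_quotient_jacobson : IsSemisimpleModule A (A ⧸ Ring.jacobson A) := by
  have ht : Module.IsTorsionBySet A (A ⧸ Ring.jacobson A) (Ring.jacobson A : Set A) :=
    fun x a => jacobson_smul_eq_zero a.2 x
  let _ := ht.module
  exact ht.isSemisimpleModule_iff.1 (inferInstanceAs (IsSemisimpleModule (A ⧸ _) (A ⧸ _)))

/-- A superfluous submodule is contained in the radical. -/
theorem le_jacobson_smul_of_superfluous (K : Submodule A M)
    (h : ∀ L : Submodule A M, L ⊔ K = ⊤ → L = ⊤) :
    K ≤ Ring.jacobson A • (⊤ : Submodule A M) := by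
  set V := Ring.jacobson A • (⊤ : Submodule A M)
  -- The preimage of a complement C of the image of K in the semisimple quotient, together with K,
  -- is everything. So C is everything and K has zero image.
  obtain ⟨C, hC⟩ := exists_isCompl (K.map V.mkQ)
  have hL : C.comap V.mkQ = ⊤ := by
    refine h _ (top_le_iff.1 fun x _ => ?_)
    have hx : V.mkQ x ∈ K.map V.mkQ ⊔ C := hC.sup_eq_top ▸ trivial
    obtain ⟨_, ⟨y, hy, rfl⟩, c, hc, hyc⟩ := Submodule.mem_sup.1 hx
    refine Submodule.mem_sup.2 ⟨x - y, ?_, y, hy, sub_add_cancel _ _⟩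
    rw [Submodule.mem_comap, map_sub, ← hyc, add_sub_cancel_left]
    exact hc
  intro x hx
  refine (Submodule.Quotient.mk_eq_zero V).1 ((Submodule.disjoint_def.1 hC.disjoint) _
    (Submodule.mem_map_of_mem (f := V.mkQ) hx) ?_)
  exact (hL.symm ▸ trivial : x ∈ C.comap V.mkQ)

end Artinian

/-! ### Comparison of dim M with dim Hom_A(M, A / Jac A) -/

section Counting

variable {k A : Type*} [Field k] [Ring A] [Algebra k A] [FiniteDimensional k A]
variable {M : Type*} [AddCommGroup M] [Module k M] [Module A M] [IsScalarTower k A M]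

/-- The maps to `A / Jac(A)` detect the elements outside of the radical of a module. -/
theorem exists_apply_ne_zero [IsArtinianRing A] {y : M}
    (hy : y ∉ Ring.jacobson A • (⊤ : Submodule A M)) :
    ∃ φ : M →ₗ[A] A ⧸ Ring.jacobson A, φ y ≠ 0 := by
  set V := Ring.jacobson A • (⊤ : Submodule A M)
  -- The class of y generates a cyclic submodule of M / Jac(A) M. By semisimplicity that submodule
  -- is a direct summand and also embeds back into A / Jac(A); the desired map is projection
  -- followed by this embedding.
  let τ : (A ⧸ Ring.jacobson A) →ₗ[A] M ⧸ V :=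
    (Ring.jacobson A).liftQ (LinearMap.toSpanSingleton A _ (V.mkQ y)) fun a ha =>
      (Submodule.Quotient.mk_eq_zero V).2 (Submodule.smul_mem_smul ha trivial)
  obtain ⟨s, hs⟩ := IsSemisimpleModule.lifting_property τ.rangeRestrict
    τ.surjective_rangeRestrict LinearMap.id
  obtain ⟨C, hC⟩ := exists_isCompl (LinearMap.range τ)
  have hmem : V.mkQ y ∈ LinearMap.range τ := ⟨Submodule.Quotient.mk 1, one_smul A (V.mkQ y)⟩
  refine ⟨s ∘ₗ (LinearMap.range τ).projectionOnto C hC ∘ₗ V.mkQ, fun h => hy ?_⟩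
  have h' : s ⟨V.mkQ y, hmem⟩ = 0 := by
    rw [← h]
    exact congrArg s (Submodule.projectionOnto_apply_left hC ⟨_, hmem⟩).symm
  have h'' := LinearMap.congr_fun hs ⟨V.mkQ y, hmem⟩
  rw [LinearMap.comp_apply, h', map_zero] at h''
  exact (Submodule.Quotient.mk_eq_zero V).1 (congrArg Subtype.val h'').symm

theorem finrank_hom_le [FiniteDimensional k M] :
    Module.finrank k (M →ₗ[A] A ⧸ Ring.jacobson A) ≤
      Module.finrank k (A ⧸ Ring.jacobson A) * Module.finrank k M := by
  rw [mul_comm, ← Module.finrank_linearMap k k]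
  exact LinearMap.finrank_le_finrank_of_injective
    (f := LinearMap.restrictScalarsₗ k A M (A ⧸ Ring.jacobson A) k)
    (LinearMap.restrictScalars_injective k)

theorem finite_hom [FiniteDimensional k M] :
    Module.Finite k (M →ₗ[A] A ⧸ Ring.jacobson A) :=
  Module.Finite.of_injective (LinearMap.restrictScalarsₗ k A M (A ⧸ Ring.jacobson A) k)
    (LinearMap.restrictScalars_injective k)

/-- Lifts of a k-basis of the image of `ev` generate M modulo its radical, hence generate M over A
by Nakayama. -/
theorem finrank_le_of_ker_le_jacobson_smul [FiniteDimensional k M] {Y : Type*} [AddCommGroup Y]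
    [Module k Y] [FiniteDimensional k Y] (ev : M →ₗ[k] Y)
    (hker : ∀ y, ev y = 0 → y ∈ Ring.jacobson A • (⊤ : Submodule A M)) :
    Module.finrank k M ≤ Module.finrank k Y * Module.finrank k A := by
  have : IsArtinianRing A := isArtinian_of_tower k inferInstance
  let b := Module.finBasis k (LinearMap.range ev)
  choose c hc using fun i => (b i).2
  have hb : (Submodule.span A (Set.range c)) = ⊤ := by
    refine eq_top_of_sup_jacobson_smul (top_le_iff.1 fun y _ => ?_)
    have hy : ev (y - ∑ i, b.repr ⟨ev y, y, rfl⟩ i • c i) = 0 := by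
      have h1 := congrArg (LinearMap.range ev).subtype (b.sum_repr ⟨ev y, y, rfl⟩)
      rw [map_sum] at h1
      rw [map_sub, map_sum, sub_eq_zero]
      refine h1.symm.trans (Finset.sum_congr rfl fun i _ => ?_)
      rw [map_smul, map_smul, hc]
      rfl
    refine Submodule.mem_sup.2 ⟨_, Submodule.sum_mem _ fun i _ => ?_, _, hker _ hy,
      add_sub_cancel _ _⟩
    rw [← algebraMap_smul A]
    exact Submodule.smul_mem _ _ (Submodule.subset_span ⟨i, rfl⟩)
  have hsurj : Function.Surjective (Fintype.linearCombination A c) := by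
    rw [← LinearMap.range_eq_top, Fintype.range_linearCombination, hb]
  have h1 := LinearMap.finrank_le_finrank_of_surjective
    (f := (Fintype.linearCombination A c).restrictScalars k) hsurj
  rw [Module.finrank_pi_fintype, Finset.sum_const, Finset.card_univ, Fintype.card_fin,
    smul_eq_mul] at h1
  exact h1.trans (Nat.mul_le_mul_right _ (Submodule.finrank_le _))

/-- Applies the previous bound to the evaluation M → Hom_k(Hom_A(M, A/Jac A), A/Jac A), whose kernel
lies in the radical by `exists_apply_ne_zero`. -/
theorem finrank_le_mul_finrank_hom [FiniteDimensional k M] :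
    Module.finrank k M ≤ Module.finrank k A * Module.finrank k (A ⧸ Ring.jacobson A) *
      Module.finrank k (M →ₗ[A] A ⧸ Ring.jacobson A) := by
  have : IsArtinianRing A := isArtinian_of_tower k inferInstance
  have : Module.Finite k (M →ₗ[A] A ⧸ Ring.jacobson A) := finite_hom
  refine (finrank_le_of_ker_le_jacobson_smul (A := A)
    (LinearMap.restrictScalarsₗ k A M (A ⧸ Ring.jacobson A) k).flip fun y hy => ?_).trans
      (le_of_eq ?_)
  · by_contra hne
    obtain ⟨φ, hφ⟩ := exists_apply_ne_zero hne
    exact hφ (LinearMap.congr_fun hy φ)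
  · rw [Module.finrank_linearMap]
    ring

end Counting

/-! ### Existence of projective covers -/

section ProjectiveCover

variable {A : Type u} [Ring A] [IsArtinianRing A]

/-- Finitely generated modules over an artinian ring have projective covers. -/
theorem exists_projectiveCover (M : Type u) [AddCommGroup M] [Module A M] [Module.Finite A M] :
    ∃ (P : ModuleCat.{u} A) (π : P →ₗ[A] M), Module.Finite A P ∧ Module.Projective A P ∧
      Function.Surjective π ∧ LinearMap.ker π ≤ Ring.jacobson A • (⊤ : Submodule A P) := by
  -- The cover is a finitely generated projective module of least length that surjects onto M.
  let S : Set ℕ∞ := {l | ∃ (P : ModuleCat.{u} A) (π : P →ₗ[A] M), Module.Finite A P ∧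
    Module.Projective A P ∧ Function.Surjective π ∧ Module.length A P = l}
  have hS : S.Nonempty := by
    obtain ⟨r, f, hf⟩ := Module.Finite.exists_fin' A M
    exact ⟨_, ModuleCat.of A (Fin r → A), f, inferInstanceAs (Module.Finite A (Fin r → A)),
      inferInstanceAs (Module.Projective A (Fin r → A)), hf, rfl⟩
  obtain ⟨P, π, hfin, hproj, hπ, hl⟩ := csInf_mem hS
  refine ⟨P, π, hfin, hproj, hπ, le_jacobson_smul_of_superfluous _ fun L hL => ?_⟩
  have hπL : Function.Surjective (π.comp L.subtype) := by
    intro m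
    obtain ⟨x, rfl⟩ := hπ m
    obtain ⟨l, hl, z, hz, rfl⟩ := Submodule.mem_sup.1 (hL ▸ trivial : x ∈ L ⊔ LinearMap.ker π)
    exact ⟨⟨l, hl⟩, by simp [LinearMap.mem_ker.1 hz]⟩
  obtain ⟨g, hg⟩ := Module.projective_lifting_property _ π hπL
  -- G has its image in L and satisfies π ∘ G = π. By Fitting's lemma the image of a high power is a
  -- direct summand of P that still surjects onto M, and by minimality of length it is all of P.
  -- Hence L is everything, and the kernel of π is superfluous.
  let G : Module.End A P := L.subtype.comp g
  have hG : ∀ (n : ℕ) (x : P), π ((G ^ n) x) = π x := by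
    intro n
    induction n with
    | zero => intro x; rfl
    | succ n ih =>
      intro x
      rw [pow_succ, Module.End.mul_apply, ih]
      exact LinearMap.congr_fun hg x
  obtain ⟨n, hn⟩ := Filter.eventually_atTop.1 G.eventually_isCompl_ker_pow_range_pow
  have hc := hn (n + 1) (Nat.le_succ n)
  set U := LinearMap.range (G ^ (n + 1))
  have hUproj : Module.Projective A U :=
    Module.Projective.of_split U.subtype (U.projectionOnto _ hc.symm)
      (LinearMap.ext fun x => Submodule.projectionOnto_apply_left hc.symm x)
  have hU : U = ⊤ := by
    by_contra hne
    refine (Submodule.length_lt hne).not_ge (hl.le.trans (csInf_le' ?_))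
    refine ⟨ModuleCat.of A U, π.comp U.subtype, inferInstanceAs (Module.Finite A U), hUproj, ?_, rfl⟩
    intro m
    obtain ⟨x, rfl⟩ := hπ m
    exact ⟨⟨_, x, rfl⟩, hG (n + 1) x⟩
  refine top_le_iff.1 (hU.symm.le.trans ?_)
  rintro _ ⟨x, rfl⟩
  rw [pow_succ', Module.End.mul_apply]
  exact (g _).2

end ProjectiveCover

/-! ### Minimal projective resolutions -/

section MinimalResolution

open CategoryTheory

variable {A : Type u} [Ring A] [IsArtinianRing A] {M : ModuleCat.{u} A}

omit [IsArtinianRing A] in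
theorem isMinimal_mkResolution (X : ℕ → ModuleCat.{u} A) (d : ∀ n, X (n + 1) ⟶ X n) (π : X 0 ⟶ M)
    (hX : ∀ n, Module.Projective A (X n)) (hπ : Function.Surjective π.hom)
    (h0 : Function.Exact (d 0).hom π.hom) (hd : ∀ n, Function.Exact (d (n + 1)).hom (d n).hom)
    (h : ∀ n, LinearMap.range (d n).hom ≤ Ring.jacobson A • (⊤ : Submodule A (X n))) :
    IsMinimal (mkResolution X d π hX hπ h0 hd) := by
  intro n
  rw [mkResolution_d]
  exact h n

omit [IsArtinianRing A] in
-- The composite P → Q → P is homotopic to the identity, and minimality of P places both homotopy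
-- terms, d s and r d, in the radical. So minimal resolutions are termwise isomorphic.
theorem comp_lift_sub_mem_jacobson_smul {P Q : ProjectiveResolution M} (hP : IsMinimal P) (n : ℕ)
    (x : P.complex.X n) :
    ((ProjectiveResolution.lift (𝟙 M) Q P).f n).hom
        (((ProjectiveResolution.lift (𝟙 M) P Q).f n).hom x) - x ∈
      Ring.jacobson A • (⊤ : Submodule A (P.complex.X n)) := by
  obtain ⟨s, t, hst, h0, h1⟩ := exists_homotopy_of_lift
    (ProjectiveResolution.lift (𝟙 M) P Q ≫ ProjectiveResolution.lift (𝟙 M) Q P) (𝟙 P.complex)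
    (Q := P) (by
      ext y
      change (P.π.f 0).hom (((ProjectiveResolution.lift (𝟙 M) Q P).f 0).hom
        (((ProjectiveResolution.lift (𝟙 M) P Q).f 0).hom y)) = (P.π.f 0).hom y
      rw [π_lift_apply, π_lift_apply]
      rfl) n
  have hx : ((ProjectiveResolution.lift (𝟙 M) Q P).f n).hom
      (((ProjectiveResolution.lift (𝟙 M) P Q).f n).hom x) - x =
      (P.complex.d (n + 1) n).hom (s x) + t x := by
    rw [sub_eq_iff_eq_add]
    exact (hst x).trans ((add_assoc _ _ _).trans (add_comm _ _))
  rw [hx]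
  refine add_mem (hP n ⟨_, rfl⟩) ?_
  cases n with
  | zero => rw [h0 rfl]; exact zero_mem _
  | succ n =>
    obtain ⟨r, hr⟩ := h1 n rfl
    rw [hr]
    have : r ((P.complex.d (n + 1) n).hom x) ∈
        (Ring.jacobson A • (⊤ : Submodule A (P.complex.X n))).map r :=
      Submodule.mem_map_of_mem (hP n ⟨x, rfl⟩)
    rw [Submodule.map_smul''] at this
    exact Submodule.smul_mono le_rfl le_top this

theorem nonempty_linearEquiv_of_isMinimal {P Q : ProjectiveResolution M} (hP : IsMinimal P)
    (hQ : IsMinimal Q) (n : ℕ) : Nonempty (P.complex.X n ≃ₗ[A] Q.complex.X n) := by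
  have h₁ := bijective_of_sub_mem_jacobson_smul
    (((ProjectiveResolution.lift (𝟙 M) Q P).f n).hom ∘ₗ
      ((ProjectiveResolution.lift (𝟙 M) P Q).f n).hom) (comp_lift_sub_mem_jacobson_smul hP n)
  have h₂ := bijective_of_sub_mem_jacobson_smul
    (((ProjectiveResolution.lift (𝟙 M) P Q).f n).hom ∘ₗ
      ((ProjectiveResolution.lift (𝟙 M) Q P).f n).hom) (comp_lift_sub_mem_jacobson_smul hQ n)
  exact ⟨LinearEquiv.ofBijective ((ProjectiveResolution.lift (𝟙 M) P Q).f n).hom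
    ⟨.of_comp h₁.1, .of_comp h₂.2⟩⟩

open scoped ModuleCat.Algebra in
theorem complexity_eq_growthRate (k : Type u) [Field k] [Algebra k A] {P : ProjectiveResolution M}
    (hP : IsMinimal P) :
    complexity k M = growthRate fun n => Module.finrank k (P.complex.X n) := by
  refine le_antisymm (iInf₂_le P hP) (le_iInf₂ fun Q hQ => le_of_eq ?_)
  congr 1
  funext n
  obtain ⟨e⟩ := nonempty_linearEquiv_of_isMinimal hP hQ n
  exact (e.restrictScalars k).finrank_eq

/-- The finitely generated modules over `A`. -/
abbrev FGModule (A : Type u) [Ring A] := {M : ModuleCat.{u} A // Module.Finite A M}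

/-- A projective cover. -/
def projectiveCover (M : FGModule A) : ModuleCat.{u} A :=
  haveI := M.2
  (exists_projectiveCover M.1).choose

def projectiveCoverπ (M : FGModule A) : projectiveCover M →ₗ[A] M.1 :=
  haveI := M.2
  (exists_projectiveCover M.1).choose_spec.choose

theorem projectiveCover_spec (M : FGModule A) :
    Module.Finite A (projectiveCover M) ∧ Module.Projective A (projectiveCover M) ∧
      Function.Surjective (projectiveCoverπ M) ∧ LinearMap.ker (projectiveCoverπ M) ≤
        Ring.jacobson A • (⊤ : Submodule A (projectiveCover M)) :=
  haveI := M.2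
  (exists_projectiveCover M.1).choose_spec.choose_spec

/-- The syzygies of a finitely generated module. -/
def syzygy (M : FGModule A) : ℕ → FGModule A
  | 0 => M
  | n + 1 => ⟨ModuleCat.of A (LinearMap.ker (projectiveCoverπ (syzygy M n))), by
      have := (projectiveCover_spec (syzygy M n)).1
      exact inferInstanceAs (Module.Finite A (LinearMap.ker (projectiveCoverπ (syzygy M n))))⟩

/-- The differential of the minimal resolution. -/
def syzygyD (M : FGModule A) (n : ℕ) :
    projectiveCover (syzygy M (n + 1)) →ₗ[A] projectiveCover (syzygy M n) :=
  (LinearMap.ker (projectiveCoverπ (syzygy M n))).subtype ∘ₗ projectiveCoverπ (syzygy M (n + 1))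

theorem range_syzygyD (M : FGModule A) (n : ℕ) :
    LinearMap.range (syzygyD M n) = LinearMap.ker (projectiveCoverπ (syzygy M n)) :=
  (LinearMap.range_comp_of_range_eq_top _ (LinearMap.range_eq_top.2
    (projectiveCover_spec (syzygy M (n + 1))).2.2.1)).trans (Submodule.range_subtype _)

theorem ker_syzygyD (M : FGModule A) (n : ℕ) :
    LinearMap.ker (syzygyD M n) = LinearMap.ker (projectiveCoverπ (syzygy M (n + 1))) :=
  LinearMap.ker_comp_of_ker_eq_bot _ (Submodule.ker_subtype _)

/-- Projective covers of successive syzygies are spliced. The image of each differential is the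
kernel of a projective cover, which lies in the radical. -/
theorem exists_isMinimal (M : ModuleCat.{u} A) [h : Module.Finite A M] :
    ∃ P : ProjectiveResolution M, IsMinimal P ∧ ∀ n, Module.Finite A (P.complex.X n) := by
  let F : FGModule A := ⟨M, h⟩
  have hd : ∀ n, Function.Exact (syzygyD F (n + 1)) (syzygyD F n) := fun n =>
    LinearMap.exact_iff.2 ((ker_syzygyD F n).trans (range_syzygyD F (n + 1)).symm)
  have h0 : Function.Exact (syzygyD F 0) (projectiveCoverπ F) :=
    LinearMap.exact_iff.2 (range_syzygyD F 0).symm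
  have hX : ∀ n, Module.Projective A (projectiveCover (syzygy F n)) := fun n =>
    (projectiveCover_spec (syzygy F n)).2.1
  have hJ : ∀ n, LinearMap.range (syzygyD F n) ≤
      Ring.jacobson A • (⊤ : Submodule A (projectiveCover (syzygy F n))) := fun n =>
    (range_syzygyD F n).le.trans (projectiveCover_spec (syzygy F n)).2.2.2
  exact ⟨mkResolution (fun n => projectiveCover (syzygy F n))
    (fun n => ModuleCat.ofHom (syzygyD F n)) (ModuleCat.ofHom (projectiveCoverπ F))
    hX (projectiveCover_spec F).2.2.1 h0 hd, isMinimal_mkResolution _ _ _ _ _ _ _ hJ,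
    fun n => (projectiveCover_spec (syzygy F n)).1⟩

end MinimalResolution

end HochschildTheory
end

noncomputable section

namespace HochschildTheory

/-! ### Outer tensor products of modules -/

section OuterTensor

variable (k : Type*) [Field k] (M N : Type*) [AddCommGroup M] [Module k M] [AddCommGroup N]
  [Module k N]

/-- The tensor product of an `A`-module and an `A'`-module, as an `A ⊗ A'`-module. -/
def OuterTensor : Type _ := M ⊗[k] N

instance : AddCommGroup (OuterTensor k M N) := inferInstanceAs (AddCommGroup (M ⊗[k] N))

instance : Module k (OuterTensor k M N) := inferInstanceAs (Module k (M ⊗[k] N))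

variable {A A' : Type*} [Ring A] [Algebra k A] [Ring A'] [Algebra k A']
  [Module A M] [IsScalarTower k A M] [Module A' N] [IsScalarTower k A' N]

instance : Module (A ⊗[k] A') (OuterTensor k M N) :=
  Module.compHom (M ⊗[k] N) ((Module.endTensorEndAlgHom (R := k) (S := k) (A := k)).comp
    (Algebra.TensorProduct.map (Algebra.lsmul k k M : A →ₐ[k] Module.End k M)
      (Algebra.lsmul k k N : A' →ₐ[k] Module.End k N))).toRingHom

instance : IsScalarTower k (A ⊗[k] A') (OuterTensor k M N) where
  smul_assoc c b x := by
    let ρ := (Module.endTensorEndAlgHom (R := k) (S := k) (A := k)).comp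
      (Algebra.TensorProduct.map (Algebra.lsmul k k M : A →ₐ[k] Module.End k M)
        (Algebra.lsmul k k N : A' →ₐ[k] Module.End k N))
    exact LinearMap.congr_fun (map_smul ρ c b) x

variable {M N}

/-- A pure tensor. -/
def OuterTensor.mk (m : M) (n : N) : OuterTensor k M N := m ⊗ₜ[k] n

variable {k}

theorem OuterTensor.induction {p : OuterTensor k M N → Prop}
    (mk : ∀ m n, p (OuterTensor.mk k m n)) (add : ∀ x y, p x → p y → p (x + y)) (x) : p x :=
  TensorProduct.induction_on x (by simpa [OuterTensor.mk] using mk 0 0) mk add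

/-- A `k`-linear map is `A ⊗ A'`-linear as soon as this holds on pure tensors. -/
theorem OuterTensor.map_smul_of_pure {X : Type*} [AddCommGroup X] [Module (A ⊗[k] A') X]
    (f : OuterTensor k M N →+ X)
    (h : ∀ (a : A) (a' : A') m n, f (OuterTensor.mk k (a • m) (a' • n)) =
      (a ⊗ₜ[k] a') • f (OuterTensor.mk k m n))
    (b : A ⊗[k] A') (x : OuterTensor k M N) : f (b • x) = b • f x := by
  induction b with
  | zero => rw [zero_smul, zero_smul, map_zero]
  | add b c hb hc => rw [add_smul, add_smul, map_add, hb, hc]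
  | tmul a a' =>
    induction x using OuterTensor.induction with
    | mk m n => exact h a a' m n
    | add x y hx hy => rw [smul_add, map_add, hx, hy, map_add, smul_add]

variable {M₂ N₂ : Type*} [AddCommGroup M₂] [Module k M₂] [AddCommGroup N₂] [Module k N₂]

/-- The tensor product of `k`-linear maps. -/
def OuterTensor.mapₖ (f : M →ₗ[k] M₂) (g : N →ₗ[k] N₂) :
    OuterTensor k M N →ₗ[k] OuterTensor k M₂ N₂ := TensorProduct.map f g

@[simp] theorem OuterTensor.mapₖ_mk (f : M →ₗ[k] M₂) (g : N →ₗ[k] N₂) (m : M) (n : N) :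
    OuterTensor.mapₖ f g (OuterTensor.mk k m n) = OuterTensor.mk k (f m) (g n) := rfl

variable [Module A M₂] [IsScalarTower k A M₂] [Module A' N₂] [IsScalarTower k A' N₂]

/-- The tensor product of linear maps. -/
def OuterTensor.map (f : M →ₗ[A] M₂) (g : N →ₗ[A'] N₂) :
    OuterTensor k M N →ₗ[A ⊗[k] A'] OuterTensor k M₂ N₂ where
  toFun := OuterTensor.mapₖ (f.restrictScalars k) (g.restrictScalars k)
  map_add' := map_add _
  map_smul' := OuterTensor.map_smul_of_pure
    (OuterTensor.mapₖ (f.restrictScalars k) (g.restrictScalars k)).toAddMonoidHom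
    fun a a' m n => by
      change OuterTensor.mk k (f (a • m)) (g (a' • n)) = _
      rw [map_smul, map_smul]
      rfl

theorem OuterTensor.map_comp_eq_id (f : M →ₗ[A] M₂) (g : N →ₗ[A'] N₂) (f' : M₂ →ₗ[A] M)
    (g' : N₂ →ₗ[A'] N) (hf : f'.comp f = LinearMap.id) (hg : g'.comp g = LinearMap.id) :
    (OuterTensor.map (k := k) f' g').comp (OuterTensor.map f g) = LinearMap.id := by
  ext x
  induction x using OuterTensor.induction with
  | mk m n =>
    exact congrArg₂ (OuterTensor.mk k) (LinearMap.congr_fun hf m) (LinearMap.congr_fun hg n)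
  | add x y hx hy => rw [map_add, map_add, hx, hy]

/-- The outer tensor product of free modules is free. -/
def OuterTensor.finsuppEquiv (ι κ : Type*) :
    OuterTensor k (ι →₀ A) (κ →₀ A') ≃ₗ[A ⊗[k] A'] (ι × κ →₀ A ⊗[k] A') :=
  { (finsuppTensorFinsupp k k A A' ι κ :
      OuterTensor k (ι →₀ A) (κ →₀ A') ≃ₗ[k] (ι × κ →₀ A ⊗[k] A')) with
    map_smul' := OuterTensor.map_smul_of_pure
      (finsuppTensorFinsupp k k A A' ι κ).toLinearMap.toAddMonoidHom fun a a' f g => by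
        ext1 ⟨i, j⟩
        exact (finsuppTensorFinsupp_apply k k A A' ι κ (a • f) (a' • g) i j).trans
          ((congrArg (fun y => (a ⊗ₜ[k] a') * y)
            (finsuppTensorFinsupp_apply k k A A' ι κ f g i j)).trans
              (Algebra.TensorProduct.tmul_mul_tmul a (f i) a' (g j))).symm }

/-- Both factors are retracts of free modules, and the outer tensor product preserves retractions
and freeness. -/
theorem OuterTensor.projective [Module.Projective A M] [Module.Projective A' N] :
    Module.Projective (A ⊗[k] A') (OuterTensor k M N) := by
  obtain ⟨s, hs⟩ := (Module.projective_def' (R := A) (P := M)).1 inferInstance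
  obtain ⟨s', hs'⟩ := (Module.projective_def' (R := A') (P := N)).1 inferInstance
  have := Module.Projective.of_equiv (OuterTensor.finsuppEquiv (k := k) (A := A) (A' := A') M N).symm
  exact Module.Projective.of_split (OuterTensor.map s s') (OuterTensor.map _ _)
    (OuterTensor.map_comp_eq_id s s' _ _ hs hs')

end OuterTensor

end HochschildTheory
end

noncomputable section

set_option linter.unusedSectionVars false

namespace HochschildTheory

/-! ### Contractions of augmented exact complexes -/

section Contraction

variable (k : Type*) {A : Type*} [Field k] [Ring A] [Algebra k A]
  {P : ℕ → Type*} [∀ n, AddCommGroup (P n)] [∀ n, Module k (P n)] [∀ n, Module A (P n)]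
  [∀ n, IsScalarTower k A (P n)]
  {M : Type*} [AddCommGroup M] [Module k M] [Module A M] [IsScalarTower k A M]

/-- A `k`-linear contraction of an augmented complex. -/
structure Contraction (d : ∀ n, P (n + 1) →ₗ[A] P n) (π : P 0 →ₗ[A] M) where
  /-- the homotopy -/
  s : ∀ n, P n →ₗ[k] P (n + 1)
  /-- the homotopy in degree `-1` -/
  η : M →ₗ[k] P 0
  d_s_zero : ∀ x, d 0 (s 0 x) + η (π x) = x
  d_s : ∀ n x, d (n + 1) (s (n + 1) x) + s n (d n x) = x

/-- Over a field every linear map has a generalized inverse g with f g f = f. -/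
theorem exists_section {X Y : Type*} [AddCommGroup X] [Module k X] [AddCommGroup Y] [Module k Y]
    (f : X →ₗ[k] Y) : ∃ g : Y →ₗ[k] X, ∀ x, f (g (f x)) = f x := by
  obtain ⟨s, hs⟩ := f.rangeRestrict.exists_rightInverse_of_surjective
    f.range_rangeRestrict
  obtain ⟨g, hg⟩ := s.exists_extend
  refine ⟨g, fun x => ?_⟩
  have h1 : g (f x) = s ⟨f x, x, rfl⟩ := LinearMap.congr_fun hg ⟨f x, x, rfl⟩
  rw [h1]
  exact congrArg Subtype.val (LinearMap.congr_fun hs ⟨f x, x, rfl⟩)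

/-- Recursive construction of a contraction from sections of the differentials. -/
def contractionMap (d : ∀ n, P (n + 1) →ₗ[A] P n) (u : P 0 →ₗ[k] P 0)
    (g : ∀ n, P n →ₗ[k] P (n + 1)) : ∀ n, P n →ₗ[k] P (n + 1)
  | 0 => g 0 ∘ₗ (LinearMap.id - u)
  | n + 1 => g (n + 1) ∘ₗ
      (LinearMap.id - contractionMap d u g n ∘ₗ (d n).restrictScalars k)

/-- With s = g (1 - s d), one degree at a time: 1 - s d takes values in the cycles, which are
boundaries by exactness, and d g is the identity on boundaries. -/
theorem exists_contraction (d : ∀ n, P (n + 1) →ₗ[A] P n) (π : P 0 →ₗ[A] M)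
    (h0 : Function.Exact (d 0) π)
    (hd : ∀ n, Function.Exact (d (n + 1)) (d n)) : Nonempty (Contraction k d π) := by
  obtain ⟨η, hη⟩ := exists_section k (π.restrictScalars k)
  choose g hg using fun n => exists_section k ((d n).restrictScalars k)
  have hη' : ∀ x, π (η (π x)) = π x := hη
  have hg' : ∀ n y, d n (g n (d n y)) = d n y := fun n y => hg n y
  let s := contractionMap k d (η ∘ₗ π.restrictScalars k) g
  have hs0 : ∀ x, d 0 (s 0 x) + η (π x) = x := by
    intro x
    obtain ⟨y, hy⟩ := (h0 (x - η (π x))).1 (by rw [map_sub, hη', sub_self])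
    have : s 0 x = g 0 (d 0 y) := congrArg (g 0) hy.symm
    rw [this, hg' 0 y, hy, sub_add_cancel]
  have hsn : ∀ n x, d (n + 1) (s (n + 1) x) + s n (d n x) = x := by
    have step : ∀ n x, d n (x - s n (d n x)) = 0 →
        d (n + 1) (s (n + 1) x) + s n (d n x) = x := by
      intro n x hx
      obtain ⟨y, hy⟩ := (hd n _).1 hx
      have : s (n + 1) x = g (n + 1) (d (n + 1) y) := congrArg (g (n + 1)) hy.symm
      rw [this, hg' _ y, hy, sub_add_cancel]
    intro n
    induction n with
    | zero =>
      refine fun x => step 0 x ?_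
      have := hs0 (d 0 x)
      rw [h0.apply_apply_eq_zero, map_zero, add_zero] at this
      rw [map_sub, this, sub_self]
    | succ n ih =>
      refine fun x => step _ x ?_
      have := ih (d (n + 1) x)
      rw [(hd n).apply_apply_eq_zero, map_zero, add_zero] at this
      rw [map_sub, this, sub_self]
  exact ⟨⟨s, η, hs0, hsn⟩⟩

end Contraction

/-! ### The total complex of two complexes over different algebras -/

section Total

variable {k : Type*} {A A' : Type*} [Field k] [Ring A] [Algebra k A] [Ring A'] [Algebra k A']
  {P P' : ℕ → Type*} [∀ n, AddCommGroup (P n)] [∀ n, Module k (P n)] [∀ n, Module A (P n)]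
  [∀ n, IsScalarTower k A (P n)] [∀ n, AddCommGroup (P' n)] [∀ n, Module k (P' n)]
  [∀ n, Module A' (P' n)] [∀ n, IsScalarTower k A' (P' n)]
  {M M' : Type*} [AddCommGroup M] [Module k M] [Module A M] [IsScalarTower k A M]
  [AddCommGroup M'] [Module k M'] [Module A' M'] [IsScalarTower k A' M']

/-- The differential as a map lowering the degree by `1`, in all degrees. -/
def lower (d : ∀ n, P (n + 1) →ₗ[A] P n) : ∀ n, P n →ₗ[A] P (n - 1)
  | 0 => 0
  | n + 1 => d n

/-- The augmentation in all degrees. -/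
def augment (π : P 0 →ₗ[A] M) : ∀ n, P n →ₗ[A] M
  | 0 => π
  | _ + 1 => 0

/-- The difference of the identity and the boundary of the contraction. -/
def coaugment {d : ∀ n, P (n + 1) →ₗ[A] P n} {π : P 0 →ₗ[A] M} (C : Contraction k d π) :
    ∀ n, P n →ₗ[k] P n
  | 0 => C.η ∘ₗ π.restrictScalars k
  | _ + 1 => 0

variable (k P P') in
/-- The modules `P i ⊗ P' j`. -/
abbrev Bigraded (x : ℕ × ℕ) := OuterTensor k (P x.1) (P' x.2)

variable (k P P') in
/-- The sum of all `P i ⊗ P' j`. -/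
abbrev TotalSpace := ⨁ x : ℕ × ℕ, Bigraded k P P' x

variable (k P P') in
/-- The terms of the total complex. -/
abbrev TotalTerm (n : ℕ) := ⨁ x : {x : ℕ × ℕ // x.1 + x.2 = n}, Bigraded k P P' x.1

variable (k P P' A A') in
/-- The inclusion of a summand. -/
def totalLof (i j : ℕ) : OuterTensor k (P i) (P' j) →ₗ[A ⊗[k] A'] TotalSpace k P P' :=
  DirectSum.lof (A ⊗[k] A') _ (Bigraded k P P') (i, j)

variable (k P P') in
/-- The inclusion of a summand as a `k`-linear map. -/
def totalLofₖ (i j : ℕ) : OuterTensor k (P i) (P' j) →ₗ[k] TotalSpace k P P' :=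
  DirectSum.lof k _ (Bigraded k P P') (i, j)

variable (k) in
/-- A pure tensor in the total space. -/
def totalMk (i j : ℕ) : P i →ₗ[k] P' j →ₗ[k] TotalSpace k P P' :=
  (TensorProduct.mk k (P i) (P' j)).compr₂ (totalLofₖ k P P' i j)

theorem totalMk_apply (i j : ℕ) (p : P i) (q : P' j) :
    totalMk k i j p q = totalLofₖ k P P' i j (OuterTensor.mk k p q) := rfl

theorem total_hom_ext {X : Type*} [AddCommGroup X] {f g : TotalSpace k P P' →+ X}
    (h : ∀ i j p q, f (totalMk k i j p q) = g (totalMk k i j p q)) : f = g := by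
  refine DirectSum.addHom_ext fun x y => ?_
  induction y using OuterTensor.induction with
  | mk p q => exact h x.1 x.2 p q
  | add y z hy hz => rw [map_add, map_add, map_add, hy, hz]

/-- A linear map on the total space given by its components. -/
def totalLift {X : Type*} [AddCommGroup X] [Module (A ⊗[k] A') X]
    (f : ∀ i j, OuterTensor k (P i) (P' j) →ₗ[A ⊗[k] A'] X) :
    TotalSpace k P P' →ₗ[A ⊗[k] A'] X :=
  DirectSum.toModule (A ⊗[k] A') (ℕ × ℕ) X fun x => f x.1 x.2

theorem totalLift_lof {X : Type*} [AddCommGroup X] [Module (A ⊗[k] A') X]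
    (f : ∀ i j, OuterTensor k (P i) (P' j) →ₗ[A ⊗[k] A'] X) (i j : ℕ)
    (y : OuterTensor k (P i) (P' j)) :
    totalLift f (totalLofₖ k P P' i j y) = f i j y :=
  DirectSum.toModule_lof (φ := fun x : ℕ × ℕ => f x.1 x.2) (A ⊗[k] A') (i, j) y

theorem totalLift_mk {X : Type*} [AddCommGroup X] [Module (A ⊗[k] A') X]
    (f : ∀ i j, OuterTensor k (P i) (P' j) →ₗ[A ⊗[k] A'] X) (i j : ℕ) (p : P i) (q : P' j) :
    totalLift f (totalMk k i j p q) = f i j (OuterTensor.mk k p q) :=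
  totalLift_lof f i j _

/-- The total differential. -/
def totalD (d : ∀ n, P (n + 1) →ₗ[A] P n) (d' : ∀ n, P' (n + 1) →ₗ[A'] P' n) :
    TotalSpace k P P' →ₗ[A ⊗[k] A'] TotalSpace k P P' :=
  totalLift fun i j => totalLof k A A' P P' (i - 1) j ∘ₗ OuterTensor.map (lower d i) LinearMap.id +
    (-1 : ℤ) ^ i • totalLof k A A' P P' i (j - 1) ∘ₗ OuterTensor.map LinearMap.id (lower d' j)

theorem totalD_mk (d : ∀ n, P (n + 1) →ₗ[A] P n) (d' : ∀ n, P' (n + 1) →ₗ[A'] P' n) (i j : ℕ)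
    (p : P i) (q : P' j) : totalD d d' (totalMk k i j p q) =
      totalMk k (i - 1) j (lower d i p) q +
        (-1 : ℤ) ^ i • totalMk k i (j - 1) p (lower d' j q) := by
  rw [totalD, totalLift_mk, LinearMap.add_apply, LinearMap.smul_apply]
  rfl

/-- The total contraction. -/
def totalH {d : ∀ n, P (n + 1) →ₗ[A] P n} {d' : ∀ n, P' (n + 1) →ₗ[A'] P' n}
    {π : P 0 →ₗ[A] M} {π' : P' 0 →ₗ[A'] M'} (C : Contraction k d π) (C' : Contraction k d' π') :
    TotalSpace k P P' →ₗ[k] TotalSpace k P P' :=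
  DirectSum.toModule k (ℕ × ℕ) (TotalSpace k P P') fun x =>
    totalLofₖ k P P' (x.1 + 1) x.2 ∘ₗ OuterTensor.mapₖ (C.s x.1) LinearMap.id +
      totalLofₖ k P P' x.1 (x.2 + 1) ∘ₗ OuterTensor.mapₖ (coaugment C x.1) (C'.s x.2)

theorem totalH_mk {d : ∀ n, P (n + 1) →ₗ[A] P n} {d' : ∀ n, P' (n + 1) →ₗ[A'] P' n}
    {π : P 0 →ₗ[A] M} {π' : P' 0 →ₗ[A'] M'} (C : Contraction k d π) (C' : Contraction k d' π')
    (i j : ℕ) (p : P i) (q : P' j) : totalH C C' (totalMk k i j p q) =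
      totalMk k (i + 1) j (C.s i p) q + totalMk k i (j + 1) (coaugment C i p) (C'.s j q) :=
  DirectSum.toModule_lof (φ := fun x : ℕ × ℕ =>
    totalLofₖ k P P' (x.1 + 1) x.2 ∘ₗ OuterTensor.mapₖ (C.s x.1) LinearMap.id +
      totalLofₖ k P P' x.1 (x.2 + 1) ∘ₗ OuterTensor.mapₖ (coaugment C x.1) (C'.s x.2))
    k (i, j) (OuterTensor.mk k p q)

/-- The total augmentation. -/
def totalπ (π : P 0 →ₗ[A] M) (π' : P' 0 →ₗ[A'] M') :
    TotalSpace k P P' →ₗ[A ⊗[k] A'] OuterTensor k M M' :=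
  totalLift fun i j => OuterTensor.map (augment π i) (augment π' j)

theorem totalπ_mk (π : P 0 →ₗ[A] M) (π' : P' 0 →ₗ[A'] M') (i j : ℕ) (p : P i) (q : P' j) :
    totalπ π π' (totalMk k i j p q) = OuterTensor.mk k (augment π i p) (augment π' j q) :=
  totalLift_mk (fun i j => OuterTensor.map (augment π i) (augment π' j)) i j p q

variable (k P P' A A') in
/-- The inclusion of a summand of a term of the total complex. -/
def termLof {n i j : ℕ} (h : i + j = n) :
    OuterTensor k (P i) (P' j) →ₗ[A ⊗[k] A'] TotalTerm k P P' n :=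
  DirectSum.lof (A ⊗[k] A') _ (fun x : {x : ℕ × ℕ // x.1 + x.2 = n} => Bigraded k P P' x.1)
    ⟨(i, j), h⟩

variable (k P P' A A') in
/-- The inclusion of a term of the total complex. -/
def totalι (n : ℕ) : TotalTerm k P P' n →ₗ[A ⊗[k] A'] TotalSpace k P P' :=
  DirectSum.toModule (A ⊗[k] A') {x : ℕ × ℕ // x.1 + x.2 = n} (TotalSpace k P P') fun x =>
    totalLof k A A' P P' x.1.1 x.1.2

theorem totalι_lof {n i j : ℕ} (h : i + j = n) (y : OuterTensor k (P i) (P' j)) :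
    totalι k A A' P P' n (termLof k A A' P P' h y) = totalLofₖ k P P' i j y :=
  DirectSum.toModule_lof (φ := fun x : {x : ℕ × ℕ // x.1 + x.2 = n} =>
    totalLof k A A' P P' x.1.1 x.1.2) (A ⊗[k] A') ⟨(i, j), h⟩ y

variable (k P P' A A') in
/-- The projection to a term of the total complex. -/
def totalR (n : ℕ) : TotalSpace k P P' →ₗ[A ⊗[k] A'] TotalTerm k P P' n :=
  totalLift fun i j => if h : i + j = n then termLof k A A' P P' h else 0

theorem totalR_lof {n i j : ℕ} (h : i + j = n) (y : OuterTensor k (P i) (P' j)) :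
    totalR k A A' P P' n (totalLofₖ k P P' i j y) = termLof k A A' P P' h y := by
  rw [totalR, totalLift_lof, dif_pos h]

/-- Induction over pure tensors in a term of the total complex. -/
theorem totalTerm_induction {n : ℕ} {p : TotalTerm k P P' n → Prop} (zero : p 0)
    (add : ∀ x y, p x → p y → p (x + y))
    (mk : ∀ i j (h : i + j = n) x y, p (termLof k A A' P P' h (OuterTensor.mk k x y)))
    (y : TotalTerm k P P' n) : p y := by
  induction y using DirectSum.induction_on with
  | zero => exact zero
  | add y z hy hz => exact add _ _ hy hz
  | of x y =>
    obtain ⟨⟨i, j⟩, h⟩ := x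
    have key : ∀ y : OuterTensor k (P i) (P' j), p (termLof k A A' P P' h y) := by
      intro y
      induction y using OuterTensor.induction with
      | mk a b => exact mk i j h a b
      | add y z hy hz => rw [map_add]; exact add _ _ hy hz
    exact key y

/-- Each term of fixed total degree is a retract of the sum of all P i ⊗ P' j. Identities are proved
in that sum, where no transport along i + j = n is needed, and are then restricted. -/
theorem totalR_ι (n : ℕ) (y : TotalTerm k P P' n) :
    totalR k A A' P P' n (totalι k A A' P P' n y) = y := by
  refine totalTerm_induction (k := k) (A := A) (A' := A')
    (p := fun y => totalR k A A' P P' n (totalι k A A' P P' n y) = y) ?_ ?_ ?_ y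
  · rw [map_zero, map_zero]
  · intro y z hy hz
    rw [map_add, map_add, hy, hz]
  · intro i j h p q
    exact (congrArg (totalR k A A' P P' n) (totalι_lof h _)).trans (totalR_lof h _)

theorem totalMk_mem_range {i j n : ℕ} (h : i + j = n) (p : P i) (q : P' j) :
    totalMk k i j p q ∈ LinearMap.range (totalι k A A' P P' n) :=
  ⟨termLof k A A' P P' h (OuterTensor.mk k p q), totalι_lof h _⟩

theorem totalι_R {n : ℕ} {t : TotalSpace k P P'}
    (h : t ∈ LinearMap.range (totalι k A A' P P' n)) :
    totalι k A A' P P' n (totalR k A A' P P' n t) = t := by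
  obtain ⟨y, rfl⟩ := h
  rw [totalR_ι]

theorem totalι_mk {n i j : ℕ} (h : i + j = n) (p : P i) (q : P' j) :
    totalι k A A' P P' n (termLof k A A' P P' h (OuterTensor.mk k p q)) = totalMk k i j p q :=
  totalι_lof h _

variable {d : ∀ n, P (n + 1) →ₗ[A] P n} {d' : ∀ n, P' (n + 1) →ₗ[A'] P' n}
  {π : P 0 →ₗ[A] M} {π' : P' 0 →ₗ[A'] M'}

theorem lower_lower (hd : ∀ n x, d n (d (n + 1) x) = 0) (n : ℕ) (x : P n) :
    lower d (n - 1) (lower d n x) = 0 :=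
  match n, x with
  | 0, _ => map_zero _
  | 1, _ => rfl
  | n + 2, x => hd n x

theorem augment_lower (h0 : ∀ x, π (d 0 x) = 0) (n : ℕ) (x : P n) :
    augment π (n - 1) (lower d n x) = 0 :=
  match n, x with
  | 0, _ => map_zero _
  | 1, x => h0 x
  | _ + 2, _ => rfl

theorem coaugment_lower (C : Contraction k d π) (h0 : ∀ x, π (d 0 x) = 0) (n : ℕ) (x : P n) :
    coaugment C (n - 1) (lower d n x) = 0 :=
  match n, x with
  | 0, _ => map_zero _
  | 1, x => (congrArg C.η (h0 x)).trans (map_zero _)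
  | _ + 2, _ => rfl

theorem lower_coaugment (C : Contraction k d π) (n : ℕ) (x : P n) :
    lower d n (coaugment C n x) = 0 :=
  match n, x with
  | 0, _ => rfl
  | _ + 1, _ => map_zero _

/-- The factor `coaugment` vanishes in positive degrees, so the sign is never felt. -/
theorem neg_one_pow_smul_totalMk_coaugment (C : Contraction k d π) (i j : ℕ) (p : P i) (q : P' j) :
    (-1 : ℤ) ^ i • totalMk k i j (coaugment C i p) q = totalMk k i j (coaugment C i p) q := by
  cases i with
  | zero => rw [pow_zero, one_smul]
  | succ i =>
    have h : coaugment C (i + 1) p = 0 := rfl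
    rw [h, map_zero, LinearMap.zero_apply, smul_zero]

theorem contraction_left (C : Contraction k d π) (i j : ℕ) (p : P i) (q : P' j) :
    totalMk k (i + 1 - 1) j (lower d (i + 1) (C.s i p)) q +
      totalMk k (i - 1 + 1) j (C.s (i - 1) (lower d i p)) q =
        totalMk k i j p q - totalMk k i j (coaugment C i p) q := by
  cases i with
  | zero =>
    have h1 : lower d 0 p = 0 := rfl
    have h2 : d 0 (C.s 0 p) = p - coaugment C 0 p := eq_sub_of_add_eq (C.d_s_zero p)
    rw [h1, map_zero, map_zero, LinearMap.zero_apply, add_zero]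
    change totalMk k 0 j (d 0 (C.s 0 p)) q = _
    rw [h2, map_sub, LinearMap.sub_apply]
  | succ i =>
    have h1 : coaugment C (i + 1) p = 0 := rfl
    rw [h1, map_zero, LinearMap.zero_apply, sub_zero]
    change totalMk k (i + 1) j (d (i + 1) (C.s (i + 1) p)) q +
      totalMk k (i + 1) j (C.s i (d i p)) q = _
    rw [← LinearMap.add_apply, ← map_add, C.d_s]

theorem contraction_right (C : Contraction k d' π') (i j : ℕ) (p : P i) (q : P' j) :
    totalMk k i (j + 1 - 1) p (lower d' (j + 1) (C.s j q)) +
      totalMk k i (j - 1 + 1) p (C.s (j - 1) (lower d' j q)) =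
        totalMk k i j p q - totalMk k i j p (coaugment C j q) := by
  cases j with
  | zero =>
    have h1 : lower d' 0 q = 0 := rfl
    have h2 : d' 0 (C.s 0 q) = q - coaugment C 0 q := eq_sub_of_add_eq (C.d_s_zero q)
    rw [h1, map_zero, map_zero, add_zero]
    change totalMk k i 0 p (d' 0 (C.s 0 q)) = _
    rw [h2, map_sub]
  | succ j =>
    have h1 : coaugment C (j + 1) q = 0 := rfl
    rw [h1, map_zero, sub_zero]
    change totalMk k i (j + 1) p (d' (j + 1) (C.s (j + 1) q)) +
      totalMk k i (j + 1) p (C.s j (d' j q)) = _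
    rw [← map_add, C.d_s]

theorem totalMk_coaugment (C : Contraction k d π) (C' : Contraction k d' π') (i j : ℕ) (p : P i)
    (q : P' j) : totalMk k i j (coaugment C i p) (coaugment C' j q) =
      totalLofₖ k P P' 0 0 (OuterTensor.mapₖ C.η C'.η (totalπ π π' (totalMk k i j p q))) := by
  rw [totalπ_mk, OuterTensor.mapₖ_mk, ← totalMk_apply]
  cases i with
  | zero =>
    cases j with
    | zero => rfl
    | succ j =>
      have h1 : coaugment C' (j + 1) q = 0 := rfl
      have h2 : augment π' (j + 1) q = 0 := rfl
      rw [h1, h2, map_zero, map_zero, map_zero]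
  | succ i =>
    have h1 : coaugment C (i + 1) p = 0 := rfl
    have h2 : augment π (i + 1) p = 0 := rfl
    rw [h1, h2, map_zero, map_zero, map_zero, LinearMap.zero_apply, LinearMap.zero_apply]

/-- The homotopy formula in the total space. -/
theorem totalD_totalH (C : Contraction k d π) (C' : Contraction k d' π')
    (h0 : ∀ x, π (d 0 x) = 0) (t : TotalSpace k P P') :
    totalD d d' (totalH C C' t) + totalH C C' (totalD d d' t) +
      totalLofₖ k P P' 0 0 (OuterTensor.mapₖ C.η C'.η (totalπ π π' t)) = t := by
  refine DFunLike.congr_fun (total_hom_ext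
    (f := (totalD d d').toAddMonoidHom.comp (totalH C C').toAddMonoidHom +
      (totalH C C').toAddMonoidHom.comp (totalD d d').toAddMonoidHom +
      (totalLofₖ k P P' 0 0 ∘ₗ OuterTensor.mapₖ C.η C'.η).toAddMonoidHom.comp
        (totalπ π π').toAddMonoidHom) (g := AddMonoidHom.id _) ?_) t
  intro i j p q
  change totalD d d' (totalH C C' (totalMk k i j p q)) +
    totalH C C' (totalD d d' (totalMk k i j p q)) +
      totalLofₖ k P P' 0 0 (OuterTensor.mapₖ C.η C'.η (totalπ π π' (totalMk k i j p q))) =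
    totalMk k i j p q
  -- Writing c and c' for the coaugmentations, (d s + s d) ⊗ 1 = 1 - c ⊗ 1 and c ⊗ (d' s' + s' d') =
  -- c ⊗ 1 - c ⊗ c'. The sum is 1 - c ⊗ c', and c ⊗ c' factors through the total augmentation.
  have e1 := contraction_left C i j p q
  have e2 := contraction_right C' i j (coaugment C i p) q
  have e3 : totalMk k i j p q =
      (totalMk k (i + 1 - 1) j (lower d (i + 1) (C.s i p)) q +
        totalMk k (i - 1 + 1) j (C.s (i - 1) (lower d i p)) q) +
      (totalMk k i (j + 1 - 1) (coaugment C i p) (lower d' (j + 1) (C'.s j q)) +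
        totalMk k i (j - 1 + 1) (coaugment C i p) (C'.s (j - 1) (lower d' j q))) +
      totalMk k i j (coaugment C i p) (coaugment C' j q) := by
    rw [e1, e2]
    abel
  rw [← totalMk_coaugment, totalD_mk, map_add, map_zsmul, totalH_mk, totalH_mk, totalH_mk, map_add,
    totalD_mk, totalD_mk, lower_coaugment, coaugment_lower C h0, smul_add,
    neg_one_pow_smul_totalMk_coaugment, neg_one_pow_smul_totalMk_coaugment, e3, pow_succ, mul_neg,
    mul_one, neg_smul, (totalMk k (i - 1) (j + 1)).map_zero, LinearMap.zero_apply]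
  abel

end Total

end HochschildTheory
end

/-! ### Exactness, projectivity, dimensions and minimality of the total complex -/

noncomputable section

set_option linter.unusedSectionVars false

namespace HochschildTheory

section Total

variable {k : Type*} {A A' : Type*} [Field k] [Ring A] [Algebra k A] [Ring A'] [Algebra k A']
  {P P' : ℕ → Type*} [∀ n, AddCommGroup (P n)] [∀ n, Module k (P n)] [∀ n, Module A (P n)]
  [∀ n, IsScalarTower k A (P n)] [∀ n, AddCommGroup (P' n)] [∀ n, Module k (P' n)]
  [∀ n, Module A' (P' n)] [∀ n, IsScalarTower k A' (P' n)]
  {M M' : Type*} [AddCommGroup M] [Module k M] [Module A M] [IsScalarTower k A M]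
  [AddCommGroup M'] [Module k M'] [Module A' M'] [IsScalarTower k A' M']
  {d : ∀ n, P (n + 1) →ₗ[A] P n} {d' : ∀ n, P' (n + 1) →ₗ[A'] P' n}
  {π : P 0 →ₗ[A] M} {π' : P' 0 →ₗ[A'] M'}

theorem totalD_totalD (hd : ∀ n x, d n (d (n + 1) x) = 0) (hd' : ∀ n x, d' n (d' (n + 1) x) = 0)
    (t : TotalSpace k P P') : totalD d d' (totalD d d' t) = 0 := by
  refine DFunLike.congr_fun (total_hom_ext
    (f := (totalD d d').toAddMonoidHom.comp (totalD d d').toAddMonoidHom) (g := 0) ?_) t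
  intro i j p q
  change totalD d d' (totalD d d' (totalMk k i j p q)) = 0
  rw [totalD_mk, map_add, map_zsmul, totalD_mk, totalD_mk, lower_lower hd, lower_lower hd',
    map_zero, map_zero, LinearMap.zero_apply, smul_zero]
  -- The mixed terms cancel because the signs for i and i - 1 are opposite. This fails for the
  -- truncated difference 0 - 1 = 0, but there `lower d 0` is zero.
  cases i with
  | zero =>
    have h : lower d 0 p = 0 := rfl
    rw [h, map_zero, LinearMap.zero_apply, smul_zero, add_zero, zero_add, smul_zero]
  | succ i =>
    rw [pow_succ]
    simp

theorem totalπ_totalD (h0 : ∀ x, π (d 0 x) = 0) (h0' : ∀ x, π' (d' 0 x) = 0)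
    (t : TotalSpace k P P') : totalπ π π' (totalD d d' t) = 0 := by
  refine DFunLike.congr_fun (total_hom_ext
    (f := (totalπ π π').toAddMonoidHom.comp (totalD d d').toAddMonoidHom) (g := 0) ?_) t
  intro i j p q
  change totalπ π π' (totalD d d' (totalMk k i j p q)) = 0
  rw [totalD_mk, map_add, map_zsmul, totalπ_mk, totalπ_mk, augment_lower h0, augment_lower h0']
  have h1 : OuterTensor.mk k 0 (augment π' j q) = (0 : OuterTensor k M M') :=
    TensorProduct.zero_tmul _ _
  have h2 : OuterTensor.mk k (augment π i p) 0 = (0 : OuterTensor k M M') :=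
    TensorProduct.tmul_zero _ _
  rw [h1, h2, smul_zero, add_zero]

theorem totalD_ι_mem (d : ∀ n, P (n + 1) →ₗ[A] P n) (d' : ∀ n, P' (n + 1) →ₗ[A'] P' n) (n : ℕ)
    (y : TotalTerm k P P' (n + 1)) :
    totalD d d' (totalι k A A' P P' (n + 1) y) ∈ LinearMap.range (totalι k A A' P P' n) := by
  refine totalTerm_induction (k := k) (A := A) (A' := A') (p := fun y =>
    totalD d d' (totalι k A A' P P' (n + 1) y) ∈ LinearMap.range (totalι k A A' P P' n)) ?_ ?_ ?_ y
  · rw [map_zero, map_zero]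
    exact zero_mem _
  · intro x y hx hy
    rw [map_add, map_add]
    exact add_mem hx hy
  · intro i j h p q
    rw [totalι_mk, totalD_mk]
    refine add_mem ?_ (zsmul_mem ?_ _)
    · cases i with
      | zero =>
        have h : lower d 0 p = 0 := rfl
        rw [h, map_zero, LinearMap.zero_apply]
        exact zero_mem _
      | succ i => exact totalMk_mem_range (by omega) _ _
    · cases j with
      | zero =>
        have h : lower d' 0 q = 0 := rfl
        rw [h, map_zero]
        exact zero_mem _
      | succ j => exact totalMk_mem_range (by omega) _ _

theorem totalD_ι_zero (d : ∀ n, P (n + 1) →ₗ[A] P n) (d' : ∀ n, P' (n + 1) →ₗ[A'] P' n)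
    (y : TotalTerm k P P' 0) : totalD d d' (totalι k A A' P P' 0 y) = 0 := by
  refine totalTerm_induction (k := k) (A := A) (A' := A') (p := fun y =>
    totalD d d' (totalι k A A' P P' 0 y) = 0) ?_ ?_ ?_ y
  · rw [map_zero, map_zero]
  · intro x y hx hy
    rw [map_add, map_add, hx, hy, add_zero]
  · intro i j h p q
    obtain rfl : i = 0 := by omega
    obtain rfl : j = 0 := by omega
    have h1 : lower d 0 p = 0 := rfl
    have h2 : lower d' 0 q = 0 := rfl
    rw [totalι_mk, totalD_mk, h1, h2, map_zero, map_zero, LinearMap.zero_apply, smul_zero, add_zero]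

theorem totalπ_ι_succ (π : P 0 →ₗ[A] M) (π' : P' 0 →ₗ[A'] M') (n : ℕ)
    (y : TotalTerm k P P' (n + 1)) : totalπ π π' (totalι k A A' P P' (n + 1) y) = 0 := by
  refine totalTerm_induction (k := k) (A := A) (A' := A') (p := fun y =>
    totalπ π π' (totalι k A A' P P' (n + 1) y) = 0) ?_ ?_ ?_ y
  · rw [map_zero, map_zero]
  · intro x y hx hy
    rw [map_add, map_add, hx, hy, add_zero]
  · intro i j h p q
    rw [totalι_mk, totalπ_mk]
    cases i with
    | zero =>
      obtain ⟨j, rfl⟩ : ∃ j', j = j' + 1 := ⟨n, by omega⟩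
      exact TensorProduct.tmul_zero _ _
    | succ i => exact TensorProduct.zero_tmul _ _

theorem totalH_ι_mem (C : Contraction k d π) (C' : Contraction k d' π') (n : ℕ)
    (y : TotalTerm k P P' n) :
    totalH C C' (totalι k A A' P P' n y) ∈ LinearMap.range (totalι k A A' P P' (n + 1)) := by
  refine totalTerm_induction (k := k) (A := A) (A' := A') (p := fun y =>
    totalH C C' (totalι k A A' P P' n y) ∈ LinearMap.range (totalι k A A' P P' (n + 1))) ?_ ?_ ?_ y
  · rw [map_zero, map_zero]
    exact zero_mem _
  · intro x y hx hy
    rw [map_add, map_add]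
    exact add_mem hx hy
  · intro i j h p q
    rw [totalι_mk, totalH_mk]
    exact add_mem (totalMk_mem_range (by omega) _ _) (totalMk_mem_range (by omega) _ _)

/-- The differential of the total complex. -/
def termD (d : ∀ n, P (n + 1) →ₗ[A] P n) (d' : ∀ n, P' (n + 1) →ₗ[A'] P' n) (n : ℕ) :
    TotalTerm k P P' (n + 1) →ₗ[A ⊗[k] A'] TotalTerm k P P' n :=
  totalR k A A' P P' n ∘ₗ totalD d d' ∘ₗ totalι k A A' P P' (n + 1)

/-- The augmentation of the total complex. -/
def termπ (π : P 0 →ₗ[A] M) (π' : P' 0 →ₗ[A'] M') :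
    TotalTerm k P P' 0 →ₗ[A ⊗[k] A'] OuterTensor k M M' :=
  totalπ π π' ∘ₗ totalι k A A' P P' 0

theorem totalι_termD (n : ℕ) (y : TotalTerm k P P' (n + 1)) :
    totalι k A A' P P' n (termD d d' n y) = totalD d d' (totalι k A A' P P' (n + 1) y) :=
  totalι_R (totalD_ι_mem d d' n y)

theorem totalι_injective (n : ℕ) : Function.Injective (totalι k A A' P P' n) :=
  Function.LeftInverse.injective (totalR_ι n)

/-- For a cycle killed by the augmentation the homotopy formula reduces to y = d(H y). -/
theorem exists_termD_eq (C : Contraction k d π) (C' : Contraction k d' π')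
    (h0 : ∀ x, π (d 0 x) = 0) (n : ℕ) (y : TotalTerm k P P' n)
    (h : totalD d d' (totalι k A A' P P' n y) = 0)
    (h' : totalπ π π' (totalι k A A' P P' n y) = 0) : ∃ z, termD d d' n z = y := by
  refine ⟨totalR k A A' P P' (n + 1) (totalH C C' (totalι k A A' P P' n y)),
    totalι_injective (A := A) (A' := A') n ?_⟩
  have := totalD_totalH C C' h0 (totalι k A A' P P' n y)
  rw [h, h', map_zero, map_zero, map_zero, add_zero, add_zero] at this
  rw [totalι_termD, totalι_R (totalH_ι_mem C C' n y), this]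

theorem exact_termD (C : Contraction k d π) (C' : Contraction k d' π')
    (h0 : ∀ x, π (d 0 x) = 0) (hd : ∀ n x, d n (d (n + 1) x) = 0)
    (hd' : ∀ n x, d' n (d' (n + 1) x) = 0) (n : ℕ) :
    Function.Exact (termD (k := k) d d' (n + 1)) (termD d d' n) := by
  intro y
  refine ⟨fun hy => ?_, ?_⟩
  · refine exists_termD_eq C C' h0 _ y ?_ (totalπ_ι_succ π π' n y)
    rw [← totalι_termD, hy, map_zero]
  · rintro ⟨z, rfl⟩
    refine totalι_injective (A := A) (A' := A') n ?_
    rw [totalι_termD, totalι_termD, totalD_totalD hd hd', map_zero]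

theorem exact_termπ (C : Contraction k d π) (C' : Contraction k d' π')
    (h0 : ∀ x, π (d 0 x) = 0) (h0' : ∀ x, π' (d' 0 x) = 0) :
    Function.Exact (termD (k := k) d d' 0) (termπ π π') := by
  intro y
  refine ⟨fun hy => exists_termD_eq C C' h0 _ y (totalD_ι_zero d d' y) hy, ?_⟩
  rintro ⟨z, rfl⟩
  change totalπ π π' (totalι k A A' P P' 0 (termD d d' 0 z)) = 0
  rw [totalι_termD, totalπ_totalD h0 h0']

theorem termπ_surjective (hπ : Function.Surjective π) (hπ' : Function.Surjective π') :
    Function.Surjective (termπ (k := k) π π') := by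
  intro x
  induction x using OuterTensor.induction with
  | mk m n =>
    obtain ⟨p, rfl⟩ := hπ m
    obtain ⟨q, rfl⟩ := hπ' n
    refine ⟨termLof k A A' P P' (add_zero 0) (OuterTensor.mk k p q), ?_⟩
    exact (congrArg (totalπ π π') (totalι_mk _ p q)).trans (totalπ_mk π π' 0 0 p q)
  | add x y hx hy =>
    obtain ⟨a, rfl⟩ := hx
    obtain ⟨b, rfl⟩ := hy
    exact ⟨a + b, map_add _ _ _⟩

theorem projective_totalTerm [∀ n, Module.Projective A (P n)] [∀ n, Module.Projective A' (P' n)]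
    (n : ℕ) : Module.Projective (A ⊗[k] A') (TotalTerm k P P' n) := by
  have : ∀ x : {x : ℕ × ℕ // x.1 + x.2 = n}, Module.Projective (A ⊗[k] A') (Bigraded k P P' x.1) :=
    fun x => OuterTensor.projective
  exact Module.Projective.directSum

theorem finrank_totalTerm [∀ n, Module.Finite k (P n)] [∀ n, Module.Finite k (P' n)] (n : ℕ) :
    Module.finrank k (TotalTerm k P P' n) =
      convolution (fun n => Module.finrank k (P n)) (fun n => Module.finrank k (P' n)) n := by
  have e : ∀ x : ℕ × ℕ, x ∈ Finset.HasAntidiagonal.antidiagonal n ↔ x.1 + x.2 = n :=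
    fun x => Finset.HasAntidiagonal.mem_antidiagonal
  have : Fintype {x : ℕ × ℕ // x.1 + x.2 = n} := Fintype.subtype _ e
  have hf : ∀ x : {x : ℕ × ℕ // x.1 + x.2 = n}, Module.Finite k (Bigraded k P P' x.1) :=
    fun x => inferInstanceAs (Module.Finite k (P x.1.1 ⊗[k] P' x.1.2))
  rw [Module.finrank_directSum, convolution, ← Finset.sum_subtype _ e
    (fun x => Module.finrank k (Bigraded k P P' x))]
  exact Finset.sum_congr rfl fun x _ => Module.finrank_tensorProduct

end Total

/-! ### The radical of A ⊗ A' and minimality of the total complex -/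

section Minimal

variable {k : Type*} {A A' : Type*} [Field k] [Ring A] [Algebra k A] [Ring A'] [Algebra k A']

/-- Suppose a maximal left ideal m misses f(a). Then B = m + B f(a), and B f(a) lies in Jac(A) B for
the A-module structure given by f. Nakayama over A, which needs no finiteness of B, forces m = B. -/
theorem map_mem_jacobson {B : Type*} [Ring B] [IsArtinianRing A] (f : A →+* B)
    (h : ∀ a ∈ Ring.jacobson A, ∀ b : B, b * f a ∈
      AddSubmonoid.closure {y | ∃ j ∈ Ring.jacobson A, ∃ c, y = f j * c})
    {a : A} (ha : a ∈ Ring.jacobson A) : f a ∈ Ring.jacobson B := by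
  refine Submodule.mem_sInf.2 fun m hm => ?_
  by_contra hne
  let _ : Module A B := Module.compHom B f
  let m' : Submodule A B :=
    { m.toAddSubmonoid with smul_mem' := fun a x hx => m.smul_mem (f a) hx }
  have key : m' = ⊤ := by
    refine eq_top_of_sup_jacobson_smul (top_le_iff.1 fun b _ => ?_)
    have hsup : m ⊔ Submodule.span B {f a} = ⊤ := hm.2 _ (left_lt_sup.2 fun hle =>
      hne (hle (Submodule.mem_span_singleton_self _)))
    obtain ⟨x, hx, y, hy, rfl⟩ := Submodule.mem_sup.1 (hsup.symm ▸ trivial :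
      b ∈ m ⊔ Submodule.span B {f a})
    obtain ⟨c, rfl⟩ := Submodule.mem_span_singleton.1 hy
    refine Submodule.mem_sup.2 ⟨x, hx, _, ?_, rfl⟩
    have hle : AddSubmonoid.closure {y | ∃ j ∈ Ring.jacobson A, ∃ c, y = f j * c} ≤
        (Ring.jacobson A • (⊤ : Submodule A B)).toAddSubmonoid := by
      refine AddSubmonoid.closure_le.2 ?_
      rintro _ ⟨j, hj, c, rfl⟩
      exact Submodule.smul_mem_smul (N := (⊤ : Submodule A B)) (n := c) hj trivial
    exact hle (h a ha c)
  refine hm.1 (top_le_iff.1 fun x _ => ?_)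
  exact (key.symm ▸ trivial : x ∈ m')

theorem tmul_one_mem_jacobson [IsArtinianRing A] {a : A} (ha : a ∈ Ring.jacobson A) :
    a ⊗ₜ[k] (1 : A') ∈ Ring.jacobson (A ⊗[k] A') := by
  refine map_mem_jacobson (Algebra.TensorProduct.includeLeftRingHom : A →+* A ⊗[k] A')
    (fun a ha b => ?_) ha
  induction b with
  | zero => rw [zero_mul]; exact zero_mem _
  | add b c hb hc => rw [add_mul]; exact add_mem hb hc
  | tmul x y =>
    refine AddSubmonoid.subset_closure ⟨x * a, Ideal.mul_mem_left _ x ha, 1 ⊗ₜ y, ?_⟩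
    simp

theorem one_tmul_mem_jacobson [IsArtinianRing A'] {a : A'} (ha : a ∈ Ring.jacobson A') :
    (1 : A) ⊗ₜ[k] a ∈ Ring.jacobson (A ⊗[k] A') := by
  refine map_mem_jacobson
    (Algebra.TensorProduct.includeRight : A' →ₐ[k] A ⊗[k] A').toRingHom (fun a ha b => ?_) ha
  induction b with
  | zero => rw [zero_mul]; exact zero_mem _
  | add b c hb hc => rw [add_mul]; exact add_mem hb hc
  | tmul x y =>
    refine AddSubmonoid.subset_closure ⟨y * a, Ideal.mul_mem_left _ y ha, x ⊗ₜ 1, ?_⟩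
    simp

variable
  {P P' : ℕ → Type*} [∀ n, AddCommGroup (P n)] [∀ n, Module k (P n)] [∀ n, Module A (P n)]
  [∀ n, IsScalarTower k A (P n)] [∀ n, AddCommGroup (P' n)] [∀ n, Module k (P' n)]
  [∀ n, Module A' (P' n)] [∀ n, IsScalarTower k A' (P' n)]
  {d : ∀ n, P (n + 1) →ₗ[A] P n} {d' : ∀ n, P' (n + 1) →ₗ[A'] P' n}

theorem smul_totalMk (a : A) (a' : A') (i j : ℕ) (p : P i) (q : P' j) :
    (a ⊗ₜ[k] a') • totalMk k i j p q = totalMk k i j (a • p) (a' • q) :=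
  ((totalLof k A A' P P' i j).map_smul (a ⊗ₜ[k] a') (OuterTensor.mk k p q)).symm

theorem totalMk_left_mem [IsArtinianRing A] {i j : ℕ} {p : P i}
    (hp : p ∈ Ring.jacobson A • (⊤ : Submodule A (P i))) (q : P' j) : totalMk k i j p q ∈
      Ring.jacobson (A ⊗[k] A') • (⊤ : Submodule (A ⊗[k] A') (TotalSpace k P P')) := by
  induction hp using Submodule.smul_induction_on' with
  | smul a ha p hp =>
    have := smul_totalMk (k := k) a (1 : A') i j p q
    rw [one_smul] at this
    rw [← this]
    exact Submodule.smul_mem_smul (tmul_one_mem_jacobson ha) trivial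
  | add x hx y hy h1 h2 =>
    rw [map_add, LinearMap.add_apply]
    exact add_mem h1 h2

theorem totalMk_right_mem [IsArtinianRing A'] {i j : ℕ} (p : P i) {q : P' j}
    (hq : q ∈ Ring.jacobson A' • (⊤ : Submodule A' (P' j))) : totalMk k i j p q ∈
      Ring.jacobson (A ⊗[k] A') • (⊤ : Submodule (A ⊗[k] A') (TotalSpace k P P')) := by
  induction hq using Submodule.smul_induction_on' with
  | smul a ha q hq =>
    have := smul_totalMk (k := k) (1 : A) a i j p q
    rw [one_smul] at this
    rw [← this]
    exact Submodule.smul_mem_smul (one_tmul_mem_jacobson ha) trivial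
  | add x hx y hy h1 h2 =>
    rw [map_add]
    exact add_mem h1 h2

theorem lower_mem_jacobson_smul
    (h : ∀ n, LinearMap.range (d n) ≤ Ring.jacobson A • (⊤ : Submodule A (P n))) (n : ℕ) (x : P n) :
    lower d n x ∈ Ring.jacobson A • (⊤ : Submodule A (P (n - 1))) :=
  match n, x with
  | 0, _ => zero_mem _
  | n + 1, x => h n ⟨x, rfl⟩

theorem totalD_mem_jacobson_smul [IsArtinianRing A] [IsArtinianRing A']
    (h : ∀ n, LinearMap.range (d n) ≤ Ring.jacobson A • (⊤ : Submodule A (P n)))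
    (h' : ∀ n, LinearMap.range (d' n) ≤ Ring.jacobson A' • (⊤ : Submodule A' (P' n)))
    (n : ℕ) (y : TotalTerm k P P' n) : totalD d d' (totalι k A A' P P' n y) ∈
      Ring.jacobson (A ⊗[k] A') • (⊤ : Submodule (A ⊗[k] A') (TotalSpace k P P')) := by
  refine totalTerm_induction (k := k) (A := A) (A' := A') (p := fun y =>
    totalD d d' (totalι k A A' P P' n y) ∈
      Ring.jacobson (A ⊗[k] A') • (⊤ : Submodule (A ⊗[k] A') (TotalSpace k P P'))) ?_ ?_ ?_ y
  · rw [map_zero, map_zero]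
    exact zero_mem _
  · intro x y hx hy
    rw [map_add, map_add]
    exact add_mem hx hy
  · intro i j hij p q
    rw [totalι_mk, totalD_mk]
    exact add_mem (totalMk_left_mem (lower_mem_jacobson_smul h i p) q)
      (zsmul_mem (totalMk_right_mem p (lower_mem_jacobson_smul h' j q)) _)

theorem range_termD_le [IsArtinianRing A] [IsArtinianRing A']
    (h : ∀ n, LinearMap.range (d n) ≤ Ring.jacobson A • (⊤ : Submodule A (P n)))
    (h' : ∀ n, LinearMap.range (d' n) ≤ Ring.jacobson A' • (⊤ : Submodule A' (P' n))) (n : ℕ) :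
    LinearMap.range (termD (k := k) d d' n) ≤
      Ring.jacobson (A ⊗[k] A') • (⊤ : Submodule (A ⊗[k] A') (TotalTerm k P P' n)) := by
  rintro _ ⟨y, rfl⟩
  have := Submodule.mem_map_of_mem (f := totalR k A A' P P' n)
    (totalD_mem_jacobson_smul (k := k) h h' (n + 1) y)
  rw [Submodule.map_smul''] at this
  exact Submodule.smul_mono le_rfl le_top this

end Minimal

/-! ### Trivial modules and the minimal resolution over A ⊗ A' -/

section Trivial

open scoped ModuleCat.Algebra

variable {k A A' : Type u} [Field k] [Ring A] [Algebra k A] [Ring A'] [Algebra k A']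

/-- A one-dimensional module on which `A` acts through `ε`, as a vector space. -/
def trivialEquiv {M : ModuleCat.{u} A} (ε : A →ₐ[k] k) (t : k ≃+ M)
    (ht : ∀ a x, t (ε a * x) = a • t x) : k ≃ₗ[k] M :=
  { t with
    map_smul' := fun c x => by
      have := ht (algebraMap k A c) x
      rw [AlgHom.commutes, algebraMap_smul] at this
      exact this }

/-- The identification k ⊗ k = k. The modules enter through additive bijections with k compatible
with the augmentations; k-linearity is automatic, because augmentations fix the scalars. -/
theorem exists_trivialModule_equiv {M : ModuleCat.{u} A} {M' : ModuleCat.{u} A'}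
    {N : ModuleCat.{u} (A ⊗[k] A')} (ε : A →ₐ[k] k) (ε' : A' →ₐ[k] k) (t : k ≃+ M)
    (ht : ∀ a x, t (ε a * x) = a • t x) (t' : k ≃+ M') (ht' : ∀ a x, t' (ε' a * x) = a • t' x)
    (t'' : k ≃+ N) (ht'' : ∀ a x, t'' (tensorAugmentation ε ε' a * x) = a • t'' x) :
    Nonempty (OuterTensor k M M' ≃ₗ[A ⊗[k] A'] N) := by
  let e : OuterTensor k M M' ≃ₗ[k] k :=
    (TensorProduct.congr (trivialEquiv ε t ht).symm (trivialEquiv ε' t' ht').symm).trans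
      (TensorProduct.lid k k)
  let f : OuterTensor k M M' →+ N := t''.toAddMonoidHom.comp e.toLinearMap.toAddMonoidHom
  refine ⟨{ e.toAddEquiv.trans t'' with map_smul' := OuterTensor.map_smul_of_pure f ?_ }⟩
  intro a a' m n
  obtain ⟨x, rfl⟩ := t.surjective m
  obtain ⟨y, rfl⟩ := t'.surjective n
  have he : ∀ x y, e (OuterTensor.mk k (t x) (t' y)) = x * y := by
    intro x y
    change t.symm (t x) * t'.symm (t' y) = x * y
    rw [AddEquiv.symm_apply_apply, AddEquiv.symm_apply_apply]
  change t'' (e (OuterTensor.mk k (a • t x) (a' • t' y))) =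
    (a ⊗ₜ[k] a') • t'' (e (OuterTensor.mk k (t x) (t' y)))
  rw [← ht, ← ht', he, he, ← ht'']
  have h : tensorAugmentation ε ε' (a ⊗ₜ[k] a') = ε a * ε' a' := by simp
  rw [h, mul_mul_mul_comm]

theorem finrank_restrictScalars (Y : Type*) [AddCommGroup Y] [Module k Y] [Module A Y]
    [IsScalarTower k A Y] :
    @Module.finrank k Y _ _ (Module.restrictScalars k A Y) = Module.finrank k Y := by
  congr 1
  exact Module.ext' _ _ fun c y => algebraMap_smul A c y

open CategoryTheory in
/-- The total complex of the outer tensor product of minimal resolutions is a minimal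
resolution. -/
theorem exists_isMinimal_outerTensor [IsArtinianRing A] [IsArtinianRing A']
    {M : ModuleCat.{u} A} {M' : ModuleCat.{u} A'}
    {N : ModuleCat.{u} (A ⊗[k] A')} (e : OuterTensor k M M' ≃ₗ[A ⊗[k] A'] N)
    {P : ProjectiveResolution M} {P' : ProjectiveResolution M'} (hP : IsMinimal P)
    (hP' : IsMinimal P') [∀ n, Module.Finite k (P.complex.X n)]
    [∀ n, Module.Finite k (P'.complex.X n)] :
    ∃ Q : ProjectiveResolution N, IsMinimal Q ∧ ∀ n, Module.finrank k (Q.complex.X n) =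
      convolution (fun n => Module.finrank k (P.complex.X n))
        (fun n => Module.finrank k (P'.complex.X n)) n := by
  obtain ⟨C⟩ := exists_contraction k (P := fun n => P.complex.X n)
    (fun n => (P.complex.d (n + 1) n).hom) (P.π.f 0).hom (exact_d_π P) (exact_d_d P)
  obtain ⟨C'⟩ := exists_contraction k (P := fun n => P'.complex.X n)
    (fun n => (P'.complex.d (n + 1) n).hom) (P'.π.f 0).hom (exact_d_π P') (exact_d_d P')
  have h0 := fun x => (exact_d_π P).apply_apply_eq_zero x
  have h0' := fun x => (exact_d_π P').apply_apply_eq_zero x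
  have hd := fun n x => (exact_d_d P n).apply_apply_eq_zero x
  have hd' := fun n x => (exact_d_d P' n).apply_apply_eq_zero x
  have hproj := projective_X P
  have hproj' := projective_X P'
  have hmin := range_termD_le (k := k) (P := fun n => P.complex.X n) (P' := fun n => P'.complex.X n)
    hP hP'
  let X : ℕ → ModuleCat.{u} (A ⊗[k] A') := fun n => ModuleCat.of (A ⊗[k] A')
    (TotalTerm k (fun n => P.complex.X n) (fun n => P'.complex.X n) n)
  let δ : ∀ n, X (n + 1) ⟶ X n := fun n => ModuleCat.ofHom
    (termD (fun n => (P.complex.d (n + 1) n).hom) (fun n => (P'.complex.d (n + 1) n).hom) n)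
  let θ : X 0 ⟶ N := ModuleCat.ofHom
    (e.toLinearMap ∘ₗ termπ (P := fun n => P.complex.X n) (P' := fun n => P'.complex.X n)
      (P.π.f 0).hom (P'.π.f 0).hom)
  have hX : ∀ n, Module.Projective (A ⊗[k] A') (X n) := fun n =>
    projective_totalTerm (P := fun n => P.complex.X n) (P' := fun n => P'.complex.X n) n
  have hθ : Function.Surjective θ.hom :=
    e.surjective.comp (termπ_surjective (surjective_π P) (surjective_π P'))
  have hδ0 : Function.Exact (δ 0).hom θ.hom := fun y =>
    (map_eq_zero_iff e e.injective).trans (exact_termπ C C' h0 h0' y)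
  have hδ : ∀ n, Function.Exact (δ (n + 1)).hom (δ n).hom := exact_termD C C' h0 hd hd'
  refine ⟨mkResolution X δ θ hX hθ hδ0 hδ, isMinimal_mkResolution X δ θ hX hθ hδ0 hδ hmin,
    fun n => ?_⟩
  have : IsScalarTower k (A ⊗[k] A')
      (TotalTerm k (fun n => P.complex.X n) (fun n => P'.complex.X n) n) :=
    inferInstanceAs (IsScalarTower k (A ⊗[k] A') (Π₀ x : {x : ℕ × ℕ // x.1 + x.2 = n},
      Bigraded k (fun n => P.complex.X n) (fun n => P'.complex.X n) x.1))
  exact (finrank_restrictScalars (k := k) (A := A ⊗[k] A') (TotalTerm k (fun n => P.complex.X n)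
    (fun n => P'.complex.X n) n)).trans (finrank_totalTerm (k := k) (P := fun n => P.complex.X n)
      (P' := fun n => P'.complex.X n) n)

end Trivial

end HochschildTheory
end

noncomputable section

set_option linter.unusedSectionVars false

namespace HochschildTheory

/-! ### The action of the Hochschild cohomology ring on `Ext` -/

section Action

variable {k : Type u} {A : Type v} {R : Type w} [Field k] [Ring A] [Algebra k A] [Ring R]
  [Algebra k R]

instance finite_HH [Module.Finite k A] [Module.Finite k R] (ρ : A →ₐ[k] R) (n : ℕ) :
    Module.Finite k (HH ρ n) :=
  Module.Finite.of_surjective (HH.mk ρ n) (HH.mk_surjective ρ n)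

/-- Multiplication on the right by a class of degree `0`. -/
def HH.mulRightZero (ρ : A →ₐ[k] R) (z : HH ρ 0) (n : ℕ) : HH ρ n →ₗ[k] HH ρ n :=
  (HH.mul ρ n 0).flip z

theorem mul_of_zero (ρ : A →ₐ[k] R) (z : HH ρ 0) (w : ⨁ n, HH ρ n) (n : ℕ) :
    (w * DirectSum.of (HH ρ) 0 z) n = HH.mulRightZero ρ z n (w n) := by
  have h : (AddMonoidHom.mulRight (DirectSum.of (HH ρ) 0 z)) =
      DirectSum.map fun n => (HH.mulRightZero ρ z n).toAddMonoidHom := by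
    refine DirectSum.addHom_ext fun i y => ?_
    rw [DirectSum.map_of]
    exact DirectSum.of_mul_of y z
  exact (congrArg (fun v : ⨁ n, HH ρ n => v n) (DFunLike.congr_fun h w)).trans
    (DirectSum.map_apply _ n w)

/-- The classes that are fixed by right multiplication by a class of degree `0`. -/
def HH.fixed (ρ : A →ₐ[k] R) (z : HH ρ 0) (n : ℕ) : Submodule k (HH ρ n) :=
  LinearMap.eqLocus (HH.mulRightZero ρ z n) LinearMap.id

theorem HH.pushAlgHom_of (σ : A →ₐ[k] R) (n : ℕ) (y : HH (AlgHom.id k A) n) :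
    HH.pushAlgHom σ (DirectSum.of _ n y) = DirectSum.of _ n (HH.push σ n y) :=
  DirectSum.toAddMonoid_of _ _ _

theorem exists_of_eq_of_eq {E : ℕ → Type*} [∀ n, AddCommMonoid (E n)] {m n : ℕ} (h : m = n)
    (x : E m) : ∃ y : E n, DirectSum.of E m x = DirectSum.of E n y := by
  subst h
  exact ⟨x, rfl⟩

/-- A finitely generated graded subalgebra is generated by finitely many homogeneous elements. -/
theorem exists_homogeneous_generators {H : Subalgebra k (HochschildRing k A)} (hH : FG1 H) :
    ∃ G : Finset H, Algebra.adjoin k (G : Set H) = ⊤ ∧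
      ∀ g ∈ G, ∃ n y, (g : HochschildRing k A) = DirectSum.of _ n y := by
  classical
  obtain ⟨s, hs⟩ := hH.fg
  let G₀ : Finset (HochschildRing k A) :=
    s.biUnion fun x => (DFinsupp.support x).image fun n => DirectSum.of _ n (x n)
  have hG₀ : Algebra.adjoin k (G₀ : Set (HochschildRing k A)) = H := by
    refine le_antisymm (Algebra.adjoin_le fun g hg => ?_) (hs ▸ Algebra.adjoin_le fun x hx => ?_)
    · obtain ⟨x, hx, hg⟩ := Finset.mem_biUnion.1 hg
      obtain ⟨n, -, rfl⟩ := Finset.mem_image.1 hg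
      exact hH.homogeneous x (hs ▸ Algebra.subset_adjoin hx) n
    · rw [← DirectSum.sum_support_of x]
      exact sum_mem fun n hn => Algebra.subset_adjoin
        (Finset.mem_biUnion.2 ⟨x, hx, Finset.mem_image.2 ⟨n, hn, rfl⟩⟩)
  have hle : ∀ g ∈ G₀, g ∈ H := fun g hg => hG₀ ▸ Algebra.subset_adjoin hg
  refine ⟨G₀.subtype (· ∈ H), ?_, fun g hg => ?_⟩
  · refine Subalgebra.map_injective (f := H.val) Subtype.val_injective ?_
    rw [AlgHom.map_adjoin, Algebra.map_top, Subalgebra.range_val]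
    refine Eq.trans (congrArg (Algebra.adjoin k) (Set.ext fun g => ?_)) hG₀
    constructor
    · rintro ⟨g, hg, rfl⟩
      exact Finset.mem_subtype.1 hg
    · exact fun hg => ⟨⟨g, hle g hg⟩, Finset.mem_subtype.2 hg, rfl⟩
  · obtain ⟨x, -, hg⟩ := Finset.mem_biUnion.1 (Finset.mem_subtype.1 hg)
    obtain ⟨n, -, h⟩ := Finset.mem_image.1 hg
    exact ⟨n, _, h.symm⟩

/-- H acts on the left through φ, so the classes with w z = w form an H-submodule, homogeneous
because z has degree 0. A finitely generated commutative algebra H is Noetherian, and so is the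
finitely generated H-module Ext; Hilbert–Serre applies. -/
theorem isQuasiPolynomial_finrank_fixed [FiniteDimensional k A] (h : SatisfiesFG k A)
    (z : HH (Algebra.lsmul k k (A ⧸ Ring.jacobson A) : A →ₐ[k] _) 0) :
    IsQuasiPolynomial fun n => (Module.finrank k
      (HH.fixed (Algebra.lsmul k k (A ⧸ Ring.jacobson A) : A →ₐ[k] _) z n) : ℤ) := by
  obtain ⟨H, h1, h2⟩ := h
  let ψ := tensorHom k A (A ⧸ Ring.jacobson A)
  let S := ExtRing k A (A ⧸ Ring.jacobson A)
  let E := HH (Algebra.lsmul k k (A ⧸ Ring.jacobson A) : A →ₐ[k] _)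
  let _ : CommRing H :=
    { (inferInstance : Ring H) with
      mul_comm := fun x y => Subtype.ext (h1.commutative x.1 x.2 y.1 y.2) }
  let _ : Module H S := Module.compHom _ (ψ.comp H.val).toRingHom
  have hsmul : ∀ (x : H) (w : S), x • w = ψ x.1 * w := fun x w => rfl
  have : IsScalarTower k H S := ⟨fun c x w => by
    rw [hsmul, hsmul, ← smul_mul_assoc, ← map_smul]
    rfl⟩
  have hfin : Module.Finite H S := h2
  obtain ⟨G, hG, hGhom⟩ := exists_homogeneous_generators h1
  have : Algebra.FiniteType k H := ⟨⟨G, hG⟩⟩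
  have : IsNoetherianRing H := Algebra.FiniteType.isNoetherianRing k H
  have : IsNoetherian H S := isNoetherian_of_isNoetherianRing_of_finite H S
  have hdeg : ∀ g ∈ G, ∃ d, RaisesDegree E g d := by
    intro g hg
    obtain ⟨d, y, hy⟩ := hGhom g hg
    refine ⟨d, fun n w => ?_⟩
    -- The product lies in degree d + n, while `RaisesDegree` asks for degree n + d.
    obtain ⟨v, hv⟩ := exists_of_eq_of_eq (E := E) (add_comm d n)
      (GradedMonoid.GMul.mul (HH.push _ d y) w)
    refine ⟨v, Eq.trans ?_ hv⟩
    rw [hsmul, hy]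
    exact (congrArg (· * DirectSum.of E n w) (HH.pushAlgHom_of _ d y)).trans
      (DirectSum.of_mul_of _ _)
  let W : Submodule H S :=
    { carrier := {w | w * DirectSum.of E 0 z = w}
      add_mem' := fun {a b} (ha : a * _ = a) (hb : b * _ = b) => (add_mul a b _).trans (by
        rw [ha, hb])
      zero_mem' := zero_mul _
      smul_mem' := fun x w (hw : w * _ = w) => by
        change ψ x.1 * w * _ = ψ x.1 * w
        rw [mul_assoc, hw] }
  have hmem : ∀ w, w ∈ W ↔ ∀ n, w n ∈ HH.fixed _ z n := fun w =>
    ⟨fun hw n => (mul_of_zero _ z w n).symm.trans (congrArg (fun v : S => v n) hw),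
      fun hw => DirectSum.ext_component k fun n => (mul_of_zero _ z w n).trans (hw n)⟩
  have hof : ∀ n (y : E n), DirectSum.of E n y ∈ W ↔ y ∈ HH.fixed _ z n := by
    intro n y
    rw [hmem]
    refine ⟨fun hw => ?_, fun hy m => ?_⟩
    · have := hw n
      rwa [DirectSum.of_eq_same] at this
    · by_cases hm : m = n
      · subst hm
        rwa [DirectSum.of_eq_same]
      · rw [DirectSum.of_eq_of_ne _ _ _ hm]
        exact zero_mem _
  have hW : IsHomogeneousSubmodule W := fun w hw n => (hof n _).2 ((hmem w).1 hw n)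
  have hdp : ∀ n, degreePart k W n = HH.fixed _ z n := fun n =>
    Submodule.ext fun y => mem_degreePart.trans (hof n y)
  have key := isQuasiPolynomial_finrank (k := k) hG hdeg hW
  exact (funext fun n => congrArg (fun U : Submodule k (E n) => (Module.finrank k U : ℤ))
    (hdp n) : (fun n => (Module.finrank k (degreePart k W n) : ℤ)) = _) ▸ key

end Action

/-! ### Growth of the minimal resolution of a summand of A / Jac(A) -/

section Growth

open CategoryTheory
open scoped ModuleCat.Algebra

variable {k A : Type u} [Field k] [Ring A] [Algebra k A]

/-- The dimensions of the terms of a minimal resolution of a direct summand of `A / Jac(A)` have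
polynomial growth in the sense of `HasGrowth`. -/
theorem exists_hasGrowth_finrank [FiniteDimensional k A] (hA : SatisfiesFG k A)
    {M : ModuleCat.{u} A} {P : ProjectiveResolution M} (hP : IsMinimal P)
    [∀ n, Module.Finite k (P.complex.X n)] (π : (A ⧸ Ring.jacobson A) →ₗ[A] M)
    (hπ : Function.Surjective π) : ∃ c, HasGrowth (fun n => Module.finrank k (P.complex.X n)) c := by
  have : IsArtinianRing A := isArtinian_of_tower k inferInstance
  -- A quotient of the semisimple module A / Jac(A) is a direct summand, and ι ∘ π is the
  -- corresponding idempotent.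
  obtain ⟨ι, hι⟩ := IsSemisimpleModule.lifting_property π hπ LinearMap.id
  have hι' : ∀ m, π (ι m) = m := LinearMap.congr_fun hι
  let X : BarModule k A := ⟨A ⧸ Ring.jacobson A⟩
  have hX : ∀ a ∈ Ring.jacobson A, ∀ x : X, a • x = 0 := fun a ha x => jacobson_smul_eq_zero ha x
  let z : HH X.rep 0 := HH.mk X.rep 0 (endCocycle X (ι.comp π))
  have hq : ∀ n, Module.finrank k (HH.fixed X.rep z n) =
      Module.finrank k (P.complex.X n →ₗ[A] A ⧸ Ring.jacobson A) := by
    intro n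
    have h1 : LinearMap.range (homToHH X π hP hX n) = HH.fixed X.rep z n :=
      Submodule.ext fun x => range_homToHH X hι' hP hX n x
    rw [← h1]
    exact LinearMap.finrank_range_of_inj (homToHH_injective X hι' hP hX n)
  obtain ⟨c, hc⟩ := exists_hasGrowth (isQuasiPolynomial_finrank_fixed hA z)
  refine ⟨c, hc.of_le_mul (C := Module.finrank k A * Module.finrank k (A ⧸ Ring.jacobson A))
    (D := Module.finrank k (A ⧸ Ring.jacobson A)) (fun n => ?_) fun n => ?_⟩
  · exact finrank_le_mul_finrank_hom.trans (Nat.mul_le_mul_left _ (hq n).ge)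
  · exact (hq n).le.trans finrank_hom_le

/-- The radical acts trivially on one-dimensional modules. -/
theorem jacobson_apply_eq_zero [IsArtinianRing A] {M : ModuleCat.{u} A} (ε : A →ₐ[k] k)
    (t : k ≃+ M) (ht : ∀ a x, t (ε a * x) = a • t x) {a : A} (ha : a ∈ Ring.jacobson A) :
    ε a = 0 := by
  by_contra hne
  have h : (⊥ : Submodule A M) = ⊤ := by
    refine eq_top_of_sup_jacobson_smul (top_le_iff.1 fun y _ => Submodule.mem_sup_right ?_)
    have hy : y = a • t ((ε a)⁻¹ * t.symm y) := by
      rw [← ht, mul_inv_cancel_left₀ hne, AddEquiv.apply_symm_apply]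
    rw [hy]
    exact Submodule.smul_mem_smul ha trivial
  have h1 : t 1 = 0 := (Submodule.mem_bot A).1 (h.symm ▸ trivial : t 1 ∈ (⊥ : Submodule A M))
  exact one_ne_zero ((map_eq_zero_iff t t.injective).1 h1)

/-- The trivial module is cyclic and killed by the radical, hence a quotient of A / Jac(A).
Positivity in degree 0 is needed for `growthRate_convolution`. -/
theorem exists_minimal_trivial [FiniteDimensional k A] (hA : SatisfiesFG k A)
    {M : ModuleCat.{u} A} (ε : A →ₐ[k] k)
    (t : k ≃+ M) (ht : ∀ a x, t (ε a * x) = a • t x) :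
    ∃ P : ProjectiveResolution M, IsMinimal P ∧ (∀ n, Module.Finite k (P.complex.X n)) ∧
      0 < Module.finrank k (P.complex.X 0) ∧
      ∃ c, HasGrowth (fun n => Module.finrank k (P.complex.X n)) c := by
  have : IsArtinianRing A := isArtinian_of_tower k inferInstance
  have ht1 : ∀ a, a • t 1 = t (ε a) := fun a => by rw [← ht, mul_one]
  have hs : ∀ m, ∃ a : A, a • t 1 = m := fun m =>
    ⟨algebraMap k A (t.symm m), by rw [ht1, AlgHom.commutes]; exact t.apply_symm_apply m⟩
  have : Module.Finite A M :=
    Module.Finite.of_surjective (LinearMap.toSpanSingleton A M (t 1)) hs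
  obtain ⟨P, hP, hfin⟩ := exists_isMinimal M
  have hfin' : ∀ n, Module.Finite k (P.complex.X n) := fun n =>
    have := hfin n
    Module.Finite.trans A _
  refine ⟨P, hP, hfin', ?_, exists_hasGrowth_finrank hA hP
    ((Ring.jacobson A).liftQ (LinearMap.toSpanSingleton A M (t 1)) fun a ha => ?_) fun m => ?_⟩
  · have : Nontrivial (P.complex.X 0) := by
      obtain ⟨x, hx⟩ := surjective_π P (t 1)
      refine ⟨x, 0, fun h => one_ne_zero (α := k) ((map_eq_zero_iff t t.injective).1 ?_)⟩
      rw [← hx, h]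
      exact map_zero _
    exact Module.finrank_pos
  · refine LinearMap.mem_ker.2 ((ht1 a).trans ?_)
    rw [jacobson_apply_eq_zero ε t ht ha, map_zero]
  · obtain ⟨a, ha⟩ := hs m
    exact ⟨Submodule.Quotient.mk a, ha⟩

end Growth

end HochschildTheory
end

/-! ### Additivity of the complexity of the trivial module -/

theorem mainTheorem12 {k A A' : Type u} [Field k]
    [Ring A] [Algebra k A] [FiniteDimensional k A] [Module.Injective A A]
    [Ring A'] [Algebra k A'] [FiniteDimensional k A'] [Module.Injective A' A']
    (ε : A →ₐ[k] k) (ε' : A' →ₐ[k] k)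
    (hA : HochschildTheory.SatisfiesFG k A) (hA' : HochschildTheory.SatisfiesFG k A') :
    HochschildTheory.complexity k
        (HochschildTheory.trivialModule (HochschildTheory.tensorAugmentation ε ε')) =
      HochschildTheory.complexity k (HochschildTheory.trivialModule ε) +
        HochschildTheory.complexity k (HochschildTheory.trivialModule ε') := by
  open HochschildTheory in
  have : IsArtinianRing A := isArtinian_of_tower k inferInstance
  have : IsArtinianRing A' := isArtinian_of_tower k inferInstance
  have : IsArtinianRing (A ⊗[k] A') := isArtinian_of_tower k inferInstance
  let t : k ≃+ trivialModule ε := AddEquiv.refl k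
  let t' : k ≃+ trivialModule ε' := AddEquiv.refl k
  let t'' : k ≃+ trivialModule (tensorAugmentation ε ε') := AddEquiv.refl k
  obtain ⟨P, hP, hfin, h0, c, hc⟩ := exists_minimal_trivial hA ε t fun _ _ => rfl
  obtain ⟨P', hP', hfin', h0', c', hc'⟩ := exists_minimal_trivial hA' ε' t' fun _ _ => rfl
  obtain ⟨e⟩ := exists_trivialModule_equiv ε ε' t (fun _ _ => rfl) t' (fun _ _ => rfl) t''
    fun _ _ => rfl
  obtain ⟨Q, hQ, hdim⟩ := exists_isMinimal_outerTensor e hP hP'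
  rw [complexity_eq_growthRate k hP, complexity_eq_growthRate k hP', complexity_eq_growthRate k hQ,
    funext hdim]
  exact growthRate_convolution hc hc' h0 h0'
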